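/- **Setting.** Let $n,\mu\ge 1$ be integers, $P_0>0$, and $a=(a(k))_{k\ge0}$ a complex sequence. Let $\sum_k d_\mu(k)x^k=\big(\sum_{j\ge 0}x^{\mu j}\big)^n$, and assume that the series $b_\mu(k)=(D^\mu a)_k=\sum_{m\ge k}a(m)d_\mu(m-k)$ converge and satisfy $\sum_k|b_\mu(k)|<\infty$ and $\sum_k(k+1)|b_\mu(k)|^2<\infty$. Let $D^\mu A$ be the matrix with entries $\sum_{l\ge k}d_\mu(l-k)a(l+j)$, $k,j\ge0$. Let $W^\mu$ be the lower triangular matrix with entries $w_\mu(j-k)$, $0\le k\le j$, where $w_\mu(z)=\sum_k w_\mu(k)z^k=\exp\Big\{\frac1{4\pi}\int_{-\pi}^{\pi}\frac{e^{i\lambda}+z}{e^{i\lambda}-z}\ln\frac{|1-e^{-i\lambda\mu}|^{2n}}{\lambda^{2n}}\,d\lambda\Big\}$ for $|z|<1$. Norms are those of $\ell_2$, and series $\sum_k x(k)e^{\pm i\lambda k}$ with $x\in\ell_2$ converge in $L_2(-\pi,\pi)$; densities are identified up to null sets. Let $\xi(m)$, $m\in\mathbb Z$, be a complex stochastic sequence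 whose increments $\xi^{(n)}(m,\mu')=\sum_{l=0}^n(-1)^l\binom nl\xi(m-l\mu')$ have finite variance and mean zero. It has spectral density $f$ if for all integers $m_0,m,\mu_1,\mu_2$ $$E\,\xi^{(n)}(m_0+m,\mu_1)\overline{\xi^{(n)}(m_0,\mu_2)}=\frac1{2\pi}\int_{-\pi}^{\pi}e^{i\lambda m}\frac{(1-e^{-i\mu_1\lambda})^n(1-e^{i\mu_2\lambda})^n}{\lambda^{2n}}f(\lambda)\,d\lambda .$$ The functional $A\xi=\sum_{k\ge0}a(k)\xi(k)$ is understood as $B\xi-V\xi$, with $B\xi=\sum_{k\ge0}b_\mu(k)\xi^{(n)}(k,\mu)$ converging in mean square, and $V\xi=\sum_{i=1}^{\mu n}\xi(-i)\sum_{i/\mu\le l\le n}(-1)^l\binom nl b_\mu(l\mu-i)$. Its linear estimates are $-V\xi+\sum_{j\ge1}c_j\xi^{(n)}(-j,\mu)$ (finite sums and their limits). Let $$\Delta(f)=\inf_{h}\frac1{2\pi}\int_{-\pi}^{\pi}\Big|\sum_{k\ge0}b_\mu(k)e^{i\lambda k}-h(\lambda)\Big|^2\frac{|1-e^{-i\lambda\mu}|^{2n}}{\lambda^{2n}}f(\lambda)\,d\lambda,$$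 the infimum being over finite sums $h(\lambda)=\sum_{j\ge1}c_je^{-i\lambda j}$. Let $D_0$ be the set of integrable $f\ge0$ on $(-\pi,\pi]$ with $\frac1{2\pi}\int_{-\pi}^{\pi}f\,d\lambda\le P_0$. A density $f^0\in D_0$ is *least favorable* if $\Delta(f^0)=\max_{f\in D_0}\Delta(f)$. Call $\varphi=(\varphi(k))_{k\ge0}$ *canonical* if $\Phi(z)=\sum_k\varphi(k)z^k$ has radius of convergence greater than $1$ and no zeros in $|z|\le1$; its density is $f_\varphi(\lambda)=|\sum_k\varphi(k)e^{-i\lambda k}|^2$ (also for $\varphi\in\ell_2$ not canonical). Consider $$(\mathrm E)\quad D^\mu AW^\mu\varphi=\alpha\overline\varphi\ \text{ for some }\alpha\in\mathbb C,\qquad (\mathrm F)\quad f_\varphi(\lambda)=\Big|c\sum_{k\ge0}(D^\mu A\varphi_\mu)_ke^{i\lambda k}\Big|^2\ \text{ for some }c\in\mathbb C,\quad \varphi_\mu=W^\mu\varphi .$$ Let $\nu_0P_0$, respectively $\nu_0^+P_0$, be the maximum of $\|D^\mu AW^\mu\varphi\|^2$ over the canonical $\varphi$ with $\|\varphi\|^2=P_0$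 that satisfy $(\mathrm E)$, respectively $(\mathrm F)$. **Theorem 5.1.** For every $f\in D_0$ and every $\xi$ with spectral density $f$, the functional $A\xi$ exists and the least mean square error $E|A\xi-\hat A\xi|^2$ of its linear estimates is $\Delta(f)$. Suppose that the maximum $\nu_0^+P_0$ exists. 1. If $\nu_0P_0$ exists, $\nu_0=\nu_0^+$, and $\varphi^0\in\ell_2$ is a solution of $(\mathrm E)$ with $\|\varphi^0\|^2=P_0$ and $\|D^\mu AW^\mu\varphi^0\|^2=\nu_0P_0=\nu_0^+P_0$, then $f^0(\lambda)=|\sum_k\varphi^0(k)e^{-i\lambda k}|^2$ is least favorable in $D_0$. For every $\xi$ with spectral density $f^0$ the increments have a one-sided moving average representation $\xi^{(n)}(m,\mu)=\sum_{k\ge0}\psi(k)\varepsilon(m-k)$ in mean square, where $\sum_k|\psi(k)|^2<\infty$ and $\varepsilon$ is an innovation sequence (centred, uncorrelated, of unit variance, and for every $t$ the closed span of $\varepsilon(m)$, $m\le t$, equals that of $\xi^{(n)}(m,\mu')$, $m\le t$, $\mu'>0$). If $\varphi^0$ is canonical, such a representation holds with $\psi=W^\mu\varphi^0$. 2. If $\nu_0<\nu_0^+$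 (which includes the case where no canonical $\varphi$ with $\|\varphi\|^2=P_0$ satisfies $(\mathrm E)$), then among the canonical $\varphi$ with $\int_{-\pi}^{\pi}f_\varphi\,d\lambda=2\pi P_0$, those satisfying $(\mathrm F)$ are exactly the solutions of the extremum problem $\|D^\mu A\varphi_\mu\|^2\to\max$, $\varphi_\mu=W^\mu\varphi$, over all $\varphi\in\ell_2$ with $f_\varphi\in D_0$; such $\varphi$ exist, and for each of them the density $f_\varphi(\lambda)=|c\sum_k(D^\mu A\varphi_\mu)_ke^{i\lambda k}|^2$ is least favorable in $D_0$. -/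

import Mathlib

open MeasureTheory Filter Topology
open scoped ENNReal ComplexConjugate

universe u

noncomputable section

namespace Extrapolation

/-! ### Stochastic sequences with stationary increments -/

section Sequences

variable {Ω : Type u}

/-- The increment of order `n` with step `μ`, namely
`ξ⁽ⁿ⁾(m, μ) = ∑ l ≤ n, (-1)^l C(n, l) ξ(m - l μ)`. -/
def increment (n : ℕ) (ξ : ℤ → Ω → ℂ) (m μ : ℤ) : Ω → ℂ := fun ω =>
  ∑ l ∈ Finset.range (n + 1), (-1 : ℂ) ^ l * (n.choose l : ℂ) * ξ (m - l * μ) ω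

variable [MeasurableSpace Ω]

/-- `ξ` is a stochastic sequence whose increments of order `n` are (wide sense) stationary with
mean zero, and whose spectral function is absolutely continuous with density `f`.  Densities are
taken with respect to the normalised measure `dλ / 2π` on `(-π, π]`, so that an uncorrelated
sequence of unit variance has density one. -/
structure HasSpectralDensity (P : Measure Ω) (n : ℕ) (ξ : ℤ → Ω → ℂ) (f : ℝ → ℝ) : Prop where
  meas : ∀ m, AEStronglyMeasurable (ξ m) P
  memLp : ∀ m μ : ℤ, MemLp (increment n ξ m μ) 2 P
  mean : ∀ m μ : ℤ, ∫ ω, increment n ξ m μ ω ∂P = 0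
  structural : ∀ m₀ m μ₁ μ₂ : ℤ,
    ∫ ω, increment n ξ (m₀ + m) μ₁ ω * conj (increment n ξ m₀ μ₂ ω) ∂P =
      (1 / (2 * Real.pi) : ℂ) * ∫ t in (-Real.pi)..Real.pi,
        Complex.exp (Complex.I * t * m) * (1 - Complex.exp (-(Complex.I * μ₁ * t))) ^ n *
          (1 - Complex.exp (Complex.I * μ₂ * t)) ^ n / (t : ℂ) ^ (2 * n) * (f t : ℂ)

/-- The closed linear span in `L²(P)` of a set of random variables, as a set of (representatives
of) square integrable random variables. -/
def closedSpan (P : Measure Ω) (S : Set (Ω → ℂ)) : Set (Ω → ℂ) :=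
  {X | MemLp X 2 P ∧ ∀ δ : ℝ≥0∞, 0 < δ → ∃ Y ∈ Submodule.span ℂ S, eLpNorm (X - Y) 2 P ≤ δ}

/-- `Hᵗ(ξ⁽ⁿ⁾)`, generated by the increments `ξ⁽ⁿ⁾(m, μ)` with `m ≤ t` and `μ > 0`. -/
def pastIncrements (P : Measure Ω) (n : ℕ) (ξ : ℤ → Ω → ℂ) (t : ℤ) : Set (Ω → ℂ) :=
  closedSpan P {X | ∃ m μ : ℤ, m ≤ t ∧ 0 < μ ∧ X = increment n ξ m μ}

/-- `ε` is an innovation sequence for `ξ⁽ⁿ⁾`: it is centred, uncorrelated, of unit variance, and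
generates the same past as the increments at every time. -/
structure IsInnovation (P : Measure Ω) (n : ℕ) (ξ ε : ℤ → Ω → ℂ) : Prop where
  memLp : ∀ m, MemLp (ε m) 2 P
  mean : ∀ m, ∫ ω, ε m ω ∂P = 0
  orthonormal : ∀ m k : ℤ, ∫ ω, ε m ω * conj (ε k ω) ∂P = if m = k then 1 else 0
  past_eq : ∀ t : ℤ, pastIncrements P n ξ t = closedSpan P {X | ∃ m : ℤ, m ≤ t ∧ X = ε m}

/-- The increments with step `μ` have the (canonical) one-sided moving average representation
`ξ⁽ⁿ⁾(m, μ) = ∑ k ≥ 0, ψ(k) ε(m - k)`, the series converging in mean square, with square summable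
coefficients `ψ` and an innovation sequence `ε`. -/
def IsMovingAverage (P : Measure Ω) (n μ : ℕ) (ξ : ℤ → Ω → ℂ) (ψ : ℕ → ℂ) : Prop :=
  (Summable fun k => ‖ψ k‖ ^ 2) ∧
  ∃ ε : ℤ → Ω → ℂ, IsInnovation P n ξ ε ∧
    ∀ m : ℤ, Tendsto (fun N : ℕ =>
      eLpNorm (fun ω => increment n ξ m μ ω - ∑ k ∈ Finset.range N, ψ k * ε (m - k) ω) 2 P)
      atTop (𝓝 0)

end Sequences

/-! ### The operators `Dᵘ`, `A`, `Wᵘ` -/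

/-- The coefficients of `(∑ j, x ^ (μ j)) ^ n`. -/
def dCoeff (n μ k : ℕ) : ℂ :=
  PowerSeries.coeff k ((PowerSeries.mk fun j => if μ ∣ j then (1 : ℂ) else 0) ^ n)

/-- The upper triangular matrix with entries `d(j - k)` for `k ≤ j`. -/
def matD (n μ k j : ℕ) : ℂ := if k ≤ j then dCoeff n μ (j - k) else 0

/-- The sum of a (possibly conditionally) convergent series. -/
def seriesSum (x : ℕ → ℂ) : ℂ := limUnder atTop fun N => ∑ i ∈ Finset.range N, x i

/-- `b(k) = (D a)(k)`, that is `∑ m ≥ k, a(m) d(m - k)`. -/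
def bCoeff (n μ : ℕ) (a : ℕ → ℂ) (k : ℕ) : ℂ := seriesSum fun m => matD n μ k m * a m

/-- The standing assumptions on the coefficients `a` of the functional `∑ k, a(k) ξ(k)`: the series
defining `b = D a` converge, `∑ |b(k)| < ∞` and `∑ (k + 1) |b(k)|² < ∞`. -/
structure Admissible (n μ : ℕ) (a : ℕ → ℂ) : Prop where
  conv : ∀ k, ∃ s, Tendsto (fun N => ∑ m ∈ Finset.range N, matD n μ k m * a m) atTop (𝓝 s)
  summable : Summable fun k => ‖bCoeff n μ a k‖
  summable_sq : Summable fun k : ℕ => ((k : ℝ) + 1) * ‖bCoeff n μ a k‖ ^ 2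

/-- The matrix product `D A`, where `A` has entries `a(l + j)`. -/
def matDA (n μ : ℕ) (a : ℕ → ℂ) (k j : ℕ) : ℂ := seriesSum fun l => matD n μ k l * a (l + j)

/-- The action of `D A` on square summable sequences. -/
def opDA (n μ : ℕ) (a x : ℕ → ℂ) (k : ℕ) : ℂ := ∑' j, matDA n μ a k j * x j

/-- The function `|1 - e^{-iλμ}|^{2n} / λ^{2n}`. -/
def weight (n μ : ℕ) (t : ℝ) : ℝ :=
  ‖1 - Complex.exp (-(Complex.I * t * μ))‖ ^ (2 * n) / t ^ (2 * n)

/-- The outer function on the unit disc whose squared boundary modulus is `weight`. -/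
def wFun (n μ : ℕ) (z : ℂ) : ℂ :=
  Complex.exp ((1 / (4 * Real.pi) : ℂ) * ∫ t in (-Real.pi)..Real.pi,
    (Complex.exp (Complex.I * t) + z) / (Complex.exp (Complex.I * t) - z) *
      (Real.log (weight n μ t) : ℂ))

/-- The Taylor coefficients of `wFun` at the origin. -/
def wCoeff (n μ k : ℕ) : ℂ := iteratedDeriv k (wFun n μ) 0 / (k.factorial : ℂ)

/-- The lower triangular operator `W` with entries `w(j - k)` for `k ≤ j`. -/
def opW (n μ : ℕ) (φ : ℕ → ℂ) (j : ℕ) : ℂ :=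
  ∑ k ∈ Finset.range (j + 1), wCoeff n μ (j - k) * φ k

/-- The operator `D A W`. -/
def opDAW (n μ : ℕ) (a φ : ℕ → ℂ) : ℕ → ℂ := opDA n μ a (opW n μ φ)

/-- The squared `ℓ²` norm. -/
def sqNorm (x : ℕ → ℂ) : ℝ := ∑' k, ‖x k‖ ^ 2

/-! ### Densities -/

/-- Lebesgue measure on `(-π, π]`. -/
def circleVol : Measure ℝ := volume.restrict (Set.Ioc (-Real.pi) Real.pi)

/-- `F(λ) = ∑ k ≥ 0, x(k) e^{iσλk}` on `(-π, π]`, the series converging in mean square. -/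
def IsFourierSum (σ : ℤ) (x : ℕ → ℂ) (F : ℝ → ℂ) : Prop :=
  MemLp F 2 circleVol ∧
  Tendsto (fun N : ℕ => eLpNorm (fun t : ℝ =>
      F t - ∑ k ∈ Finset.range N, x k * Complex.exp (Complex.I * σ * t * k)) 2 circleVol)
    atTop (𝓝 0)

/-- `f(λ) = |∑ k ≥ 0, φ(k) e^{-iλk}|²` almost everywhere. -/
def IsDensityOf (φ : ℕ → ℂ) (f : ℝ → ℝ) : Prop :=
  ∃ F : ℝ → ℂ, IsFourierSum (-1) φ F ∧ f =ᵐ[circleVol] fun t => ‖F t‖ ^ 2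

/-- `f(λ) = |c ∑ k ≥ 0, (D A φ_μ)(k) e^{iλk}|²` almost everywhere, where `φ_μ = W φ`. -/
def IsExtremalForm (n μ : ℕ) (a φ : ℕ → ℂ) (c : ℂ) (f : ℝ → ℝ) : Prop :=
  ∃ R : ℝ → ℂ, IsFourierSum 1 (opDA n μ a (opW n μ φ)) R ∧
    f =ᵐ[circleVol] fun t => ‖c * R t‖ ^ 2

/-- The sequence `φ` defines a canonical factorization: `Φ(z) = ∑ φ(k) z^k` has convergence radius
larger than one and no zeros in the closed unit disc. -/
def IsCanonical (φ : ℕ → ℂ) : Prop :=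
  (∃ r : ℝ, 1 < r ∧ Summable fun k => ‖φ k‖ * r ^ k) ∧
  ∀ z : ℂ, ‖z‖ ≤ 1 → ∑' k, φ k * z ^ k ≠ 0

/-- The class of spectral densities with total power at most `P₀`. -/
def classD0 (P₀ : ℝ) : Set (ℝ → ℝ) :=
  {f | Integrable f circleVol ∧ (∀ᵐ t ∂circleVol, 0 ≤ f t) ∧
    1 / (2 * Real.pi) * ∫ t in (-Real.pi)..Real.pi, f t ≤ P₀}

/-! ### Mean square errors -/

/-- The function `∑ k ≥ 0, b(k) e^{iλk}`. -/
def bFun (n μ : ℕ) (a : ℕ → ℂ) (t : ℝ) : ℂ :=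
  ∑' k : ℕ, bCoeff n μ a k * Complex.exp (Complex.I * t * k)

/-- The mean square error, under the density `f`, of the estimate with spectral characteristic
`h`. -/
def specError (n μ : ℕ) (a : ℕ → ℂ) (h : ℝ → ℂ) (f : ℝ → ℝ) : ℝ :=
  1 / (2 * Real.pi) * ∫ t in (-Real.pi)..Real.pi, ‖bFun n μ a t - h t‖ ^ 2 * weight n μ t * f t

/-- The spectral characteristic `∑ j, c(j) e^{-i(j+1)λ}` of an estimate that uses finitely many past
increments. -/
def pastChar (c : ℕ →₀ ℂ) (t : ℝ) : ℂ :=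
  c.sum fun j z => z * Complex.exp (-(Complex.I * t * ((j : ℂ) + 1)))

/-- The mean square error of the optimal linear estimate under the density `f`: the squared distance
in `L²(f)` from `∑ k ≥ 0, b(k) e^{iλk} (1 - e^{-iλμ})ⁿ (iλ)⁻ⁿ` to the closed span of the functions
`e^{iλk} (1 - e^{-iλμ})ⁿ (iλ)⁻ⁿ` with `k ≤ -1`. -/
def optimalError (n μ : ℕ) (a : ℕ → ℂ) (f : ℝ → ℝ) : ℝ :=
  ⨅ c : ℕ →₀ ℂ, specError n μ a (pastChar c) f

/-- `f₀` is least favourable in the class `D` for the optimal linear estimation of the functional. -/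
def IsLeastFavorable (n μ : ℕ) (a : ℕ → ℂ) (D : Set (ℝ → ℝ)) (f₀ : ℝ → ℝ) : Prop :=
  f₀ ∈ D ∧ ∀ f ∈ D, optimalError n μ a f ≤ optimalError n μ a f₀

section SequenceErrors

variable {Ω : Type u}

/-- The linear combination `Vξ = ∑ 1 ≤ i ≤ μ n, v(-i) ξ(-i)` of observed values, where
`v(-i) = ∑ i/μ ≤ l ≤ n, (-1)^l C(n, l) b(l μ - i)`. -/
def functionalV (n μ : ℕ) (a : ℕ → ℂ) (ξ : ℤ → Ω → ℂ) : Ω → ℂ := fun ω =>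
  ∑ i ∈ Finset.Icc 1 (μ * n),
    (∑ l ∈ (Finset.range (n + 1)).filter (fun l => i ≤ l * μ),
      (-1 : ℂ) ^ l * (n.choose l : ℂ) * bCoeff n μ a (l * μ - i)) * ξ (-(i : ℤ)) ω

/-- The estimate `-Vξ + ∑ j, c(j) ξ⁽ⁿ⁾(-1-j, μ)`, formed from the values `ξ(m)` with `m ≤ -1`. -/
def linearEstimate (n μ : ℕ) (a : ℕ → ℂ) (ξ : ℤ → Ω → ℂ) (c : ℕ →₀ ℂ) : Ω → ℂ := fun ω =>
  -functionalV n μ a ξ ω + c.sum fun j z => z * increment n ξ (-1 - (j : ℤ)) μ ω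

variable [MeasurableSpace Ω]

/-- `X` is the functional `Aξ = ∑ k ≥ 0, a(k) ξ(k)`, understood after summation by parts as
`Aξ = Bξ - Vξ` with `Bξ = ∑ k ≥ 0, b(k) ξ⁽ⁿ⁾(k, μ)` converging in mean square. -/
def IsFunctionalA (P : Measure Ω) (n μ : ℕ) (a : ℕ → ℂ) (ξ : ℤ → Ω → ℂ) (X : Ω → ℂ) : Prop :=
  AEStronglyMeasurable X P ∧
  Tendsto (fun N : ℕ => eLpNorm (fun ω => X ω + functionalV n μ a ξ ω -
      ∑ k ∈ Finset.range N, bCoeff n μ a k * increment n ξ k μ ω) 2 P) atTop (𝓝 0)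

/-- The least mean square error `E|X - X̂|²` over the linear estimates `X̂`. -/
def leastMSE (P : Measure Ω) (n μ : ℕ) (a : ℕ → ℂ) (ξ : ℤ → Ω → ℂ) (X : Ω → ℂ) : ℝ :=
  ⨅ c : ℕ →₀ ℂ, ∫ ω, ‖X ω - linearEstimate n μ a ξ c ω‖ ^ 2 ∂P

end SequenceErrors

/-! ### The extremal problems -/

/-- `φ` is a square summable solution of `D A W φ = α φ̄` for some complex `α`. -/
def SolvesEigen (n μ : ℕ) (a φ : ℕ → ℂ) : Prop :=
  (Summable fun k => ‖φ k‖ ^ 2) ∧ ∃ α : ℂ, ∀ k, opDAW n μ a φ k = α * conj (φ k)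

/-- The values `‖D A W φ‖²` on the solutions `φ` of `D A W φ = α φ̄` with `‖φ‖² = P₀` that define a
canonical factorization; the maximum of this set is `ν₀ P₀`. -/
def eigenValues (n μ : ℕ) (a : ℕ → ℂ) (P₀ : ℝ) : Set ℝ :=
  {x | ∃ φ : ℕ → ℂ, IsCanonical φ ∧ sqNorm φ = P₀ ∧ SolvesEigen n μ a φ ∧
    x = sqNorm (opDAW n μ a φ)}

/-- The values `‖D A W φ‖²` on the sequences `φ` with `‖φ‖² = P₀` that define the canonical
factorization of a density of the form `|c ∑ (D A W φ)(k) e^{iλk}|²`; the maximum of this set is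
`ν₀⁺ P₀`. -/
def extremalValues (n μ : ℕ) (a : ℕ → ℂ) (P₀ : ℝ) : Set ℝ :=
  {x | ∃ φ : ℕ → ℂ, IsCanonical φ ∧ sqNorm φ = P₀ ∧
    (∃ (f : ℝ → ℝ) (c : ℂ), IsDensityOf φ f ∧ IsExtremalForm n μ a φ c f) ∧
    x = sqNorm (opDAW n μ a φ)}

/-- `φ` solves the extremum problem `‖D A φ_μ‖² → max`, `|∑ φ(k) e^{-iλk}|² ∈ D`, where
`φ_μ = W φ`. -/
def SolvesExtremum (n μ : ℕ) (a : ℕ → ℂ) (D : Set (ℝ → ℝ)) (φ : ℕ → ℂ) : Prop :=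
  (∃ f ∈ D, IsDensityOf φ f) ∧
  ∀ ψ : ℕ → ℂ, (∃ f ∈ D, IsDensityOf ψ f) →
    sqNorm (opDA n μ a (opW n μ ψ)) ≤ sqNorm (opDA n μ a (opW n μ φ))

end Extrapolation

end

open Extrapolation

noncomputable section

namespace Extrapolation

/-! ### Square integrable functions -/

section LTwo

variable {X : Type*} [MeasurableSpace X] {m : Measure X}

/-! Functions on the circle are read through $z=e^{-it}$, so the Hardy space consists of the
functions without positive frequencies. Let $F$ have coefficients $\varphi$ and let $w$ be the outer
function with $|w|^2$ equal to the weight. Then $wF$ has coefficients $W^\mu\varphi$. Since $D^\mu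
A$ is the Hankel matrix $b(k+j)$, the entries of $D^\mu AW^\mu\varphi$ are the Fourier coefficients
of $bwF$ at nonnegative frequencies (`fc_bFun_mul`, `isFourierSum_opW`).

Lower bound: under the density $|F|^2$ the error of $h$ is $\|bwF-hwF\|^2$, and $hwF$ has negative
frequencies only, so $\Delta(|F|^2)\ge\|D^\mu AW^\mu\varphi\|^2$ (`sqNorm_le_optimalError`).

Upper bound, by duality: suppose $|U|^2=\nu$ almost everywhere and $bw-U$ has negative frequencies
only (`IsCertificate`). Because $w$ is outer, some $hw$ comes arbitrarily close to $bw-U$ in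
$L_2(f)$, and the error of that $h$ is close to $\int|U|^2f\le\nu P_0$, for every $f\in D_0$ at once
(`IsCertificate.optimalError_le`). The same $U$ bounds the Hankel form by $\nu\|\varphi\|^2$.

A canonical solution of (F) produces a certificate: with $R=\sum_k(D^\mu A\varphi_\mu)_ke^{i\lambda
k}$ take $U=R/F$. Its modulus is constant by (F), and $1/F$ is a bounded Hardy function
(`IsCanonical.exists_certificate`). The two bounds then meet, so whatever attains $\nu_0^+P_0$ is
least favorable and extremal. Conversely, attaining it forces $UF$ to have no negative frequencies,
hence $UF=R$, which is (F).

The probabilistic statements are transported by the isometry between the spans of the increments and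
of their spectral images (`exists_isometry_of_gram`). The moving average is the Wold decomposition
of the spectral model (`IsShift.exists_innovation`). For canonical $\varphi$ the innovation is the
constant function 1, because polynomial multiples of an outer function are dense. -/

lemma inner_toLp_eq_integral {F G : X → ℂ} (hF : MemLp F 2 m) (hG : MemLp G 2 m) :
    inner ℂ (hF.toLp F) (hG.toLp G) = ∫ x, conj (F x) * G x ∂m := by
  rw [L2.inner_def]
  refine integral_congr_ae ?_
  filter_upwards [hF.coeFn_toLp, hG.coeFn_toLp] with x h1 h2
  rw [h1, h2, RCLike.inner_apply, mul_comm]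

lemma norm_toLp_sq {F : X → ℂ} (hF : MemLp F 2 m) :
    ‖hF.toLp F‖ ^ 2 = ∫ x, ‖F x‖ ^ 2 ∂m := by
  have h := inner_toLp_eq_integral hF hF
  rw [inner_self_eq_norm_sq_to_K] at h
  have h2 : ∀ x, conj (F x) * F x = ((‖F x‖ ^ 2 : ℝ) : ℂ) := fun x => by
    rw [Complex.conj_mul']; push_cast; rfl
  simp_rw [h2] at h
  rw [integral_complex_ofReal] at h
  apply Complex.ofReal_injective
  rw [← h]; push_cast; rfl

lemma integrable_norm_sq {F : X → ℂ} (hF : MemLp F 2 m) : Integrable (fun x => ‖F x‖ ^ 2) m :=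
  (memLp_two_iff_integrable_sq_norm hF.1).1 hF

/-- Reduces mean square convergence to convergence of ordinary integrals, where dominated
convergence applies. -/
lemma tendsto_eLpNorm_two_iff {ι : Type*} {l : Filter ι} {F : ι → X → ℂ}
    (hF : ∀ i, MemLp (F i) 2 m) :
    Tendsto (fun i => eLpNorm (F i) 2 m) l (𝓝 0) ↔
      Tendsto (fun i => ∫ x, ‖F i x‖ ^ 2 ∂m) l (𝓝 0) := by
  have h : ∀ i, ∫ x, ‖F i x‖ ^ 2 ∂m = (eLpNorm (F i) 2 m).toReal ^ 2 := fun i => by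
    rw [← norm_toLp_sq (hF i), Lp.norm_toLp]
  simp_rw [h]
  have h0 : Tendsto (fun i => eLpNorm (F i) 2 m) l (𝓝 0) ↔
      Tendsto (fun i => (eLpNorm (F i) 2 m).toReal) l (𝓝 0) := by
    rw [← ENNReal.tendsto_toReal_iff (fun i => (hF i).2.ne) ENNReal.zero_ne_top]; simp
  rw [h0]
  constructor
  · intro h; simpa using h.pow 2
  · intro h
    have := h.sqrt
    simpa [Real.sqrt_sq ENNReal.toReal_nonneg] using this

lemma memLp_bdd_mul {p : ℝ≥0∞} {F G : X → ℂ} {C : ℝ} (hF : AEStronglyMeasurable F m)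
    (hb : ∀ᵐ x ∂m, ‖F x‖ ≤ C) (hG : MemLp G p m) : MemLp (fun x => F x * G x) p m := by
  refine MemLp.of_le_mul (c := C) hG (hF.mul hG.1) ?_
  filter_upwards [hb] with x hx
  rw [norm_mul]
  exact mul_le_mul_of_nonneg_right hx (norm_nonneg _)

lemma memLp_of_bdd [IsFiniteMeasure m] {p : ℝ≥0∞} {F : X → ℂ} {C : ℝ}
    (hF : AEStronglyMeasurable F m) (hb : ∀ᵐ x ∂m, ‖F x‖ ≤ C) : MemLp F p m :=
  MemLp.of_bound hF C hb

lemma memLp_conj {p : ℝ≥0∞} {F : X → ℂ} (hF : MemLp F p m) :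
    MemLp (fun x => conj (F x)) p m :=
  MemLp.of_le hF (Complex.continuous_conj.comp_aestronglyMeasurable hF.1)
    (Eventually.of_forall fun x => by simp)

end LTwo

/-! ### Fourier series on `(-π, π]` -/

/-- The normalised Lebesgue measure on `(-π, π]`. -/
def circ : Measure ℝ := ENNReal.ofReal (2 * Real.pi)⁻¹ • circleVol

lemma circ_const_ne_zero : ENNReal.ofReal (2 * Real.pi)⁻¹ ≠ 0 := by
  have := Real.pi_pos
  simp only [ne_eq, ENNReal.ofReal_eq_zero, not_le]; positivity

lemma ae_circ : ae circ = ae circleVol :=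
  by ext; exact Measure.ae_ennreal_smul_measure_iff circ_const_ne_zero

instance : IsFiniteMeasure circleVol := by
  unfold circleVol; infer_instance

instance : IsProbabilityMeasure circ := ⟨by
  have := Real.pi_pos
  rw [circ, circleVol, Measure.smul_apply, Measure.restrict_apply_univ, Real.volume_Ioc,
    smul_eq_mul, ← ENNReal.ofReal_mul (by positivity)]
  rw [show (2 * Real.pi)⁻¹ * (Real.pi - -Real.pi) = 1 by field_simp; ring]
  simp⟩

lemma integral_circ {E : Type*} [NormedAddCommGroup E] [NormedSpace ℝ E] (g : ℝ → E) :
    ∫ t, g t ∂circ = (2 * Real.pi)⁻¹ • ∫ t in (-Real.pi)..Real.pi, g t := by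
  have := Real.pi_pos
  rw [circ, integral_smul_measure, ENNReal.toReal_ofReal (by positivity),
    intervalIntegral.integral_of_le (by linarith), circleVol]

lemma integrable_circ {g : ℝ → ℝ} : Integrable g circ ↔ Integrable g circleVol :=
  integrable_smul_measure circ_const_ne_zero ENNReal.ofReal_ne_top

lemma eLpNorm_circ (g : ℝ → ℂ) :
    eLpNorm g 2 circ = ENNReal.ofReal (2 * Real.pi)⁻¹ ^ (1 / (2 : ℝ)) * eLpNorm g 2 circleVol := by
  rw [circ, eLpNorm_smul_measure_of_ne_zero circ_const_ne_zero]
  simp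

lemma memLp_circ {g : ℝ → ℂ} : MemLp g 2 circ ↔ MemLp g 2 circleVol := by
  have h : circleVol = (ENNReal.ofReal (2 * Real.pi)⁻¹)⁻¹ • circ := by
    rw [circ, smul_smul, ENNReal.inv_mul_cancel circ_const_ne_zero ENNReal.ofReal_ne_top, one_smul]
  constructor
  · intro hg; rw [h]; exact hg.smul_measure (ENNReal.inv_ne_top.2 circ_const_ne_zero)
  · intro hg; exact hg.smul_measure ENNReal.ofReal_ne_top

lemma tendsto_eLpNorm_circ {ι : Type*} {l : Filter ι} {g : ι → ℝ → ℂ} :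
    Tendsto (fun i => eLpNorm (g i) 2 circ) l (𝓝 0) ↔
      Tendsto (fun i => eLpNorm (g i) 2 circleVol) l (𝓝 0) := by
  set c := ENNReal.ofReal (2 * Real.pi)⁻¹ ^ (1 / (2 : ℝ)) with hc
  have hc0 : c ≠ 0 := by
    have := circ_const_ne_zero
    simp only [hc, ne_eq, ENNReal.rpow_eq_zero_iff]
    push Not
    exact ⟨fun h => absurd h this, fun h => absurd h ENNReal.ofReal_ne_top⟩
  have hct : c ≠ ∞ := ENNReal.rpow_ne_top_of_nonneg (by norm_num) ENNReal.ofReal_ne_top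
  simp_rw [eLpNorm_circ, ← hc]
  constructor
  · intro h
    have := ENNReal.Tendsto.const_mul (a := c⁻¹) h (Or.inr (ENNReal.inv_ne_top.2 hc0))
    simpa [← mul_assoc, ENNReal.inv_mul_cancel hc0 hct] using this
  · intro h
    simpa using ENNReal.Tendsto.const_mul (a := c) h (Or.inr hct)

/-- The exponential `e^{ikt}`. -/
def expo (k : ℤ) (t : ℝ) : ℂ := Complex.exp (Complex.I * t * k)

@[simp] lemma norm_expo (k : ℤ) (t : ℝ) : ‖expo k t‖ = 1 := by
  rw [expo, show Complex.I * t * k = ((t * k : ℝ) : ℂ) * Complex.I by push_cast; ring,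
    Complex.norm_exp_ofReal_mul_I]

lemma expo_add (j k : ℤ) (t : ℝ) : expo (j + k) t = expo j t * expo k t := by
  simp only [expo, ← Complex.exp_add]; congr 1; push_cast; ring

@[simp] lemma expo_zero (t : ℝ) : expo 0 t = 1 := by simp [expo]

lemma conj_expo (k : ℤ) (t : ℝ) : conj (expo k t) = expo (-k) t := by
  simp only [expo, ← Complex.exp_conj]; congr 1; simp

@[fun_prop] lemma continuous_expo (k : ℤ) : Continuous (expo k) := by
  unfold expo; fun_prop

lemma expo_mul_natCast (j : ℤ) (k : ℕ) (t : ℝ) : expo (j * k) t = expo j t ^ k := by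
  simp only [expo, ← Complex.exp_nat_mul]; congr 1; push_cast; ring

lemma memLp_expo_mul {p : ℝ≥0∞} (k : ℤ) {F : ℝ → ℂ} (hF : MemLp F p circ) :
    MemLp (fun t => expo k t * F t) p circ :=
  memLp_bdd_mul (C := 1) (by fun_prop) (by simp) hF

lemma memLp_expo (k : ℤ) : MemLp (expo k) 2 circ :=
  memLp_of_bdd (C := 1) (by fun_prop) (by simp)

/-- The Fourier coefficients of a function on `(-π, π]`. -/
def fc (F : ℝ → ℂ) (k : ℤ) : ℂ := ∫ t, expo (-k) t * F t ∂circ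

lemma fc_congr {F G : ℝ → ℂ} (h : F =ᵐ[circ] G) (k : ℤ) : fc F k = fc G k :=
  integral_congr_ae (by filter_upwards [h] with t ht; rw [ht])

lemma integrable_expo_mul {F : ℝ → ℂ} (hF : Integrable F circ) (k : ℤ) :
    Integrable (fun t => expo k t * F t) circ :=
  (memLp_one_iff_integrable.1 (memLp_expo_mul k (memLp_one_iff_integrable.2 hF)))

lemma integrable_of_memLp {F : ℝ → ℂ} (hF : MemLp F 2 circ) : Integrable F circ :=
  hF.integrable (by norm_num)

lemma fc_add {F G : ℝ → ℂ} (hF : MemLp F 2 circ) (hG : MemLp G 2 circ) (k : ℤ) :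
    fc (fun t => F t + G t) k = fc F k + fc G k := by
  simp only [fc, mul_add]
  exact integral_add (integrable_expo_mul (integrable_of_memLp hF) _)
    (integrable_expo_mul (integrable_of_memLp hG) _)

lemma fc_sub {F G : ℝ → ℂ} (hF : MemLp F 2 circ) (hG : MemLp G 2 circ) (k : ℤ) :
    fc (fun t => F t - G t) k = fc F k - fc G k := by
  simp only [fc, mul_sub]
  exact integral_sub (integrable_expo_mul (integrable_of_memLp hF) _)
    (integrable_expo_mul (integrable_of_memLp hG) _)

lemma fc_const_mul (c : ℂ) (F : ℝ → ℂ) (k : ℤ) : fc (fun t => c * F t) k = c * fc F k := by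
  simp only [fc, mul_left_comm _ c]
  exact integral_const_mul _ _

lemma fc_sum {ι : Type*} (s : Finset ι) {F : ι → ℝ → ℂ} (hF : ∀ i ∈ s, MemLp (F i) 2 circ) (k : ℤ) :
    fc (fun t => ∑ i ∈ s, F i t) k = ∑ i ∈ s, fc (F i) k := by
  simp only [fc, Finset.mul_sum]
  exact integral_finsetSum _ fun i hi => integrable_expo_mul (integrable_of_memLp (hF i hi)) _

lemma fc_expo_mul (j k : ℤ) (F : ℝ → ℂ) : fc (fun t => expo j t * F t) k = fc F (k - j) := by
  simp only [fc, ← mul_assoc, ← expo_add]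
  congr! 4; ring

lemma fc_conj (F : ℝ → ℂ) (k : ℤ) : fc (fun t => conj (F t)) k = conj (fc F (-k)) := by
  simp only [fc, ← integral_conj, map_mul, conj_expo]
  simp

lemma fourierCoeffOn_eq_fc (F : ℝ → ℂ) (k : ℤ) :
    fourierCoeffOn (show -Real.pi < Real.pi by linarith [Real.pi_pos]) F k = fc F k := by
  rw [fourierCoeffOn_eq_integral, fc, integral_circ]
  congr 1
  · ring
  · refine intervalIntegral.integral_congr fun t _ => ?_
    simp only [smul_eq_mul]
    congr 1
    rw [fourier_coe_apply, expo]
    congr 1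
    have := Real.pi_ne_zero
    push_cast
    field_simp
    ring

lemma hasSum_sq_fc {F : ℝ → ℂ} (hF : MemLp F 2 circ) :
    HasSum (fun k => ‖fc F k‖ ^ 2) (∫ t, ‖F t‖ ^ 2 ∂circ) := by
  have h := hasSum_sq_fourierCoeffOn (show -Real.pi < Real.pi by linarith [Real.pi_pos])
    (memLp_circ.1 hF)
  simp_rw [fourierCoeffOn_eq_fc] at h
  rw [integral_circ]
  convert h using 2
  ring

lemma fc_expo (j k : ℤ) : fc (expo j) k = if j = k then 1 else 0 := by
  by_cases h : j = k
  · subst h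
    simp [fc, ← expo_add]
  · rw [if_neg h, ← fourierCoeffOn_eq_fc]
    rw [fourierCoeffOn_eq_fc]
    have h0 : (j - k : ℂ) ≠ 0 := by
      rw [sub_ne_zero]; exact_mod_cast h
    have hI : Complex.I * (j - k : ℂ) ≠ 0 := mul_ne_zero Complex.I_ne_zero h0
    rw [fc, integral_circ]
    have : ∀ t : ℝ, expo (-k) t * expo j t = Complex.exp (Complex.I * (j - k : ℂ) * t) :=
        fun t => by
      rw [← expo_add, expo]; congr 1; push_cast; ring
    simp_rw [this]
    rw [integral_exp_mul_complex hI]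
    have : Complex.exp (Complex.I * (j - k : ℂ) * (Real.pi : ℝ)) =
        Complex.exp (Complex.I * (j - k : ℂ) * ((-Real.pi : ℝ) : ℂ)) := by
      rw [Complex.exp_eq_exp_iff_exists_int]
      exact ⟨j - k, by push_cast; ring⟩
    rw [this]; simp

/-- The Fourier basis of `L²(-π, π)`. -/
def expoBasis : HilbertBasis ℤ ℂ (Lp ℂ 2 circ) :=
  HilbertBasis.mkOfOrthogonalEqBot (v := fun k => (memLp_expo k).toLp (expo k))
    (by
      rw [orthonormal_iff_ite]
      intro j k
      rw [inner_toLp_eq_integral]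
      simp_rw [conj_expo]
      have := fc_expo k j
      rw [fc] at this
      rw [this]; simp [eq_comm])
    (by
      rw [Submodule.eq_bot_iff]
      intro f hf
      rw [Submodule.mem_orthogonal] at hf
      -- Completeness comes from Parseval: a function orthogonal to all exponentials has zero
      -- coefficients, hence zero norm.
      have h0 : ∀ k, fc f k = 0 := fun k => by
        have := hf _ (Submodule.subset_span ⟨k, rfl⟩)
        rw [← Lp.toLp_coeFn f (Lp.memLp f), inner_toLp_eq_integral] at this
        simpa [fc, conj_expo] using this
      have h := hasSum_sq_fc (Lp.memLp f)
      simp only [h0, norm_zero, ne_eq, OfNat.ofNat_ne_zero, not_false_eq_true, zero_pow] at h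
      have h2 := h.unique hasSum_zero
      rw [← norm_toLp_sq (Lp.memLp f), Lp.toLp_coeFn] at h2
      simpa using h2)

lemma expoBasis_apply (k : ℤ) : expoBasis k = (memLp_expo k).toLp (expo k) := by
  simp [expoBasis, HilbertBasis.coe_mkOfOrthogonalEqBot]

lemma expoBasis_inner {F : ℝ → ℂ} (hF : MemLp F 2 circ) (k : ℤ) :
    inner ℂ (expoBasis k) (hF.toLp F) = fc F k := by
  rw [expoBasis_apply, inner_toLp_eq_integral]
  simp [fc, conj_expo]

lemma hasSum_fc_inner {F G : ℝ → ℂ} (hF : MemLp F 2 circ) (hG : MemLp G 2 circ) :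
    HasSum (fun k => conj (fc F k) * fc G k) (∫ t, conj (F t) * G t ∂circ) := by
  have h := expoBasis.hasSum_inner_mul_inner (hF.toLp F) (hG.toLp G)
  rw [inner_toLp_eq_integral] at h
  refine h.congr_fun fun k => ?_
  rw [expoBasis_inner, ← inner_conj_symm, expoBasis_inner]

/-- Parseval applied to `G` and the conjugate of $e^{-imt}F$. The product need only be integrable.
-/
lemma hasSum_fc_mul {F G : ℝ → ℂ} (hF : MemLp F 2 circ) (hG : MemLp G 2 circ) (m : ℤ) :
    HasSum (fun j => fc F (m - j) * fc G j) (fc (fun t => F t * G t) m) := by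
  have hH := memLp_conj (memLp_expo_mul (-m) hF)
  have h := hasSum_fc_inner hH hG
  convert h using 2 with j
  · rw [fc_conj, fc_expo_mul, Complex.conj_conj]; congr 2; ring
  · simp [fc, mul_assoc]

lemma ae_eq_of_fc_eq {F G : ℝ → ℂ} (hF : MemLp F 2 circ) (hG : MemLp G 2 circ)
    (h : ∀ k, fc F k = fc G k) : F =ᵐ[circ] G := by
  have h1 := hasSum_sq_fc (hF.sub hG)
  have h2 : ∀ k, fc (F - G) k = 0 := fun k => by
    have := fc_sub hF hG k
    rw [h k, sub_self] at this
    exact this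
  simp only [h2, norm_zero, ne_eq, OfNat.ofNat_ne_zero, not_false_eq_true, zero_pow] at h1
  have h3 := h1.unique hasSum_zero
  rw [← norm_toLp_sq (hF.sub hG), MemLp.toLp_sub hF hG] at h3
  have h4 : hF.toLp F = hG.toLp G := by
    rw [← sub_eq_zero]; simpa using h3
  exact (MemLp.toLp_eq_toLp_iff _ _).1 h4

lemma exists_fc_eq {c : ℤ → ℂ} (hc : Summable fun k => ‖c k‖ ^ 2) :
    ∃ F : ℝ → ℂ, MemLp F 2 circ ∧ ∀ k, fc F k = c k := by
  have hm : Memℓp c 2 := by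
    rw [memℓp_gen_iff (by norm_num)]
    simpa using hc
  refine ⟨expoBasis.repr.symm ⟨c, hm⟩, Lp.memLp _, fun k => ?_⟩
  rw [← expoBasis_inner (Lp.memLp _), Lp.toLp_coeFn, ← HilbertBasis.repr_apply_apply]
  simp

lemma hasSum_toLp_fourier {F : ℝ → ℂ} (hF : MemLp F 2 circ) :
    HasSum (fun k => fc F k • expoBasis k) (hF.toLp F) := by
  have h := expoBasis.hasSum_repr (hF.toLp F)
  simpa only [HilbertBasis.repr_apply_apply, expoBasis_inner] using h

lemma norm_fc_le {F : ℝ → ℂ} (hF : MemLp F 2 circ) (k : ℤ) :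
    ‖fc F k‖ ^ 2 ≤ ∫ t, ‖F t‖ ^ 2 ∂circ :=
  le_hasSum (hasSum_sq_fc hF) k fun _ _ => by positivity

/-- Each coefficient is continuous in mean square, so convergence of the series fixes all of them.
Conversely, the expansion in `expoBasis` loses its vanishing terms and becomes the given series,
reindexed along the injection `k ↦ σ * k`. -/
lemma isFourierSum_iff {σ : ℤ} (hσ : σ ≠ 0) {x : ℕ → ℂ} {F : ℝ → ℂ} :
    IsFourierSum σ x F ↔ MemLp F 2 circ ∧ (∀ k : ℕ, fc F (σ * k) = x k) ∧
      ∀ j : ℤ, (∀ k : ℕ, j ≠ σ * k) → fc F j = 0 := by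
  have hinj : Function.Injective fun k : ℕ => σ * (k : ℤ) := fun a b h => by
    have := mul_left_cancel₀ hσ h
    exact_mod_cast this
  have hexp : ∀ (t : ℝ) (k : ℕ), Complex.exp (Complex.I * σ * t * k) = expo (σ * k) t :=
    fun t k => by rw [expo]; congr 1; push_cast; ring
  have hS : ∀ N : ℕ, MemLp (fun t => ∑ k ∈ Finset.range N, x k * expo (σ * k) t) 2 circ :=
    fun N => memLp_finsetSum _ fun k _ => (memLp_expo _).const_mul _
  have hfcS : ∀ (N : ℕ) (j : ℤ), fc (fun t => ∑ k ∈ Finset.range N, x k * expo (σ * k) t) j =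
      ∑ k ∈ Finset.range N, x k * if σ * (k : ℤ) = j then 1 else 0 := fun N j => by
    rw [fc_sum _ fun k _ => (memLp_expo _).const_mul _]
    simp_rw [fc_const_mul, fc_expo]
  unfold IsFourierSum
  simp_rw [hexp]
  rw [← memLp_circ, ← tendsto_eLpNorm_circ]
  refine and_congr_right fun hF => ?_
  constructor
  · intro h
    replace h := (tendsto_eLpNorm_two_iff fun N => hF.sub (hS N)).1 h
    have key : ∀ j,
        Tendsto (fun N : ℕ => ∑ k ∈ Finset.range N, x k * if σ * (k : ℤ) = j then 1 else 0)
        atTop (𝓝 (fc F j)) := fun j => by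
      rw [tendsto_iff_norm_sub_tendsto_zero]
      have h2 := h.sqrt
      rw [Real.sqrt_zero] at h2
      refine squeeze_zero (fun _ => norm_nonneg _) (fun N => ?_) h2
      apply Real.le_sqrt_of_sq_le
      rw [norm_sub_rev, ← hfcS, ← fc_sub hF (hS N)]
      exact norm_fc_le (hF.sub (hS N)) j
    refine ⟨fun k => ?_, fun j hj => ?_⟩
    · refine tendsto_nhds_unique (key _) (tendsto_const_nhds.congr' ?_)
      filter_upwards [eventually_gt_atTop k] with N hN
      rw [Finset.sum_eq_single k]
      · simp
      · intro b _ hb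
        rw [if_neg fun h => hb (hinj h), mul_zero]
      · intro h; exact absurd (Finset.mem_range.2 hN) h
    · refine tendsto_nhds_unique (key _) (tendsto_const_nhds.congr fun N => ?_)
      exact (Finset.sum_eq_zero fun k _ => by rw [if_neg fun h => hj k h.symm, mul_zero]).symm
  · rintro ⟨h1, h2⟩
    have h := hasSum_toLp_fourier hF
    rw [← hinj.hasSum_iff (fun j hj => by
      rw [h2 j fun k hk => hj ⟨k, hk.symm⟩, zero_smul])] at h
    have h3 := h.tendsto_sum_nat
    have h4 : Tendsto (fun N : ℕ => (hF.sub (hS N)).toLp _) atTop (𝓝 0) := by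
      rw [← sub_self (hF.toLp F)]
      refine (tendsto_const_nhds.sub h3).congr fun N => ?_
      rw [MemLp.toLp_sub hF (hS N)]
      congr 1
      rw [← Lp.toLp_coeFn (∑ i ∈ Finset.range N, _) (Lp.memLp _), MemLp.toLp_eq_toLp_iff]
      refine (Lp.coeFn_finsetSum _ _).trans ?_
      have : ∀ᵐ t ∂circ, ∀ k : ℕ, (fc F (σ * k) • expoBasis (σ * k) : Lp ℂ 2 circ) t =
          x k * expo (σ * k) t := by
        rw [ae_all_iff]
        intro k
        rw [h1, expoBasis_apply]
        filter_upwards [Lp.coeFn_smul (x k) ((memLp_expo (σ * k)).toLp _),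
          (memLp_expo (σ * k)).coeFn_toLp] with t ht1 ht2
        rw [ht1, Pi.smul_apply, ht2, smul_eq_mul]
      filter_upwards [this] with t ht
      simp [ht]
    have h5 := h4.norm
    rw [norm_zero] at h5
    refine (tendsto_eLpNorm_two_iff fun N => hF.sub (hS N)).2 ?_
    have h6 := h5.pow 2
    simpa only [norm_toLp_sq, ne_eq, OfNat.ofNat_ne_zero, not_false_eq_true, zero_pow] using h6

lemma exists_isFourierSum {σ : ℤ} (hσ : σ ≠ 0) {x : ℕ → ℂ} (hx : Summable fun k => ‖x k‖ ^ 2) :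
    ∃ F, IsFourierSum σ x F := by
  have hinj : Function.Injective fun k : ℕ => σ * (k : ℤ) := fun a b h => by
    have := mul_left_cancel₀ hσ h
    exact_mod_cast this
  obtain ⟨F, hF, hc⟩ := exists_fc_eq (c := Function.extend (fun k : ℕ => σ * (k : ℤ)) x 0) (by
    rw [← hinj.summable_iff]
    · refine hx.congr fun k => ?_
      simp only [Function.comp]
      rw [hinj.extend_apply]
    · intro j hj
      rw [Function.extend_apply' _ _ _ (by simpa using hj)]
      simp)
  refine ⟨F, (isFourierSum_iff hσ).2 ⟨hF, fun k => ?_, fun j hj => ?_⟩⟩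
  · rw [hc]; exact hinj.extend_apply _ _ _
  · rw [hc, Function.extend_apply' _ _ _ (by rintro ⟨k, hk⟩; exact hj k hk.symm)]; rfl

lemma IsFourierSum.hasSum_sq {σ : ℤ} (hσ : σ ≠ 0) {x : ℕ → ℂ} {F : ℝ → ℂ}
    (h : IsFourierSum σ x F) : HasSum (fun k => ‖x k‖ ^ 2) (∫ t, ‖F t‖ ^ 2 ∂circ) := by
  obtain ⟨hF, h1, h2⟩ := (isFourierSum_iff hσ).1 h
  have hinj : Function.Injective fun k : ℕ => σ * (k : ℤ) := fun a b h => by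
    have := mul_left_cancel₀ hσ h
    exact_mod_cast this
  have h3 := hasSum_sq_fc hF
  rw [← hinj.hasSum_iff] at h3
  · refine h3.congr_fun fun k => ?_
    simp [h1]
  · intro j hj
    rw [h2 j fun k hk => hj ⟨k, hk.symm⟩]
    simp

end Extrapolation

end

noncomputable section

namespace Extrapolation

/-! ### Hardy space -/

lemma exists_subseq_tendsto_ae {X : Type*} [MeasurableSpace X] {m : Measure X} {G : ℕ → X → ℂ}
    {F : X → ℂ} (hG : ∀ n, MemLp (G n) 2 m) (hF : MemLp F 2 m)
    (h : Tendsto (fun n => ∫ x, ‖G n x - F x‖ ^ 2 ∂m) atTop (𝓝 0)) :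
    ∃ s : ℕ → ℕ, StrictMono s ∧ ∀ᵐ x ∂m, Tendsto (fun n => G (s n) x) atTop (𝓝 (F x)) := by
  have h1 : Tendsto (fun n => eLpNorm (G n - F) 2 m) atTop (𝓝 0) :=
    (tendsto_eLpNorm_two_iff fun n => (hG n).sub hF).2 h
  exact (tendstoInMeasure_of_tendsto_eLpNorm (by norm_num) (fun n => (hG n).1) hF.1
    h1).exists_seq_tendsto_ae

/-- Square integrable functions on `(-π, π]` whose Fourier series has no positive frequencies. -/
def Hardy (F : ℝ → ℂ) : Prop := MemLp F 2 circ ∧ ∀ j : ℤ, 0 < j → fc F j = 0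

/-- The analytic function on the unit disc with boundary values `F(t)` at `e^{-it}`. -/
def discExt (F : ℝ → ℂ) (z : ℂ) : ℂ := ∑' k : ℕ, fc F (-k) * z ^ k

lemma isFourierSum_neg_one_iff {x : ℕ → ℂ} {F : ℝ → ℂ} :
    IsFourierSum (-1) x F ↔ Hardy F ∧ ∀ k : ℕ, fc F (-k) = x k := by
  rw [isFourierSum_iff (by norm_num), Hardy, and_assoc, and_comm (a := ∀ j : ℤ, 0 < j → fc F j = 0)]
  refine and_congr_right fun _ => and_congr (by simp) ⟨fun h j hj => h j fun k hk => ?_,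
    fun h j hj => h j ?_⟩
  · omega
  · by_contra hneg
    exact hj (-j).toNat (by omega)

lemma isFourierSum_one_iff {x : ℕ → ℂ} {F : ℝ → ℂ} :
    IsFourierSum 1 x F ↔ MemLp F 2 circ ∧ (∀ k : ℕ, fc F k = x k) ∧
      ∀ j : ℤ, j < 0 → fc F j = 0 := by
  rw [isFourierSum_iff (by norm_num)]
  refine and_congr_right fun _ => and_congr (by simp) ⟨fun h j hj => h j fun k hk => ?_,
    fun h j hj => h j ?_⟩
  · omega
  · by_contra hneg
    exact hj j.toNat (by omega)

lemma Hardy.isFourierSum {F : ℝ → ℂ} (hF : Hardy F) :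
    IsFourierSum (-1) (fun k => fc F (-k)) F :=
  isFourierSum_neg_one_iff.2 ⟨hF, fun _ => rfl⟩

lemma Hardy.hasSum_sq {F : ℝ → ℂ} (hF : Hardy F) :
    HasSum (fun k : ℕ => ‖fc F (-k)‖ ^ 2) (∫ t, ‖F t‖ ^ 2 ∂circ) :=
  hF.isFourierSum.hasSum_sq (by norm_num)

lemma Hardy.sub {F G : ℝ → ℂ} (hF : Hardy F) (hG : Hardy G) : Hardy fun t => F t - G t :=
  ⟨hF.1.sub hG.1, fun j hj => by rw [fc_sub hF.1 hG.1, hF.2 j hj, hG.2 j hj, sub_zero]⟩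

lemma Hardy.const_mul {F : ℝ → ℂ} (hF : Hardy F) (c : ℂ) : Hardy fun t => c * F t :=
  ⟨hF.1.const_mul c, fun j hj => by rw [fc_const_mul, hF.2 j hj, mul_zero]⟩

lemma Hardy.congr {F G : ℝ → ℂ} (hF : Hardy F) (h : F =ᵐ[circ] G) : Hardy G :=
  ⟨(memLp_congr_ae h).1 hF.1, fun j hj => by rw [← fc_congr h, hF.2 j hj]⟩

/-- For `j > 0` one of the indices `k`, `j - k` is positive, so every term of the convolution
vanishes. -/
lemma Hardy.mul {F G : ℝ → ℂ} (hF : Hardy F) (hG : Hardy G)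
    (h : MemLp (fun t => F t * G t) 2 circ) : Hardy fun t => F t * G t := by
  refine ⟨h, fun j hj => ?_⟩
  refine (hasSum_fc_mul hF.1 hG.1 j).unique ?_
  convert (hasSum_zero (α := ℂ) (β := ℤ)) using 2 with k
  rcases lt_or_ge 0 k with hk | hk
  · rw [hG.2 k hk, mul_zero]
  · rw [hF.2 (j - k) (by omega), zero_mul]

lemma Hardy.mul_of_bdd {F G : ℝ → ℂ} (hF : Hardy F) (hG : Hardy G) {C : ℝ}
    (h : ∀ᵐ t ∂circ, ‖F t‖ ≤ C) : Hardy fun t => F t * G t :=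
  hF.mul hG (memLp_bdd_mul hF.1.1 h hG.1)

/-- The convolution becomes a finite Cauchy product, which is what turns the triangular matrix `opW`
into multiplication by a function. -/
lemma Hardy.fc_mul {F G : ℝ → ℂ} (hF : Hardy F) (hG : Hardy G) (m : ℕ) :
    fc (fun t => F t * G t) (-m) =
      ∑ k ∈ Finset.range (m + 1), fc F (-((m - k : ℕ) : ℤ)) * fc G (-k) := by
  have h := hasSum_fc_mul hF.1 hG.1 (-m)
  have hinj : Function.Injective fun k : ℕ => -(k : ℤ) := fun a b h => by simpa using h
  rw [← hinj.hasSum_iff] at h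
  · refine h.unique ?_
    have e : ∑ k ∈ Finset.range (m + 1), fc F (-((m - k : ℕ) : ℤ)) * fc G (-k) =
        ∑ k ∈ Finset.range (m + 1), fc F (-m - (-(k : ℤ))) * fc G (-k) := by
      refine Finset.sum_congr rfl fun k hk => ?_
      simp only [Finset.mem_range] at hk
      congr 2; omega
    rw [e]
    refine hasSum_sum_of_ne_finset_zero fun k hk => ?_
    simp only [Finset.mem_range, not_lt] at hk
    change fc F (-m - -(k : ℤ)) * _ = 0
    rw [hF.2 _ (by omega), zero_mul]
  · intro j hj
    rcases lt_or_ge 0 j with h | h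
    · rw [hG.2 j h, mul_zero]
    · exact absurd ⟨(-j).toNat, by simp; omega⟩ hj

lemma isFourierSum_of_summable {σ : ℤ} {y : ℕ → ℂ} (hy : Summable fun k => ‖y k‖) :
    IsFourierSum σ y fun t => ∑' k, y k * Complex.exp (Complex.I * σ * t * k) := by
  have hexp : ∀ (t : ℝ) (k : ℕ), Complex.exp (Complex.I * σ * t * k) = expo (σ * k) t :=
    fun t k => by rw [expo]; congr 1; push_cast; ring
  have hc : Continuous fun t => ∑' k, y k * expo (σ * k) t :=
    continuous_tsum (fun k => by fun_prop) hy fun k t => by simp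
  have hs : ∀ t, Summable fun k => y k * expo (σ * k) t := fun t =>
    Summable.of_norm (by simpa using hy)
  refine ⟨?_, ?_⟩
  · simp_rw [hexp]
    refine MemLp.of_bound hc.aestronglyMeasurable (∑' k, ‖y k‖) (Eventually.of_forall fun t => ?_)
    refine (norm_tsum_le_tsum_norm (by simpa using hy)).trans (by simp)
  · simp_rw [hexp]
    have hbd : ∀ N : ℕ, eLpNorm (fun t => (∑' k, y k * expo (σ * k) t) -
        ∑ k ∈ Finset.range N, y k * expo (σ * k) t) 2 circ ≤
        ENNReal.ofReal (∑' k, ‖y (k + N)‖) := fun N => by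
      refine (eLpNorm_le_of_ae_bound (C := ∑' k, ‖y (k + N)‖)
        (Eventually.of_forall fun t => ?_)).trans ?_
      · rw [← (hs t).sum_add_tsum_nat_add N, add_sub_cancel_left]
        refine (norm_tsum_le_tsum_norm ?_).trans (by simp)
        simpa using (summable_nat_add_iff N).2 hy
      · simp
    rw [← tendsto_eLpNorm_circ]
    refine tendsto_of_tendsto_of_tendsto_of_le_of_le tendsto_const_nhds ?_ (fun _ => zero_le) hbd
    have := ENNReal.tendsto_ofReal (tendsto_sum_nat_add fun k => ‖y k‖)
    simpa using this

lemma norm_mul_expo (r : ℝ) (hr : 0 ≤ r) (k : ℤ) (t : ℝ) : ‖(r : ℂ) * expo k t‖ = r := by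
  simp [abs_of_nonneg hr]

/-- The restriction of a power series to the circle of radius `r`. -/
lemma isFourierSum_dilate {x : ℕ → ℂ} {r : ℝ} (hr : 0 ≤ r)
    (hx : Summable fun k => ‖x k‖ * r ^ k) :
    IsFourierSum (-1) (fun k => x k * r ^ k) fun t => ∑' k, x k * (r * expo (-1) t) ^ k := by
  have := isFourierSum_of_summable (σ := -1) (y := fun k => x k * r ^ k)
    (by simpa [abs_of_nonneg hr] using hx)
  convert this using 4 with t k
  rw [mul_pow, ← expo_mul_natCast, mul_assoc]
  congr 2
  rw [expo]; congr 1; push_cast; ring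

lemma summable_of_norm_le {x : ℕ → ℂ} {C : ℝ} (hx : ∀ k, ‖x k‖ ≤ C) {r : ℝ} (hr : 0 ≤ r)
    (hr1 : r < 1) : Summable fun k => ‖x k‖ * r ^ k := by
  refine Summable.of_nonneg_of_le (fun k => by positivity)
    (fun k => mul_le_mul_of_nonneg_right (hx k) (by positivity))
    ((summable_geometric_of_lt_one hr hr1).mul_left C)

lemma norm_fc_le_sqrt {F : ℝ → ℂ} (hF : MemLp F 2 circ) (k : ℤ) :
    ‖fc F k‖ ≤ Real.sqrt (∫ t, ‖F t‖ ^ 2 ∂circ) :=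
  Real.le_sqrt_of_sq_le (norm_fc_le hF k)

lemma summable_fc_mul_pow {F : ℝ → ℂ} (hF : MemLp F 2 circ) {r : ℝ} (hr : 0 ≤ r) (hr1 : r < 1) :
    Summable fun k : ℕ => ‖fc F (-k)‖ * r ^ k :=
  summable_of_norm_le (fun k => norm_fc_le_sqrt hF (-k)) hr hr1

lemma hasSum_discExt {F : ℝ → ℂ} (hF : MemLp F 2 circ) {z : ℂ} (hz : ‖z‖ < 1) :
    HasSum (fun k : ℕ => fc F (-k) * z ^ k) (discExt F z) := by
  refine Summable.hasSum (Summable.of_norm ?_)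
  simpa using summable_fc_mul_pow hF (norm_nonneg z) hz

/-- Radial limits of functions in the Hardy space. -/
lemma Hardy.exists_radial {F : ℝ → ℂ} (hF : Hardy F) {r : ℕ → ℝ} (hr : ∀ n, 0 ≤ r n)
    (hr1 : ∀ n, r n < 1) (hlim : Tendsto r atTop (𝓝 1)) :
    ∃ s : ℕ → ℕ, StrictMono s ∧ ∀ᵐ t ∂circ,
      Tendsto (fun n => discExt F (r (s n) * expo (-1) t)) atTop (𝓝 (F t)) := by
  have hd : ∀ n, IsFourierSum (-1) (fun k => fc F (-k) * r n ^ k)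
      (fun t => discExt F (r n * expo (-1) t)) := fun n =>
    isFourierSum_dilate (hr n) (summable_fc_mul_pow hF.1 (hr n) (hr1 n))
  have hd' := fun n => isFourierSum_neg_one_iff.1 (hd n)
  refine exists_subseq_tendsto_ae (fun n => (hd' n).1.1) hF.1 ?_
  -- By Parseval the squared distance is $\sum_k|x_k|^2(1-r^k)^2$, which tends to zero by domination
  -- by $\sum_k|x_k|^2$.
  have hsq : ∀ n, ∫ t, ‖discExt F (r n * expo (-1) t) - F t‖ ^ 2 ∂circ =
      ∑' k : ℕ, ‖fc F (-k) * r n ^ k - fc F (-k)‖ ^ 2 := fun n => by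
    rw [← (((hd' n).1.sub hF).hasSum_sq).tsum_eq]
    congr 1 with k
    rw [fc_sub (hd' n).1.1 hF.1, (hd' n).2]
  simp_rw [hsq]
  have h0 : (0 : ℝ) = ∑' k : ℕ, (0 : ℝ) := by simp
  rw [h0]
  refine tendsto_tsum_of_dominated_convergence (bound := fun k : ℕ => ‖fc F (-k)‖ ^ 2)
    hF.hasSum_sq.summable (fun k => ?_) (Eventually.of_forall fun n k => ?_)
  · have h1 : Tendsto (fun n => ((r n : ℝ) : ℂ)) atTop (𝓝 1) := by
      exact_mod_cast (Complex.continuous_ofReal.tendsto 1).comp hlim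
    have := ((((h1.pow k).const_mul (fc F (-k))).sub_const (fc F (-k))).norm).pow 2
    simpa using this
  · rw [Real.norm_of_nonneg (by positivity)]
    have e : fc F (-k) * (r n : ℂ) ^ k - fc F (-k) = fc F (-k) * ((r n ^ k - 1 : ℝ) : ℂ) := by
      push_cast; ring
    rw [e, norm_mul, mul_pow]
    refine mul_le_of_le_one_right (by positivity) ?_
    rw [Complex.norm_real, Real.norm_eq_abs, sq_abs]
    have h1 : r n ^ k ≤ 1 := pow_le_one₀ (hr n) (hr1 n).le
    have h2 : 0 ≤ r n ^ k := pow_nonneg (hr n) k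
    nlinarith

/-! ### Cauchy, Herglotz and Poisson kernels. -/

lemma one_sub_mul_expo_ne_zero {z : ℂ} (hz : ‖z‖ < 1) (t : ℝ) : 1 - z * expo 1 t ≠ 0 := by
  intro h
  have : ‖z * expo 1 t‖ = 1 := by rw [← sub_eq_zero.1 h]; simp
  rw [norm_mul, norm_expo, mul_one] at this
  linarith

lemma norm_cauchy_le {z : ℂ} (hz : ‖z‖ < 1) (t : ℝ) :
    ‖(1 - z * expo 1 t)⁻¹‖ ≤ (1 - ‖z‖)⁻¹ := by
  rw [norm_inv]
  refine inv_anti₀ (by linarith) ?_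
  have := norm_sub_norm_le 1 (z * expo 1 t)
  simpa using this

lemma continuous_cauchy {z : ℂ} (hz : ‖z‖ < 1) : Continuous fun t => (1 - z * expo 1 t)⁻¹ :=
  Continuous.inv₀ (by fun_prop) (one_sub_mul_expo_ne_zero hz)

lemma integrable_cauchy {F : ℝ → ℂ} (hF : Integrable F circ) {z : ℂ} (hz : ‖z‖ < 1) :
    Integrable (fun t => (1 - z * expo 1 t)⁻¹ * F t) circ :=
  memLp_one_iff_integrable.1 (memLp_bdd_mul (continuous_cauchy hz).aestronglyMeasurable
    (Eventually.of_forall (norm_cauchy_le hz)) (memLp_one_iff_integrable.2 hF))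

/-- Cauchy's integral formula. -/
lemma hasSum_cauchy {F : ℝ → ℂ} (hF : Integrable F circ) {z : ℂ} (hz : ‖z‖ < 1) :
    HasSum (fun k : ℕ => fc F (-k) * z ^ k) (∫ t, (1 - z * expo 1 t)⁻¹ * F t ∂circ) := by
  have h := hasSum_integral_of_summable_integral_norm (μ := circ)
    (F := fun (k : ℕ) t => (expo k t * F t) * z ^ k)
    (fun k => (integrable_expo_mul hF k).mul_const _) (by
      simp only [norm_mul, norm_expo, one_mul, norm_pow]
      simp_rw [integral_mul_const]
      exact (summable_geometric_of_lt_one (norm_nonneg _) hz).mul_left _)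
  have e1 : ∀ k : ℕ, fc F (-k) * z ^ k = ∫ t, expo k t * F t * z ^ k ∂circ := fun k => by
    rw [fc, neg_neg]
    exact (integral_mul_const _ _).symm
  have e2 : ∫ t, (1 - z * expo 1 t)⁻¹ * F t ∂circ =
      ∫ t, ∑' k : ℕ, expo k t * F t * z ^ k ∂circ := by
    refine integral_congr_ae (Eventually.of_forall fun t => ?_)
    have h1 : HasSum (fun k : ℕ => (expo k t * F t) * z ^ k) ((1 - z * expo 1 t)⁻¹ * F t) := by
      have h2 := (hasSum_geometric_of_norm_lt_one (ξ := z * expo 1 t)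
        (by simpa using hz)).mul_right (F t)
      refine h2.congr_fun fun k => ?_
      rw [mul_pow, ← expo_mul_natCast, one_mul]; ring
    exact h1.tsum_eq.symm
  simp_rw [e1, e2]
  exact h

/-- The Herglotz kernel `(e^{-it} + z) / (e^{-it} - z)`. -/
def hergK (z : ℂ) (t : ℝ) : ℂ := 2 * (1 - z * expo 1 t)⁻¹ - 1

/-- The real part is the Poisson kernel. Its positivity, together with `integral_hergK_re`, makes it
a probability density, so bounds on boundary values pass to the disc. -/
lemma hergK_re {z : ℂ} (hz : ‖z‖ < 1) (t : ℝ) :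
    (hergK z t).re = (1 - ‖z‖ ^ 2) * ‖(1 - z * expo 1 t)⁻¹‖ ^ 2 := by
  have h := one_sub_mul_expo_ne_zero hz t
  set v := z * expo 1 t with hv
  have hn : ‖z‖ = ‖v‖ := by simp [hv]
  have h0 : Complex.normSq (1 - v) ≠ 0 := by simpa using h
  rw [hergK, ← hv, hn, norm_inv, inv_pow, ← Complex.normSq_eq_norm_sq, ← Complex.normSq_eq_norm_sq]
  simp only [Complex.sub_re, Complex.mul_re, Complex.re_ofNat, Complex.im_ofNat, Complex.inv_re,
    Complex.one_re, zero_mul, sub_zero]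
  field_simp
  simp only [Complex.normSq_apply, Complex.sub_re, Complex.sub_im, Complex.one_re, Complex.one_im]
  ring

lemma hergK_re_nonneg {z : ℂ} (hz : ‖z‖ < 1) (t : ℝ) : 0 ≤ (hergK z t).re := by
  rw [hergK_re hz]
  have : ‖z‖ ^ 2 ≤ 1 := pow_le_one₀ (norm_nonneg _) hz.le
  exact mul_nonneg (by linarith) (by positivity)

lemma integrable_hergK_mul {F : ℝ → ℂ} (hF : Integrable F circ) {z : ℂ} (hz : ‖z‖ < 1) :
    Integrable (fun t => hergK z t * F t) circ := by
  simp only [hergK, sub_mul, one_mul, mul_assoc]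
  exact ((integrable_cauchy hF hz).const_mul 2).sub hF

/-- The kernel only sees nonpositive frequencies, so `F` need not belong to the Hardy space. -/
lemma integral_hergK_mul {F : ℝ → ℂ} (hF : MemLp F 2 circ) {z : ℂ} (hz : ‖z‖ < 1) :
    ∫ t, hergK z t * F t ∂circ = 2 * discExt F z - fc F 0 := by
  have hi := integrable_of_memLp hF
  have h1 : ∫ t, (1 - z * expo 1 t)⁻¹ * F t ∂circ = discExt F z :=
    (hasSum_cauchy hi hz).unique (hasSum_discExt hF hz)
  simp only [hergK, sub_mul, one_mul, mul_assoc]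
  rw [integral_sub ((integrable_cauchy hi hz).const_mul 2) hi, integral_const_mul, h1]
  simp [fc]

/-- The Poisson integral formula. -/
lemma Hardy.poisson {F : ℝ → ℂ} (hF : Hardy F) {z : ℂ} (hz : ‖z‖ < 1) :
    ∫ t, ((hergK z t).re : ℂ) * F t ∂circ = discExt F z := by
  have hi := integrable_of_memLp hF.1
  have h1 := integral_hergK_mul hF.1 hz
  have h2 := integral_hergK_mul (memLp_conj hF.1) hz
  -- The conjugate of `F` has no negative frequencies, so only its mean is visible to the kernel.
  -- Conjugating back handles the antianalytic half of the Poisson kernel.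
  have h3 : discExt (fun t => conj (F t)) z = conj (fc F 0) := by
    rw [discExt, tsum_eq_single 0]
    · simp [fc_conj]
    · intro k hk
      rw [fc_conj, hF.2 _ (by simp; omega)]; simp
  rw [h3, fc_conj] at h2
  have h4 : ∫ t, conj (hergK z t) * F t ∂circ = fc F 0 := by
    have := congrArg conj h2
    rw [← integral_conj] at this
    simp only [map_mul, Complex.conj_conj, map_sub, map_ofNat, neg_zero] at this
    rw [this]; ring
  have h5 : ∀ t, ((hergK z t).re : ℂ) * F t =
      2⁻¹ * (hergK z t * F t) + 2⁻¹ * (conj (hergK z t) * F t) := fun t => by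
    rw [Complex.re_eq_add_conj]; ring
  have h6 : Integrable (fun t => conj (hergK z t) * F t) circ := by
    have := integrable_hergK_mul (integrable_of_memLp (memLp_conj hF.1)) hz
    have h7 := (memLp_one_iff_integrable.1 (memLp_conj (memLp_one_iff_integrable.2 this)))
    simpa using h7
  simp_rw [h5]
  rw [integral_add ((integrable_hergK_mul hi hz).const_mul _) (h6.const_mul _),
    integral_const_mul, integral_const_mul, h1, h4]
  ring

lemma hardy_const (c : ℂ) : Hardy fun _ => c := by
  refine ⟨memLp_const _, fun j hj => ?_⟩
  have := fc_const_mul c (expo 0) j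
  rw [fc_expo, if_neg hj.ne, mul_zero] at this
  simpa using this

lemma fc_const_zero (c : ℂ) : fc (fun _ => c) 0 = c := by simp [fc]

lemma integrable_hergK_re {z : ℂ} (hz : ‖z‖ < 1) : Integrable (fun t => (hergK z t).re) circ := by
  simpa using (integrable_hergK_mul (F := fun _ => 1) (integrable_const _) hz).re

lemma integral_hergK_re {z : ℂ} (hz : ‖z‖ < 1) : ∫ t, (hergK z t).re ∂circ = 1 := by
  have h := (hardy_const 1).poisson hz
  simp only [mul_one] at h
  rw [integral_complex_ofReal] at h
  have h2 : discExt (fun _ => (1 : ℂ)) z = 1 := by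
    rw [discExt, tsum_eq_single 0]
    · simp [fc_const_zero]
    · intro k hk
      have := fc_const_mul 1 (expo 0) (-k)
      rw [fc_expo, if_neg (by simp; omega), mul_zero] at this
      simp only [expo_zero, mul_one] at this
      rw [this, zero_mul]
  rw [h2] at h
  exact_mod_cast h

/-- Values in the disc are Poisson averages of the boundary values. -/
lemma Hardy.norm_discExt_le {F : ℝ → ℂ} (hF : Hardy F) {M : ℝ} (hM : ∀ᵐ t ∂circ, ‖F t‖ ≤ M)
    {z : ℂ} (hz : ‖z‖ < 1) : ‖discExt F z‖ ≤ M := by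
  rw [← hF.poisson hz]
  refine (norm_integral_le_of_norm_le ((integrable_hergK_re hz).mul_const M) ?_).trans ?_
  · filter_upwards [hM] with t ht
    rw [norm_mul, Complex.norm_real, Real.norm_of_nonneg (hergK_re_nonneg hz t)]
    exact mul_le_mul_of_nonneg_left ht (hergK_re_nonneg hz t)
  · rw [integral_mul_const, integral_hergK_re hz, one_mul]

lemma exists_seq_tendsto_one : ∃ r : ℕ → ℝ, (∀ n, 0 ≤ r n) ∧ (∀ n, r n < 1) ∧
    Tendsto r atTop (𝓝 1) := by
  refine ⟨fun n => 1 - 1 / ((n : ℝ) + 1), fun n => ?_, fun n => ?_, ?_⟩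
  · have : 1 / ((n : ℝ) + 1) ≤ 1 := by
      rw [div_le_one (by positivity)]; linarith [n.cast_nonneg (α := ℝ)]
    linarith
  · have : 0 < 1 / ((n : ℝ) + 1) := by positivity
    linarith
  · simpa using (tendsto_one_div_add_atTop_nhds_zero_nat (𝕜 := ℝ)).const_sub 1

/-- Bounded functions in the Hardy space are boundedly approximated by polynomials. -/
lemma Hardy.exists_polynomial {F : ℝ → ℂ} (hF : Hardy F) {M : ℝ}
    (hM : ∀ᵐ t ∂circ, ‖F t‖ ≤ M) :
    ∃ p : ℕ → Polynomial ℂ, (∀ n t, ‖(p n).eval (expo (-1) t)‖ ≤ M + 1) ∧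
      ∀ᵐ t ∂circ, Tendsto (fun n => (p n).eval (expo (-1) t)) atTop (𝓝 (F t)) := by
  obtain ⟨r, hr, hr1, hlim⟩ := exists_seq_tendsto_one
  obtain ⟨s, hs, hae⟩ := hF.exists_radial hr hr1 hlim
  have hsum := fun n => summable_fc_mul_pow hF.1 (hr (s n)) (hr1 (s n))
  -- The polynomials are truncated Taylor series on circles of radius `r (s n)`. The truncation
  -- error is uniform in `t` and at most 1, whence the bound `M + 1`.
  have hN : ∀ n : ℕ, ∃ N : ℕ, ∑' k : ℕ, ‖fc F (-((k + N : ℕ) : ℤ))‖ * r (s n) ^ (k + N) ≤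
      1 / ((n : ℝ) + 1) := fun n => by
    have h := tendsto_sum_nat_add fun k : ℕ => ‖fc F (-(k : ℤ))‖ * r (s n) ^ k
    have hpos : (0 : ℝ) < 1 / ((n : ℝ) + 1) := by positivity
    exact ((h.eventually_lt_const hpos).exists).imp fun N h => h.le
  choose N hN using hN
  have hdist : ∀ n t, ‖(∑ k ∈ Finset.range (N n), Polynomial.C (fc F (-k) * (r (s n) : ℂ) ^ k) *
      Polynomial.X ^ k : Polynomial ℂ).eval (expo (-1) t) -
      discExt F (r (s n) * expo (-1) t)‖ ≤ 1 / ((n : ℝ) + 1) := fun n t => by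
    have h1 := hasSum_discExt hF.1 (z := r (s n) * expo (-1) t)
      (by rw [norm_mul_expo _ (hr _)]; exact hr1 _)
    rw [← h1.tsum_eq, ← h1.summable.sum_add_tsum_nat_add (N n), Polynomial.eval_finsetSum]
    have h2 : ∀ k : ℕ, (Polynomial.C (fc F (-k) * (r (s n) : ℂ) ^ k) * Polynomial.X ^ k :
        Polynomial ℂ).eval (expo (-1) t) = fc F (-(k : ℤ)) * (r (s n) * expo (-1) t) ^ k :=
      fun k => by simp [mul_pow, mul_assoc]
    simp_rw [h2]
    rw [sub_add_cancel_left, norm_neg]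
    refine le_trans ?_ (hN n)
    have h3 : ∀ k : ℕ, ‖fc F (-((k + N n : ℕ) : ℤ)) * (r (s n) * expo (-1) t) ^ (k + N n)‖ =
        ‖fc F (-((k + N n : ℕ) : ℤ))‖ * r (s n) ^ (k + N n) := fun k => by
      rw [norm_mul, norm_pow, norm_mul_expo _ (hr _)]
    refine (norm_tsum_le_tsum_norm ?_).trans (by simp_rw [h3]; exact le_rfl)
    simp_rw [h3]
    exact (summable_nat_add_iff (N n)).2 (hsum n)
  refine ⟨fun n => ∑ k ∈ Finset.range (N n), Polynomial.C (fc F (-k) * (r (s n) : ℂ) ^ k) *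
    Polynomial.X ^ k, fun n t => ?_, ?_⟩
  · have h1 := hF.norm_discExt_le hM (z := r (s n) * expo (-1) t)
      (by rw [norm_mul_expo _ (hr _)]; exact hr1 _)
    have h2 := norm_le_norm_add_norm_sub' _ _ |>.trans (add_le_add h1 (hdist n t))
    refine h2.trans ?_
    have : 1 / ((n : ℝ) + 1) ≤ 1 := by
      rw [div_le_one (by positivity)]; linarith [n.cast_nonneg (α := ℝ)]
    linarith
  · filter_upwards [hae] with t ht
    have h0 := squeeze_zero_norm (fun n => hdist n t) tendsto_one_div_add_atTop_nhds_zero_nat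
    simpa using h0.add ht

end Extrapolation

end

noncomputable section

namespace Extrapolation

/-! ### Outer functions -/

/-- `h` is the boundary function of the analytic function on the disc whose real part is the
Poisson integral of `u` and which is real at the origin. -/
structure IsCompletion (u : ℝ → ℝ) (h : ℝ → ℂ) : Prop where
  hardy : Hardy h
  re_eq : ∀ᵐ t ∂circ, (h t).re = u t
  im_zero : (fc h 0).im = 0

lemma IsCompletion.memLp {u : ℝ → ℝ} {h : ℝ → ℂ} (hu : IsCompletion u h) :
    MemLp (fun t => (u t : ℂ)) 2 circ := by
  refine (memLp_congr_ae ?_).1 ((hu.hardy.1.add (memLp_conj hu.hardy.1)).const_mul 2⁻¹)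
  filter_upwards [hu.re_eq] with t ht
  rw [← ht, Complex.re_eq_add_conj]
  simp only [Pi.add_apply]; ring

lemma IsCompletion.sub {u v : ℝ → ℝ} {h k : ℝ → ℂ} (hu : IsCompletion u h)
    (hv : IsCompletion v k) : IsCompletion (fun t => u t - v t) fun t => h t - k t where
  hardy := hu.hardy.sub hv.hardy
  re_eq := by
    filter_upwards [hu.re_eq, hv.re_eq] with t h1 h2
    simp [h1, h2]
  im_zero := by rw [fc_sub hu.hardy.1 hv.hardy.1]; simp [hu.im_zero, hv.im_zero]

lemma IsCompletion.const_mul {u : ℝ → ℝ} {h : ℝ → ℂ} (hu : IsCompletion u h) (c : ℝ) :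
    IsCompletion (fun t => c * u t) fun t => c * h t where
  hardy := hu.hardy.const_mul c
  re_eq := by
    filter_upwards [hu.re_eq] with t h1
    simp [h1]
  im_zero := by rw [fc_const_mul]; simp [hu.im_zero]

/-- The completion doubles the negative frequencies of `u`, keeps the mean and drops the positive
ones. Its real part is `u` because the coefficients of a real function are conjugate symmetric. -/
lemma exists_isCompletion {u : ℝ → ℝ} (hu : MemLp (fun t => (u t : ℂ)) 2 circ) :
    ∃ h, IsCompletion u h := by
  set U : ℝ → ℂ := fun t => (u t : ℂ) with hU
  have hneg : ∀ j, fc U (-j) = conj (fc U j) := fun j => by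
    have := fc_conj U (-j)
    simpa [hU] using this
  obtain ⟨h, hh, hc⟩ := exists_fc_eq (c := fun j => if j < 0 then 2 * fc U j else
    if j = 0 then fc U 0 else 0) (by
      refine Summable.of_nonneg_of_le (fun _ => by positivity) (fun j => ?_)
        ((hasSum_sq_fc hu).summable.mul_left 4)
      split_ifs with h1 h2
      · rw [norm_mul, mul_pow]; norm_num
      · rw [h2]; nlinarith [sq_nonneg ‖fc U 0‖]
      · simp)
  have h0 : fc h 0 = fc U 0 := by simp [hc]
  have hreal : conj (fc U 0) = fc U 0 := by rw [← hneg]; simp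
  refine ⟨h, ⟨hh, fun j hj => by rw [hc]; simp [hj.not_gt, hj.ne']⟩, ?_, ?_⟩
  · have hae : (fun t => 2⁻¹ * (h t + conj (h t))) =ᵐ[circ] U := by
      refine ae_eq_of_fc_eq ((hh.add (memLp_conj hh)).const_mul _) hu fun j => ?_
      rw [fc_const_mul, fc_add hh (memLp_conj hh), fc_conj]
      rcases lt_trichotomy j 0 with hj | hj | hj
      · rw [hc, hc, if_pos hj, if_neg (by omega), if_neg (by omega)]; simp
      · subst hj
        rw [neg_zero, h0, hreal]; ring
      · rw [hc, hc, if_neg (by omega), if_neg (by omega), if_pos (by omega), map_mul, hneg,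
          map_ofNat]
        simp
    filter_upwards [hae] with t ht
    have : ((h t).re : ℂ) = (u t : ℂ) := by
      rw [← hU] at *
      rw [Complex.re_eq_add_conj]
      change _ = U t
      rw [← ht]; ring
    exact_mod_cast this
  · rw [h0]; exact Complex.conj_eq_iff_im.1 hreal

lemma discExt_conj {F : ℝ → ℂ} (hF : Hardy F) (z : ℂ) :
    discExt (fun t => conj (F t)) z = conj (fc F 0) := by
  rw [discExt, tsum_eq_single 0]
  · simp [fc_conj]
  · intro k hk
    rw [fc_conj, hF.2 _ (by simp; omega)]; simp

/-- The Herglotz integral. -/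
lemma IsCompletion.herglotz {u : ℝ → ℝ} {h : ℝ → ℂ} (hu : IsCompletion u h) {z : ℂ}
    (hz : ‖z‖ < 1) : ∫ t, hergK z t * (u t : ℂ) ∂circ = discExt h z := by
  have h1 := integral_hergK_mul hu.hardy.1 hz
  have h2 := integral_hergK_mul (memLp_conj hu.hardy.1) hz
  rw [discExt_conj hu.hardy, fc_conj, neg_zero] at h2
  have hreal : conj (fc h 0) = fc h 0 := Complex.conj_eq_iff_im.2 hu.im_zero
  have h3 : ∫ t, hergK z t * (u t : ℂ) ∂circ =
      ∫ t, (2⁻¹ * (hergK z t * h t) + 2⁻¹ * (hergK z t * conj (h t))) ∂circ := by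
    refine integral_congr_ae ?_
    filter_upwards [hu.re_eq] with t ht
    rw [← ht, Complex.re_eq_add_conj]; ring
  rw [h3, integral_add, integral_const_mul, integral_const_mul, h1, h2, hreal]
  · ring
  · exact (integrable_hergK_mul (integrable_of_memLp hu.hardy.1) hz).const_mul _
  · exact (integrable_hergK_mul (integrable_of_memLp (memLp_conj hu.hardy.1)) hz).const_mul _

lemma IsCompletion.re_discExt_le {u : ℝ → ℝ} {h : ℝ → ℂ} (hu : IsCompletion u h) {C : ℝ}
    (hC : ∀ᵐ t ∂circ, u t ≤ C) {z : ℂ} (hz : ‖z‖ < 1) : (discExt h z).re ≤ C := by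
  have hi := integrable_hergK_mul (integrable_of_memLp hu.memLp) hz
  rw [← hu.herglotz hz]
  have h1 : (∫ t, hergK z t * (u t : ℂ) ∂circ).re = ∫ t, (hergK z t).re * u t ∂circ := by
    have := integral_re hi
    simpa using! this.symm
  rw [h1]
  calc ∫ t, (hergK z t).re * u t ∂circ ≤ ∫ t, (hergK z t).re * C ∂circ := by
        refine integral_mono_ae ?_ ((integrable_hergK_re hz).mul_const C) ?_
        · simpa using! hi.re
        · filter_upwards [hC] with t ht
          exact mul_le_mul_of_nonneg_left ht (hergK_re_nonneg hz t)
    _ = C := by rw [integral_mul_const, integral_hergK_re hz, one_mul]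

lemma differentiableOn_discExt {F : ℝ → ℂ} (hF : MemLp F 2 circ) :
    DifferentiableOn ℂ (discExt F) (Metric.ball 0 1) := by
  intro z hz
  rw [mem_ball_zero_iff] at hz
  obtain ⟨r, hzr, hr1⟩ := exists_between hz
  have hr : 0 ≤ r := (norm_nonneg z).trans hzr.le
  have h := Complex.differentiableOn_tsum_of_summable_norm
    (F := fun (k : ℕ) (w : ℂ) => fc F (-k) * w ^ k) (U := Metric.ball 0 r)
    (summable_fc_mul_pow hF hr hr1) (fun k => by fun_prop) Metric.isOpen_ball
    (fun k w hw => by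
      rw [mem_ball_zero_iff] at hw
      rw [norm_mul, norm_pow]
      gcongr)
  exact (h.differentiableAt
    (Metric.isOpen_ball.mem_nhds (by simpa using hzr))).differentiableWithinAt

/-! ### Exponentials of completions. -/

lemma IsCompletion.norm_exp {u : ℝ → ℝ} {h : ℝ → ℂ} (hu : IsCompletion u h) :
    ∀ᵐ t ∂circ, ‖Complex.exp (h t)‖ = Real.exp (u t) := by
  filter_upwards [hu.re_eq] with t ht
  rw [Complex.norm_exp, ht]

lemma IsCompletion.norm_exp_le {u : ℝ → ℝ} {h : ℝ → ℂ} (hu : IsCompletion u h) {C : ℝ}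
    (hC : ∀ᵐ t ∂circ, u t ≤ C) : ∀ᵐ t ∂circ, ‖Complex.exp (h t)‖ ≤ Real.exp C := by
  filter_upwards [hu.norm_exp, hC] with t ht h2
  rw [ht]; exact Real.exp_le_exp.2 h2

lemma IsCompletion.aesm_exp {u : ℝ → ℝ} {h : ℝ → ℂ} (hu : IsCompletion u h) :
    AEStronglyMeasurable (fun t => Complex.exp (h t)) circ :=
  Complex.continuous_exp.comp_aestronglyMeasurable hu.hardy.1.1

/-- A power series that converges in a disc converges absolutely there. -/
lemma summable_norm_mul_pow {x : ℕ → ℂ} {R : ℝ}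
    (h : ∀ z : ℂ, ‖z‖ < R → Summable fun k => x k * z ^ k)
    {r : ℝ} (hr : 0 ≤ r) (hrR : r < R) : Summable fun k => ‖x k‖ * r ^ k := by
  -- At an intermediate radius `s` the terms are bounded, so at `r` they are dominated by a
  -- geometric series of ratio `r / s`.
  obtain ⟨s, hrs, hsR⟩ := exists_between hrR
  have hs0 : 0 < s := hr.trans_lt hrs
  have h1 := h s (by rw [Complex.norm_real, Real.norm_of_nonneg hs0.le]; exact hsR)
  obtain ⟨B, hB⟩ := h1.tendsto_atTop_zero.norm.bddAbove_range
  have h2 := summable_of_norm_le (x := fun k => x k * (s : ℂ) ^ k) (C := B)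
    (fun k => hB ⟨k, rfl⟩) (r := r / s) (by positivity) ((div_lt_one hs0).2 hrs)
  refine h2.congr fun k => ?_
  rw [norm_mul, norm_pow, Complex.norm_real, Real.norm_of_nonneg hs0.le, mul_assoc, ← mul_pow,
    mul_div_cancel₀ _ hs0.ne']

/-- The boundary values of the outer function with modulus `exp u`. -/
lemma IsCompletion.isFourierSum_exp {u : ℝ → ℝ} {h : ℝ → ℂ} (hu : IsCompletion u h) {C : ℝ}
    (hC : ∀ᵐ t ∂circ, u t ≤ C) :
    IsFourierSum (-1) (fun k => iteratedDeriv k (fun z => Complex.exp (discExt h z)) 0 /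
      (k.factorial : ℂ)) fun t => Complex.exp (h t) := by
  set g : ℂ → ℂ := fun z => Complex.exp (discExt h z) with hg
  set x : ℕ → ℂ := fun k => iteratedDeriv k g 0 / (k.factorial : ℂ) with hx
  have hd : DifferentiableOn ℂ g (Metric.ball 0 1) := (differentiableOn_discExt hu.hardy.1).cexp
  have hsum : ∀ z : ℂ, ‖z‖ < 1 → HasSum (fun k => x k * z ^ k) (g z) := fun z hz => by
    have := Complex.hasSum_taylorSeries_on_ball (r := 1) hd (z := z) (by simpa using hz)
    refine this.congr_fun fun k => ?_
    simp only [hx, sub_zero, smul_eq_mul]; ring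
  have habs : ∀ r : ℝ, 0 ≤ r → r < 1 → Summable fun k => ‖x k‖ * r ^ k := fun r hr hr1 =>
    summable_norm_mul_pow (fun z hz => (hsum z hz).summable) hr hr1
  have hbd : ∀ z : ℂ, ‖z‖ < 1 → ‖g z‖ ≤ Real.exp C := fun z hz => by
    rw [hg, Complex.norm_exp]; exact Real.exp_le_exp.2 (hu.re_discExt_le hC hz)
  obtain ⟨r, hr, hr1, hlim⟩ := exists_seq_tendsto_one
  obtain ⟨s, hs, hae⟩ := hu.hardy.exists_radial hr hr1 hlim
  have hlim' := hlim.comp hs.tendsto_atTop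
  have hlt : ∀ n t, ‖(r (s n) : ℂ) * expo (-1) t‖ < 1 := fun n t => by
    rw [norm_mul_expo _ (hr _)]; exact hr1 _
  have hG : ∀ n, IsFourierSum (-1) (fun k => x k * r (s n) ^ k)
      fun t => g (r (s n) * expo (-1) t) := fun n => by
    have := isFourierSum_dilate (hr (s n)) (habs _ (hr (s n)) (hr1 _))
    convert this using 2 with t
    exact (hsum _ (hlt n t)).tsum_eq.symm
  have hG' := fun n => isFourierSum_neg_one_iff.1 (hG n)
  -- In the disc the exponential is bounded by `exp C`, so dominated convergence along radii carries
  -- the Taylor coefficients over to the boundary function.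
  have hfc : ∀ j, Tendsto (fun n => fc (fun t => g (r (s n) * expo (-1) t)) j) atTop
      (𝓝 (fc (fun t => Complex.exp (h t)) j)) := fun j => by
    refine tendsto_integral_of_dominated_convergence (fun _ => Real.exp C)
      (fun n => (memLp_expo_mul _ (hG' n).1.1).1) (integrable_const _)
      (fun n => Eventually.of_forall fun t => ?_) ?_
    · rw [norm_mul, norm_expo, one_mul]
      exact hbd _ (hlt n t)
    · filter_upwards [hae] with t ht
      exact ((Complex.continuous_exp.tendsto _).comp ht).const_mul _
  have hmem : MemLp (fun t => Complex.exp (h t)) 2 circ :=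
    memLp_of_bdd hu.aesm_exp (hu.norm_exp_le hC)
  refine isFourierSum_neg_one_iff.2 ⟨⟨hmem, fun j hj => ?_⟩, fun k => ?_⟩
  · refine tendsto_nhds_unique (hfc j) (tendsto_const_nhds.congr fun n => ?_)
    exact ((hG' n).1.2 j hj).symm
  · refine tendsto_nhds_unique (hfc (-k)) ?_
    simp_rw [(hG' _).2]
    have h1 : Tendsto (fun n => ((r (s n) : ℝ) : ℂ)) atTop (𝓝 1) := by
      exact_mod_cast (Complex.continuous_ofReal.tendsto 1).comp hlim'
    simpa using (h1.pow k).const_mul (x k)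

lemma IsCompletion.hardy_exp {u : ℝ → ℝ} {h : ℝ → ℂ} (hu : IsCompletion u h) {C : ℝ}
    (hC : ∀ᵐ t ∂circ, u t ≤ C) : Hardy fun t => Complex.exp (h t) :=
  (isFourierSum_neg_one_iff.1 (hu.isFourierSum_exp hC)).1

/-- The mean of the boundary function is the value at the origin, where the Herglotz kernel is 1.
This is the equality case of Jensen's inequality that characterises outer functions. -/
lemma IsCompletion.fc_exp_zero {u : ℝ → ℝ} {h : ℝ → ℂ} (hu : IsCompletion u h) {C : ℝ}
    (hC : ∀ᵐ t ∂circ, u t ≤ C) :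
    fc (fun t => Complex.exp (h t)) 0 = (Real.exp (∫ t, u t ∂circ) : ℝ) := by
  have h1 := (isFourierSum_neg_one_iff.1 (hu.isFourierSum_exp hC)).2 0
  have h2 := hu.herglotz (z := 0) (by simp)
  simp only [CharP.cast_eq_zero, neg_zero, iteratedDeriv_zero, Nat.factorial_zero, Nat.cast_one,
    div_one] at h1
  rw [h1, ← h2]
  have : ∀ t, hergK 0 t = 1 := fun t => by rw [hergK]; norm_num
  simp only [this, one_mul, integral_complex_ofReal, Complex.ofReal_exp]

/-- Outer functions are uniform limits, in the sense of dominated convergence, of functions that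
are boundedly invertible. -/
lemma IsCompletion.exists_truncation {u : ℝ → ℝ} {h : ℝ → ℂ} (hu : IsCompletion u h) :
    ∃ E : ℕ → ℝ → ℂ, (∀ n, Hardy (E n)) ∧ (∀ n, ∃ B, ∀ᵐ t ∂circ, ‖E n t‖ ≤ B) ∧
      (∀ n, ∀ᵐ t ∂circ, ‖E n t * Complex.exp (h t)‖ ≤ 1) ∧
      ∀ᵐ t ∂circ, Tendsto (fun n => E n t * Complex.exp (h t)) atTop (𝓝 1) := by
  have hui := hu.memLp
  have hur : AEStronglyMeasurable u circ := by
    have := Complex.continuous_re.comp_aestronglyMeasurable hui.1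
    simpa using! this
  -- Let `k N` complete the truncation `max u (-N)`; the functions `E` are the exponentials of `-k
  -- N` along a subsequence. Such an exponential is bounded by `exp N`, and its product with `exp h`
  -- has modulus `exp (u - max u (-N)) ≤ 1`.
  have htr : ∀ N : ℕ, ∃ k, IsCompletion (fun t => max (u t) (-N)) k := fun N => by
    refine exists_isCompletion (MemLp.of_le hui ?_ (Eventually.of_forall fun t => ?_))
    · exact Complex.continuous_ofReal.comp_aestronglyMeasurable
        (hur.sup aestronglyMeasurable_const)
    · rw [Complex.norm_real, Complex.norm_real, Real.norm_eq_abs, Real.norm_eq_abs]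
      have : (0 : ℝ) ≤ N := N.cast_nonneg
      rcases max_cases (u t) (-(N : ℝ)) with ⟨h1, h2⟩ | ⟨h1, h2⟩ <;> rw [h1]
      rw [abs_neg, abs_of_nonneg this, abs_of_neg (by linarith)]
      linarith
  choose k hk using htr
  have hv : ∀ N : ℕ, IsCompletion (fun t => u t - max (u t) (-N)) fun t => h t - k N t :=
    fun N => hu.sub (hk N)
  have hv0 : ∀ N : ℕ, ∀ᵐ t ∂circ, u t - max (u t) (-(N : ℝ)) ≤ 0 := fun N =>
    Eventually.of_forall fun t => by linarith [le_max_left (u t) (-(N : ℝ))]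
  have hE : ∀ N, Hardy fun t => Complex.exp (h t - k N t) := fun N => (hv N).hardy_exp (hv0 N)
  have hE1 : ∀ N, ∀ᵐ t ∂circ, ‖Complex.exp (h t - k N t)‖ ≤ 1 := fun N => by
    simpa using (hv N).norm_exp_le (hv0 N)
  have hneg : ∀ N : ℕ, IsCompletion (fun t => (-1 : ℝ) * max (u t) (-N))
      fun t => ((-1 : ℝ) : ℂ) * k N t :=
    fun N => (hk N).const_mul (-1)
  have hneg' : ∀ N : ℕ, ∀ᵐ t ∂circ, (-1 : ℝ) * max (u t) (-(N : ℝ)) ≤ N := fun N =>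
    Eventually.of_forall fun t => by linarith [le_max_right (u t) (-(N : ℝ))]
  have hint : Tendsto (fun N : ℕ => ∫ t, (u t - max (u t) (-(N : ℝ))) ∂circ) atTop (𝓝 0) := by
    have : (0 : ℝ) = ∫ t : ℝ, (0 : ℝ) ∂circ := by simp
    rw [this]
    refine tendsto_integral_of_dominated_convergence (fun t => |u t|)
      (fun N => hur.sub (hur.sup aestronglyMeasurable_const)) ?_ (fun N => ?_) ?_
    · simpa using (integrable_of_memLp hui).norm
    · refine Eventually.of_forall fun t => ?_
      have : (0 : ℝ) ≤ N := N.cast_nonneg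
      rcases max_cases (u t) (-(N : ℝ)) with ⟨h1, h2⟩ | ⟨h1, h2⟩ <;> rw [h1]
      · simp
      · rw [Real.norm_eq_abs, abs_of_neg (by linarith), abs_of_neg (by linarith)]; linarith
    · refine Eventually.of_forall fun t => tendsto_const_nhds.congr' ?_
      obtain ⟨M, hM⟩ := exists_nat_ge (-u t)
      filter_upwards [eventually_ge_atTop M] with N hN
      have : (M : ℝ) ≤ N := by exact_mod_cast hN
      rw [max_eq_left (by linarith)]; ring
  -- For $|e|\le1$ one has $|e-1|^2\le2-2\operatorname{Re}e$, and by `fc_exp_zero` the mean of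
  -- $\operatorname{Re}e$ is the exponential of an integral tending to zero. Convergence in modulus
  -- thus forces convergence of the phase.
  have hL2 : Tendsto (fun N => ∫ t, ‖Complex.exp (h t - k N t) - 1‖ ^ 2 ∂circ) atTop (𝓝 0) := by
    have hub : ∀ N : ℕ, ∫ t, ‖Complex.exp (h t - k N t) - 1‖ ^ 2 ∂circ ≤
        2 - 2 * Real.exp (∫ t, (u t - max (u t) (-(N : ℝ))) ∂circ) := fun N => by
      have hi := integrable_of_memLp (hE N).1
      have hre : ∫ t, (Complex.exp (h t - k N t)).re ∂circ =
          Real.exp (∫ t, (u t - max (u t) (-(N : ℝ))) ∂circ) := by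
        have h1 := (hv N).fc_exp_zero (hv0 N)
        have h2 := congrArg Complex.re h1
        rw [Complex.ofReal_re] at h2
        rw [← h2, fc]
        have := integral_re hi
        simpa using! this
      rw [← hre]
      calc ∫ t, ‖Complex.exp (h t - k N t) - 1‖ ^ 2 ∂circ
          ≤ ∫ t, (2 - 2 * (Complex.exp (h t - k N t)).re) ∂circ := by
            refine integral_mono_ae (integrable_norm_sq ((hE N).1.sub (memLp_const 1)))
              ((integrable_const _).sub (hi.re.const_mul 2)) ?_
            filter_upwards [hE1 N] with t ht
            set e := Complex.exp (h t - k N t)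
            have h3 : ‖e‖ ^ 2 ≤ 1 := pow_le_one₀ (norm_nonneg _) ht
            change ‖e - 1‖ ^ 2 ≤ 2 - 2 * e.re
            rw [← Complex.normSq_eq_norm_sq, Complex.normSq_apply] at h3 ⊢
            simp only [Complex.sub_re, Complex.sub_im, Complex.one_re, Complex.one_im]
            nlinarith
        _ = 2 - 2 * ∫ t, (Complex.exp (h t - k N t)).re ∂circ := by
            have hi2 : Integrable (fun t => 2 * (Complex.exp (h t - k N t)).re) circ :=
              hi.re.const_mul 2
            rw [integral_sub (integrable_const _) hi2, integral_const_mul]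
            simp
    refine squeeze_zero (fun N => integral_nonneg fun t => by positivity) hub ?_
    have := ((Real.continuous_exp.tendsto 0).comp hint).const_mul 2 |>.const_sub 2
    simpa using this
  obtain ⟨s, hs, hae⟩ := exists_subseq_tendsto_ae (fun N => (hE N).1) (memLp_const (1 : ℂ)) hL2
  have hmul : ∀ N t, Complex.exp (((-1 : ℝ) : ℂ) * k N t) * Complex.exp (h t) =
      Complex.exp (h t - k N t) := fun N t => by
    rw [← Complex.exp_add]; congr 1; push_cast; ring
  refine ⟨fun n t => Complex.exp (((-1 : ℝ) : ℂ) * k (s n) t), fun n => (hneg _).hardy_exp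
    (hneg' _),
    fun n => ⟨_, (hneg _).norm_exp_le (hneg' _)⟩, fun n => ?_, ?_⟩
  · simp_rw [hmul]; exact hE1 _
  · simp_rw [hmul]; exact hae

/-- Polynomial multiples of an outer function are dense. -/
lemma IsCompletion.exists_polynomial {u : ℝ → ℝ} {h : ℝ → ℂ} (hu : IsCompletion u h) {C : ℝ}
    (hC : ∀ᵐ t ∂circ, u t ≤ C) {Q : ℝ → ℂ} (hQ : Hardy Q) {M : ℝ} (hM : ∀ᵐ t ∂circ, ‖Q t‖ ≤ M)
    {f : ℝ → ℝ} (hf : Integrable f circ) (hf0 : ∀ᵐ t ∂circ, 0 ≤ f t) {δ : ℝ} (hδ : 0 < δ) :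
    ∃ p : Polynomial ℂ,
      ∫ t, ‖Q t - p.eval (expo (-1) t) * Complex.exp (h t)‖ ^ 2 * f t ∂circ < δ := by
  obtain ⟨E, hE, hEB, hE1, hElim⟩ := hu.exists_truncation
  have hM0 : 0 ≤ M := by
    obtain ⟨t, ht⟩ := hM.exists
    exact (norm_nonneg _).trans ht
  have hQE : ∀ n, ∀ᵐ t ∂circ, ‖Q t * E n t * Complex.exp (h t)‖ ≤ M := fun n => by
    filter_upwards [hM, hE1 n] with t h1 h2
    rw [mul_assoc, norm_mul]
    exact (mul_le_mul h1 h2 (norm_nonneg _) hM0).trans (by simp)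
  -- For a merely integrable `f`, bounded almost everywhere convergence still gives convergence in
  -- $L_2(f)$. Hence all approximants below are kept uniformly bounded.
  have conv : ∀ (G : ℕ → ℝ → ℂ) (F : ℝ → ℂ) (B : ℝ), (∀ n, AEStronglyMeasurable (G n) circ) →
      AEStronglyMeasurable F circ → (∀ n, ∀ᵐ t ∂circ, ‖G n t - F t‖ ≤ B) →
      (∀ᵐ t ∂circ, Tendsto (fun n => G n t) atTop (𝓝 (F t))) →
      Tendsto (fun n => ∫ t, ‖G n t - F t‖ ^ 2 * f t ∂circ) atTop (𝓝 0) := by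
    intro G F B hG hF hB hlim
    have : (0 : ℝ) = ∫ t : ℝ, (0 : ℝ) ∂circ := by simp
    rw [this]
    refine tendsto_integral_of_dominated_convergence (fun t => B ^ 2 * f t)
      (fun n => (((hG n).sub hF).norm.pow 2).mul hf.1) (hf.const_mul _) (fun n => ?_) ?_
    · filter_upwards [hB n, hf0] with t h1 h2
      rw [Real.norm_of_nonneg (by positivity)]
      gcongr
    · filter_upwards [hlim] with t ht
      have h1 := ((ht.sub_const (F t)).norm.pow 2).mul_const (f t)
      simpa using h1
  have intg : ∀ (G F : ℝ → ℂ) (B : ℝ), AEStronglyMeasurable G circ → AEStronglyMeasurable F circ →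
      (∀ᵐ t ∂circ, ‖G t - F t‖ ≤ B) → Integrable (fun t => ‖G t - F t‖ ^ 2 * f t) circ := by
    intro G F B hG hF hB
    refine Integrable.mono' (hf.const_mul (B ^ 2)) (((hG.sub hF).norm.pow 2).mul hf.1) ?_
    filter_upwards [hB, hf0] with t h1 h2
    rw [Real.norm_of_nonneg (by positivity)]
    gcongr
  have hexp := hu.aesm_exp
  have hbd1 : ∀ n, ∀ᵐ t ∂circ, ‖Q t * E n t * Complex.exp (h t) - Q t‖ ≤ 2 * M := fun n => by
    filter_upwards [hM, hQE n] with t h1 h2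
    exact (norm_sub_le _ _).trans (by linarith)
  have h1 := conv (fun n t => Q t * E n t * Complex.exp (h t)) Q (2 * M)
    (fun n => (hQ.1.1.mul (hE n).1.1).mul hexp) hQ.1.1 hbd1 (by
      filter_upwards [hElim] with t ht
      have := ht.const_mul (Q t)
      simpa [mul_assoc] using this)
  -- Two approximations enter, each with budget `δ / 4`, because $|x+y|^2\le2|x|^2+2|y|^2$.
  obtain ⟨n, hn⟩ := (h1.eventually_lt_const (show (0 : ℝ) < δ / 4 by positivity)).exists
  obtain ⟨B, hB⟩ := hEB n
  have hQn : Hardy fun t => Q t * E n t := hQ.mul_of_bdd (hE n) hM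
  have hQnB : ∀ᵐ t ∂circ, ‖Q t * E n t‖ ≤ M * B := by
    filter_upwards [hM, hB] with t h1 h2
    rw [norm_mul]; exact mul_le_mul h1 h2 (norm_nonneg _) hM0
  -- `Q * E n` is a bounded Hardy function, so polynomials may replace it as the factor of `exp h`.
  obtain ⟨p, hp, hplim⟩ := hQn.exists_polynomial hQnB
  have hpm : ∀ n, AEStronglyMeasurable (fun t => (p n).eval (expo (-1) t)) circ := fun n =>
    ((p n).continuous.comp (continuous_expo (-1))).aestronglyMeasurable
  have hbd2 : ∀ m, ∀ᵐ t ∂circ, ‖(p m).eval (expo (-1) t) * Complex.exp (h t) -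
      Q t * E n t * Complex.exp (h t)‖ ≤ (M * B + 1) * Real.exp C + M := fun m => by
    filter_upwards [hu.norm_exp_le hC, hQE n] with t h2 h3
    refine (norm_sub_le _ _).trans (add_le_add ?_ h3)
    rw [norm_mul]
    exact mul_le_mul (hp m t) h2 (norm_nonneg _) ((norm_nonneg _).trans (hp m t))
  have h2 := conv (fun m t => (p m).eval (expo (-1) t) * Complex.exp (h t))
    (fun t => Q t * E n t * Complex.exp (h t)) _ (fun m => (hpm m).mul hexp)
    ((hQ.1.1.mul (hE n).1.1).mul hexp) hbd2 (by
      filter_upwards [hplim] with t ht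
      exact ht.mul_const _)
  obtain ⟨m, hm⟩ := (h2.eventually_lt_const (show (0 : ℝ) < δ / 4 by positivity)).exists
  refine ⟨p m, ?_⟩
  have i1 : Integrable (fun t => ‖Q t * E n t * Complex.exp (h t) - Q t‖ ^ 2 * f t) circ :=
    intg _ _ _ ((hQ.1.1.mul (hE n).1.1).mul hexp) hQ.1.1 (hbd1 n)
  have i2 : Integrable (fun t => ‖(p m).eval (expo (-1) t) * Complex.exp (h t) -
      Q t * E n t * Complex.exp (h t)‖ ^ 2 * f t) circ :=
    intg _ _ _ ((hpm m).mul hexp) ((hQ.1.1.mul (hE n).1.1).mul hexp) (hbd2 m)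
  calc ∫ t, ‖Q t - (p m).eval (expo (-1) t) * Complex.exp (h t)‖ ^ 2 * f t ∂circ
      ≤ ∫ t, (2 * (‖Q t * E n t * Complex.exp (h t) - Q t‖ ^ 2 * f t) +
        2 * (‖(p m).eval (expo (-1) t) * Complex.exp (h t) -
          Q t * E n t * Complex.exp (h t)‖ ^ 2 * f t)) ∂circ := by
        refine integral_mono_of_nonneg ?_ ((i1.const_mul 2).add (i2.const_mul 2)) ?_
        · filter_upwards [hf0] with t ht
          simp only [Pi.zero_apply]; positivity
        · filter_upwards [hf0] with t ht
          set a := Q t * E n t * Complex.exp (h t)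
          set b := (p m).eval (expo (-1) t) * Complex.exp (h t)
          have h3 : ‖Q t - b‖ ≤ ‖a - Q t‖ + ‖b - a‖ := by
            rw [← norm_neg (Q t - b), show -(Q t - b) = (a - Q t) + (b - a) by ring]
            exact norm_add_le _ _
          have h4 : ‖Q t - b‖ ^ 2 ≤ 2 * ‖a - Q t‖ ^ 2 + 2 * ‖b - a‖ ^ 2 := by
            have := pow_le_pow_left₀ (norm_nonneg _) h3 2
            nlinarith [sq_nonneg (‖a - Q t‖ - ‖b - a‖)]
          have := mul_le_mul_of_nonneg_right h4 ht
          linarith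
    _ < δ := by
        rw [integral_add (i1.const_mul 2) (i2.const_mul 2), integral_const_mul, integral_const_mul]
        linarith

end Extrapolation

end

noncomputable section

namespace Extrapolation

/-! ### The weight -/

lemma ae_circ_of_countable {s : Set ℝ} (hs : s.Countable) : ∀ᵐ t ∂circ, t ∉ s := by
  rw [ae_circ]
  exact ae_restrict_of_ae (hs.ae_notMem volume)

lemma ae_circ_mem : ∀ᵐ t ∂circ, |t| ≤ Real.pi := by
  rw [ae_circ]
  refine (ae_restrict_mem measurableSet_Ioc).mono fun t ht => ?_
  rw [abs_le]; exact ⟨ht.1.le, ht.2⟩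

lemma ae_circ_ne_zero : ∀ᵐ t ∂circ, t ≠ 0 :=
  (ae_circ_of_countable (Set.countable_singleton 0)).mono fun _ h => h

lemma ae_expo_ne_one {μ : ℕ} (hμ : 1 ≤ μ) : ∀ᵐ t ∂circ, expo (-(μ : ℤ)) t ≠ 1 := by
  have hc : (Set.range fun k : ℤ => (k : ℝ) * (2 * Real.pi) / μ).Countable := Set.countable_range _
  filter_upwards [ae_circ_of_countable hc] with t ht h
  rw [expo, Complex.exp_eq_one_iff] at h
  obtain ⟨k, hk⟩ := h
  refine ht ⟨-k, ?_⟩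
  have hμ0 : (μ : ℂ) ≠ 0 := by exact_mod_cast (by omega : μ ≠ 0)
  have h2 : (t : ℂ) = ((((-k : ℤ) : ℝ) * (2 * Real.pi) / μ : ℝ) : ℂ) := by
    push_cast
    rw [eq_div_iff hμ0]
    apply mul_left_cancel₀ Complex.I_ne_zero
    push_cast at hk
    linear_combination -hk
  exact_mod_cast h2.symm

lemma norm_one_sub_expo_le (μ : ℕ) (t : ℝ) : ‖1 - expo (-(μ : ℤ)) t‖ ≤ μ * |t| := by
  rw [norm_sub_rev, expo, show Complex.I * t * ((-(μ : ℤ) : ℤ) : ℂ) =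
    Complex.I * ((-(μ * t) : ℝ) : ℂ) by push_cast; ring, Complex.norm_exp_I_mul_ofReal_sub_one]
  rw [Real.norm_eq_abs, abs_mul, abs_two]
  have := Real.abs_sin_le_abs (x := -(μ * t) / 2)
  rw [abs_div, abs_neg, abs_mul, abs_two, Nat.abs_cast] at this
  linarith

/-- Jordan's inequality for the sine at `t / 2`, valid because `|t| ≤ π`. -/
lemma le_norm_one_sub_expo {t : ℝ} (ht : |t| ≤ Real.pi) :
    2 / Real.pi * |t| ≤ ‖1 - expo (-1) t‖ := by
  rw [norm_sub_rev, expo, show Complex.I * t * ((-1 : ℤ) : ℂ) =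
    Complex.I * ((-t : ℝ) : ℂ) by push_cast; ring, Complex.norm_exp_I_mul_ofReal_sub_one]
  rw [Real.norm_eq_abs, abs_mul, abs_two]
  have := Real.mul_abs_le_abs_sin (x := -t / 2) (by rw [abs_div, abs_neg, abs_two]; linarith)
  rw [abs_div, abs_neg, abs_two] at this
  linarith

/-- The logarithm of `1 - e^{-iμt}` is its own analytic completion. -/
lemma isCompletion_log_one_sub {μ : ℕ} (hμ : 1 ≤ μ) :
    IsCompletion (fun t => Real.log ‖1 - expo (-(μ : ℤ)) t‖)
      fun t => Complex.log (1 - expo (-(μ : ℤ)) t) := by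
  have hinj : Function.Injective fun j : ℕ => μ * j := fun a b h =>
    Nat.eq_of_mul_eq_mul_left hμ h
  -- The Taylor coefficients of $\log(1-z^\mu)$: $-1/j$ at $\mu j$. The constant term comes out
  -- right because `1 / 0 = 0`.
  set x : ℕ → ℂ := Function.extend (fun j : ℕ => μ * j) (fun j => -(1 / (j : ℂ))) 0 with hx
  have hxj : ∀ j, x (μ * j) = -(1 / (j : ℂ)) := fun j => hinj.extend_apply _ _ j
  have hx0 : ∀ k, k ∉ Set.range (fun j : ℕ => μ * j) → x k = 0 := fun k hk => by
    rw [hx, Function.extend_apply' _ _ _ (by simpa using hk)]; rfl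
  have hsum : Summable fun k => ‖x k‖ ^ 2 := by
    rw [← hinj.summable_iff (fun k hk => by rw [hx0 k hk]; simp)]
    have := Real.summable_one_div_nat_pow.2 (show 1 < 2 by norm_num)
    refine this.congr fun j => ?_
    simp [hxj]
  obtain ⟨F, hF⟩ := exists_isFourierSum (σ := -1) (by norm_num) hsum
  obtain ⟨hH, hfc⟩ := isFourierSum_neg_one_iff.1 hF
  have hdisc : ∀ z : ℂ, ‖z‖ < 1 → discExt F z = Complex.log (1 - z ^ μ) := fun z hz => by
    have h1 := hasSum_discExt hH.1 hz
    simp_rw [hfc] at h1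
    rw [← hinj.hasSum_iff (fun k hk => by rw [hx0 k hk, zero_mul])] at h1
    have hz' : ‖z ^ μ‖ < 1 := by
      rw [norm_pow]; exact pow_lt_one₀ (norm_nonneg _) hz (by omega)
    have h2 := (Complex.hasSum_taylorSeries_neg_log hz').neg
    rw [neg_neg] at h2
    refine h1.unique (h2.congr_fun fun j => ?_)
    simp only [Function.comp, hxj, pow_mul]; ring
  obtain ⟨r, hr, hr1, hlim⟩ := exists_seq_tendsto_one
  obtain ⟨s, hs, hae⟩ := hH.exists_radial hr hr1 hlim
  have hFeq : F =ᵐ[circ] fun t => Complex.log (1 - expo (-(μ : ℤ)) t) := by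
    filter_upwards [hae, ae_expo_ne_one hμ] with t ht hne
    refine tendsto_nhds_unique ht ?_
    -- A unimodular number has real part at most 1, with equality only at 1, so `1 - expo` avoids
    -- the branch cut.
    have hslit : 1 - expo (-(μ : ℤ)) t ∈ Complex.slitPlane := by
      rw [Complex.mem_slitPlane_iff]
      by_contra hcon
      push Not at hcon
      obtain ⟨h1, h2⟩ := hcon
      have hn := norm_expo (-(μ : ℤ)) t
      have hre := Complex.re_le_norm (expo (-(μ : ℤ)) t)
      rw [hn] at hre
      simp only [Complex.sub_re, Complex.one_re, Complex.sub_im, Complex.one_im] at h1 h2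
      apply hne
      apply Complex.ext
      · simp; linarith
      · simp; linarith
    have e : ∀ n, discExt F (r (s n) * expo (-1) t) =
        Complex.log (1 - (r (s n) : ℂ) ^ μ * expo (-(μ : ℤ)) t) := fun n => by
      rw [hdisc _ (by rw [norm_mul_expo _ (hr _)]; exact hr1 _), mul_pow, ← expo_mul_natCast]
      simp
    simp_rw [e]
    refine (continuousAt_clog hslit).tendsto.comp ?_
    have h1 : Tendsto (fun n => ((r (s n) : ℝ) : ℂ)) atTop (𝓝 1) := by
      exact_mod_cast (Complex.continuous_ofReal.tendsto 1).comp (hlim.comp hs.tendsto_atTop)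
    simpa using ((h1.pow μ).mul_const (expo (-(μ : ℤ)) t)).const_sub 1
  refine ⟨hH.congr hFeq, Eventually.of_forall fun t => Complex.log_re _, ?_⟩
  rw [← fc_congr hFeq]
  have := hfc 0
  have h0 := hxj 0
  simp only [mul_zero, CharP.cast_eq_zero, div_zero, neg_zero] at h0 this
  rw [this, h0]; simp

/-- On $[-\pi,\pi]$ the ratio of $|t|$ to $|1-e^{-it}|$ lies between 1 and $\pi/2$. So `log |t|`
differs by a bounded function from a logarithm already known to be square integrable. -/
lemma memLp_log_abs : MemLp (fun t => ((Real.log |t| : ℝ) : ℂ)) 2 circ := by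
  have hm : Measurable fun t : ℝ => ((Real.log |t| : ℝ) : ℂ) := by fun_prop
  have h1 := (isCompletion_log_one_sub (μ := 1) le_rfl).memLp
  refine MemLp.of_le (h1.norm.add (memLp_const (Real.log (Real.pi / 2)))) hm.aestronglyMeasurable ?_
  filter_upwards [ae_circ_ne_zero, ae_circ_mem] with t ht0 htpi
  have hpi := Real.pi_pos
  have ht : 0 < |t| := abs_pos.2 ht0
  have h2 : ‖1 - expo (-1) t‖ ≤ |t| := by simpa using norm_one_sub_expo_le 1 t
  have h3 := le_norm_one_sub_expo htpi
  have h4 : 0 < ‖1 - expo (-1) t‖ := lt_of_lt_of_le (by positivity) h3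
  have h5 := Real.log_le_log h4 h2
  have h6 := Real.log_le_log (by positivity) h3
  have h7 : Real.log (2 / Real.pi * |t|) = Real.log |t| - Real.log (Real.pi / 2) := by
    rw [Real.log_mul (by positivity) ht.ne', ← inv_div, Real.log_inv]; ring
  rw [h7] at h6
  have h8 : 0 ≤ Real.log (Real.pi / 2) :=
    Real.log_nonneg (by linarith [Real.pi_gt_three])
  simp only [Complex.norm_real, Real.norm_eq_abs, Pi.add_apply, Nat.cast_one]
  refine le_trans ?_ (le_abs_self _)
  rw [abs_le]
  constructor
  · linarith [neg_abs_le (Real.log ‖1 - expo (-1) t‖)]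
  · linarith [le_abs_self (Real.log ‖1 - expo (-1) t‖)]

lemma weight_eq (n μ : ℕ) (t : ℝ) :
    weight n μ t = ‖1 - expo (-(μ : ℤ)) t‖ ^ (2 * n) / t ^ (2 * n) := by
  rw [weight, expo]; congr 5; push_cast; ring

lemma weight_nonneg (n μ : ℕ) (t : ℝ) : 0 ≤ weight n μ t := by
  rw [weight, pow_mul t]; positivity

lemma weight_neg (n μ : ℕ) (t : ℝ) : weight n μ (-t) = weight n μ t := by
  rw [weight_eq, weight_eq, Even.neg_pow (by simp)]
  congr 2
  rw [← Complex.norm_conj, map_sub, conj_expo, map_one, expo, expo]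
  congr 3; push_cast; ring

lemma weight_le (n : ℕ) {μ : ℕ} (t : ℝ) : weight n μ t ≤ (μ : ℝ) ^ (2 * n) := by
  rw [weight_eq]
  -- At `t = 0` division by zero gives 0, unless `n = 0`, where both powers are 1.
  rcases eq_or_ne t 0 with rfl | ht
  · rcases Nat.eq_zero_or_pos n with rfl | hn
    · simp
    · rw [zero_pow (by omega), div_zero]; positivity
  · have h1 : 0 < t ^ (2 * n) := by rw [pow_mul]; positivity
    rw [div_le_iff₀ h1]
    have h2 := pow_le_pow_left₀ (norm_nonneg _) (norm_one_sub_expo_le μ t) (2 * n)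
    rwa [mul_pow, Even.pow_abs (by simp)] at h2

/-- The exponent of the outer factor of the weight. -/
def wExp (n μ : ℕ) (t : ℝ) : ℝ := n * (Real.log ‖1 - expo (-(μ : ℤ)) t‖ - Real.log |t|)

lemma wExp_eq (n : ℕ) {μ : ℕ} (hμ : 1 ≤ μ) :
    wExp n μ =ᵐ[circ] fun t => Real.log (weight n μ t) / 2 := by
  filter_upwards [ae_circ_ne_zero, ae_expo_ne_one hμ] with t ht h1
  have h2 : ‖1 - expo (-(μ : ℤ)) t‖ ≠ 0 := by
    rw [norm_ne_zero_iff, sub_ne_zero]; exact h1.symm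
  rw [weight_eq, Real.log_div (by positivity) (by positivity), Real.log_pow, Real.log_pow, wExp,
    Real.log_abs]
  push_cast; ring

lemma exp_wExp (n : ℕ) {μ : ℕ} (hμ : 1 ≤ μ) :
    ∀ᵐ t ∂circ, Real.exp (wExp n μ t) ^ 2 = weight n μ t := by
  filter_upwards [ae_circ_ne_zero, ae_expo_ne_one hμ, wExp_eq n hμ] with t ht h1 h2
  have h3 : ‖1 - expo (-(μ : ℤ)) t‖ ≠ 0 := by
    rw [norm_ne_zero_iff, sub_ne_zero]; exact h1.symm
  have h4 : 0 < weight n μ t := by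
    refine lt_of_le_of_ne (weight_nonneg n μ t) (Ne.symm ?_)
    rw [weight_eq]; positivity
  rw [h2, ← Real.exp_nat_mul]
  push_cast
  rw [mul_div_cancel₀ _ (by norm_num), Real.exp_log h4]

lemma wExp_le (n : ℕ) {μ : ℕ} (hμ : 1 ≤ μ) : ∀ᵐ t ∂circ, wExp n μ t ≤ n * Real.log μ := by
  filter_upwards [ae_circ_ne_zero, ae_expo_ne_one hμ] with t ht h1
  have h3 : 0 < ‖1 - expo (-(μ : ℤ)) t‖ := by
    rw [norm_pos_iff, sub_ne_zero]; exact h1.symm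
  have h4 := Real.log_le_log h3 (norm_one_sub_expo_le μ t)
  rw [Real.log_mul (by positivity) (by positivity)] at h4
  rw [wExp]
  gcongr
  linarith

/-- The analytic completion of `log |t|`. -/
def logCompletion : ℝ → ℂ := (exists_isCompletion memLp_log_abs).choose

lemma isCompletion_logCompletion : IsCompletion (fun t => Real.log |t|) logCompletion :=
  (exists_isCompletion memLp_log_abs).choose_spec

/-- The analytic completion of the exponent of the outer factor of the weight. -/
def wLog (n μ : ℕ) (t : ℝ) : ℂ :=
  ((n : ℝ) : ℂ) * (Complex.log (1 - expo (-(μ : ℤ)) t) - logCompletion t)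

lemma isCompletion_wLog (n : ℕ) {μ : ℕ} (hμ : 1 ≤ μ) : IsCompletion (wExp n μ) (wLog n μ) :=
  ((isCompletion_log_one_sub hμ).sub isCompletion_logCompletion).const_mul n

/-- The boundary values of `wFun` at `e^{-it}`. -/
def wBdry (n μ : ℕ) (t : ℝ) : ℂ := Complex.exp (wLog n μ t)

/-- The outer function of modulus `|t|⁻ⁿ`. -/
def kappa (n : ℕ) (t : ℝ) : ℂ := Complex.exp (-(n * logCompletion t))

lemma aesm_kappa (n : ℕ) : AEStronglyMeasurable (kappa n) circ :=
  Complex.continuous_exp.comp_aestronglyMeasurable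
    (isCompletion_logCompletion.hardy.1.1.const_mul _).neg

lemma norm_kappa (n : ℕ) : ∀ᵐ t ∂circ, ‖kappa n t‖ = (|t| ^ n)⁻¹ := by
  filter_upwards [ae_circ_ne_zero, isCompletion_logCompletion.re_eq] with t ht h
  have : (-((n : ℂ) * logCompletion t)).re = Real.log ((|t| ^ n)⁻¹) := by
    rw [Real.log_inv, Real.log_pow]; simp [h]
  rw [kappa, Complex.norm_exp, this, Real.exp_log (by positivity)]

/-- Separates the factor depending on the step from `kappa`, which does not. One spectral factor
therefore makes the increments of all positive steps analytic simultaneously. -/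
lemma wBdry_eq (n : ℕ) {μ : ℕ} (hμ : 1 ≤ μ) :
    wBdry n μ =ᵐ[circ] fun t => (1 - expo (-(μ : ℤ)) t) ^ n * kappa n t := by
  filter_upwards [ae_expo_ne_one hμ] with t h1
  rw [wBdry, wLog, mul_sub, Complex.exp_sub, kappa, Complex.exp_neg, Complex.ofReal_natCast,
    Complex.exp_nat_mul, Complex.exp_log (sub_ne_zero.2 h1.symm)]
  rfl

lemma norm_wBdry_sq (n : ℕ) {μ : ℕ} (hμ : 1 ≤ μ) :
    ∀ᵐ t ∂circ, ‖wBdry n μ t‖ ^ 2 = weight n μ t := by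
  filter_upwards [(isCompletion_wLog n hμ).norm_exp, exp_wExp n hμ] with t h1 h2
  rw [wBdry, h1, h2]

lemma norm_wBdry_le (n : ℕ) {μ : ℕ} (hμ : 1 ≤ μ) :
    ∀ᵐ t ∂circ, ‖wBdry n μ t‖ ≤ Real.exp (n * Real.log μ) :=
  (isCompletion_wLog n hμ).norm_exp_le (wExp_le n hμ)

/-- `wFun` uses the kernel in $e^{it}$ and `hergK` the one in $e^{-it}$; the weight is even, so
$t\mapsto-t$ exchanges them. The factor $1/4\pi$ is $1/2\pi$ times the half that turns $\ln|w|^2$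
into $\ln|w|$. -/
lemma wFun_eq (n : ℕ) {μ : ℕ} (hμ : 1 ≤ μ) {z : ℂ} (hz : ‖z‖ < 1) :
    wFun n μ z = Complex.exp (discExt (wLog n μ) z) := by
  rw [wFun, ← (isCompletion_wLog n hμ).herglotz hz]
  congr 1
  have h1 : ∫ t, hergK z t * (wExp n μ t : ℂ) ∂circ =
      ∫ t, hergK z t * ((Real.log (weight n μ t) / 2 : ℝ) : ℂ) ∂circ := by
    refine integral_congr_ae ?_
    filter_upwards [wExp_eq n hμ] with t ht
    rw [ht]
  rw [h1, integral_circ]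
  have h2 := intervalIntegral.integral_comp_neg (a := -Real.pi) (b := Real.pi) (fun t : ℝ =>
    (Complex.exp (Complex.I * t) + z) / (Complex.exp (Complex.I * t) - z) *
      (Real.log (weight n μ t) : ℂ))
  rw [neg_neg] at h2
  rw [← h2, Complex.real_smul, ← intervalIntegral.integral_const_mul,
    ← intervalIntegral.integral_const_mul]
  refine intervalIntegral.integral_congr fun t _ => ?_
  have hpi : (Real.pi : ℂ) ≠ 0 := by exact_mod_cast Real.pi_ne_zero
  have hne := one_sub_mul_expo_ne_zero hz t
  have he : Complex.exp (Complex.I * ((-t : ℝ) : ℂ)) = (expo 1 t)⁻¹ := by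
    rw [expo, ← Complex.exp_neg]; congr 1; push_cast; ring
  have he0 : expo 1 t ≠ 0 := Complex.exp_ne_zero _
  have hK : (Complex.exp (Complex.I * ((-t : ℝ) : ℂ)) + z) /
      (Complex.exp (Complex.I * ((-t : ℝ) : ℂ)) - z) = hergK z t := by
    have e1 : (expo 1 t)⁻¹ + z = (expo 1 t)⁻¹ * (1 + z * expo 1 t) := by field_simp
    have e2 : (expo 1 t)⁻¹ - z = (expo 1 t)⁻¹ * (1 - z * expo 1 t) := by field_simp
    rw [he, e1, e2, mul_div_mul_left _ _ (inv_ne_zero he0), hergK, ← div_eq_mul_inv,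
      div_eq_iff hne, sub_mul, div_mul_cancel₀ _ hne]
    ring
  simp only [hK, weight_neg]
  push_cast
  field_simp
  ring

lemma isFourierSum_wBdry (n : ℕ) {μ : ℕ} (hμ : 1 ≤ μ) :
    IsFourierSum (-1) (wCoeff n μ) (wBdry n μ) := by
  have h := (isCompletion_wLog n hμ).isFourierSum_exp (wExp_le n hμ)
  change IsFourierSum (-1) (wCoeff n μ) fun t => Complex.exp (wLog n μ t)
  convert h using 1
  ext k
  rw [wCoeff]
  congr 1
  -- Derivatives at the origin only depend on the function near it, and the two expressions agree on
  -- the open disc.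
  apply Filter.EventuallyEq.iteratedDeriv_eq
  filter_upwards [Metric.ball_mem_nhds (0 : ℂ) one_pos] with z hz
  exact wFun_eq n hμ (by simpa using hz)

lemma hardy_wBdry (n : ℕ) {μ : ℕ} (hμ : 1 ≤ μ) : Hardy (wBdry n μ) :=
  (isFourierSum_neg_one_iff.1 (isFourierSum_wBdry n hμ)).1

lemma fc_wBdry (n : ℕ) {μ : ℕ} (hμ : 1 ≤ μ) (k : ℕ) : fc (wBdry n μ) (-k) = wCoeff n μ k :=
  (isFourierSum_neg_one_iff.1 (isFourierSum_wBdry n hμ)).2 k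

end Extrapolation

end

noncomputable section

namespace Extrapolation

/-! ### The Hankel operator -/

lemma Admissible.tendsto {n μ : ℕ} {a : ℕ → ℂ} (ha : Admissible n μ a) (k : ℕ) :
    Tendsto (fun N => ∑ m ∈ Finset.range N, matD n μ k m * a m) atTop (𝓝 (bCoeff n μ a k)) := by
  obtain ⟨s, hs⟩ := ha.conv k
  rw [bCoeff, seriesSum, hs.limUnder_eq]
  exact hs

/-- Substituting $m=l+j$ turns the series into the one for $b(k+j)$, whose terms with $m<j$ vanish.
So $D^\mu A$ is a Hankel matrix. -/
lemma matDA_eq {n μ : ℕ} {a : ℕ → ℂ} (ha : Admissible n μ a) (k j : ℕ) :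
    matDA n μ a k j = bCoeff n μ a (k + j) := by
  rw [matDA, seriesSum]
  refine Tendsto.limUnder_eq ?_
  refine ((tendsto_add_atTop_iff_nat j).2 (ha.tendsto (k + j))).congr fun N => ?_
  rw [add_comm N j, Finset.sum_range_add, Finset.sum_eq_zero, zero_add]
  · refine Finset.sum_congr rfl fun l _ => ?_
    rw [add_comm l j]
    congr 1
    simp only [matD]
    split_ifs with h1 h2 h2
    · congr 1; omega
    · omega
    · omega
    · rfl
  · intro m hm
    rw [Finset.mem_range] at hm
    rw [matD, if_neg (by omega), zero_mul]

section Symbol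

variable {n μ : ℕ} {a : ℕ → ℂ}

lemma isFourierSum_bFun (ha : Admissible n μ a) :
    IsFourierSum 1 (bCoeff n μ a) (bFun n μ a) := by
  have := isFourierSum_of_summable (σ := 1) ha.summable
  simpa [bFun] using! this

lemma memLp_bFun (ha : Admissible n μ a) : MemLp (bFun n μ a) 2 circ :=
  (isFourierSum_one_iff.1 (isFourierSum_bFun ha)).1

lemma norm_bFun_le (ha : Admissible n μ a) (t : ℝ) :
    ‖bFun n μ a t‖ ≤ ∑' k, ‖bCoeff n μ a k‖ := by
  have h : ∀ k : ℕ, ‖bCoeff n μ a k * Complex.exp (Complex.I * t * k)‖ = ‖bCoeff n μ a k‖ :=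
    fun k => by
      have := norm_expo k t
      rw [expo, Int.cast_natCast] at this
      rw [norm_mul, this, mul_one]
  refine (norm_tsum_le_tsum_norm ?_).trans (by simp_rw [h]; exact le_rfl)
  simp_rw [h]; exact ha.summable

/-- The frequency $k$ of $bG$ collects $b(k+j)x(j)$ over $j\ge0$: the Hankel operator is
multiplication by $b$ followed by restriction to nonnegative frequencies. -/
lemma fc_bFun_mul (ha : Admissible n μ a) {x : ℕ → ℂ} {G : ℝ → ℂ} (hG : IsFourierSum (-1) x G)
    (k : ℕ) : fc (fun t => bFun n μ a t * G t) k = opDA n μ a x k := by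
  obtain ⟨hH, hx⟩ := isFourierSum_neg_one_iff.1 hG
  obtain ⟨hB, hb, -⟩ := isFourierSum_one_iff.1 (isFourierSum_bFun ha)
  have h := hasSum_fc_mul hB hH.1 k
  have hinj : Function.Injective fun j : ℕ => -(j : ℤ) := fun a b h => by simpa using h
  rw [← hinj.hasSum_iff] at h
  · rw [opDA, ← h.tsum_eq]
    congr 1 with j
    simp only [Function.comp]
    rw [hx, matDA_eq ha, ← hb, sub_neg_eq_add]
    push_cast; rfl
  · intro j hj
    rcases lt_or_ge 0 j with h | h
    · rw [hH.2 j h, mul_zero]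
    · exact absurd ⟨(-j).toNat, by simp; omega⟩ hj

lemma isFourierSum_opW (n : ℕ) {μ : ℕ} (hμ : 1 ≤ μ) {φ : ℕ → ℂ} {F : ℝ → ℂ}
    (hF : IsFourierSum (-1) φ F) :
    IsFourierSum (-1) (opW n μ φ) fun t => wBdry n μ t * F t := by
  obtain ⟨hH, hφ⟩ := isFourierSum_neg_one_iff.1 hF
  refine isFourierSum_neg_one_iff.2
    ⟨(hardy_wBdry n hμ).mul_of_bdd hH (norm_wBdry_le n hμ), fun k => ?_⟩
  rw [(hardy_wBdry n hμ).fc_mul hH, opW]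
  refine Finset.sum_congr rfl fun j _ => ?_
  rw [fc_wBdry n hμ, hφ]

lemma memLp_bFun_mul (ha : Admissible n μ a) {G : ℝ → ℂ} (hG : MemLp G 2 circ) :
    MemLp (fun t => bFun n μ a t * G t) 2 circ :=
  memLp_bdd_mul (memLp_bFun ha).1 (Eventually.of_forall (norm_bFun_le ha)) hG

lemma summable_fc_natCast {G : ℝ → ℂ} (hG : MemLp G 2 circ) :
    Summable fun k : ℕ => ‖fc G k‖ ^ 2 :=
  (hasSum_sq_fc hG).summable.comp_injective Nat.cast_injective

lemma tsum_fc_natCast_le {G : ℝ → ℂ} (hG : MemLp G 2 circ) :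
    ∑' k : ℕ, ‖fc G k‖ ^ 2 ≤ ∫ t, ‖G t‖ ^ 2 ∂circ := by
  rw [← (hasSum_sq_fc hG).tsum_eq]
  exact (summable_fc_natCast hG).tsum_le_tsum_of_inj _ Nat.cast_injective
    (fun _ _ => by positivity) (fun _ => le_rfl) (hasSum_sq_fc hG).summable

/-- By Parseval the norm exceeds the nonnegative part by the sum over negative frequencies, so
equality leaves no room for them. -/
lemma fc_eq_zero_of_integral_le {G : ℝ → ℂ} (hG : MemLp G 2 circ)
    (h : ∫ t, ‖G t‖ ^ 2 ∂circ ≤ ∑' k : ℕ, ‖fc G k‖ ^ 2) {j : ℤ} (hj : j < 0) : fc G j = 0 := by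
  by_contra hne
  have h1 := hasSum_sq_fc hG
  have h2 : Summable fun k : ℤ => if 0 ≤ k then ‖fc G k‖ ^ 2 else 0 :=
    Summable.of_nonneg_of_le (fun k => by positivity)
      (fun k => by split_ifs; exacts [le_rfl, by positivity]) h1.summable
  have h3 : ∑' k : ℤ, (if 0 ≤ k then ‖fc G k‖ ^ 2 else 0) = ∑' k : ℕ, ‖fc G k‖ ^ 2 := by
    rw [← (Nat.cast_injective (R := ℤ)).tsum_eq]
    · simp
    · intro k hk
      rw [Function.mem_support, ne_eq, ite_eq_right_iff, not_forall] at hk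
      obtain ⟨hk, -⟩ := hk
      exact ⟨k.toNat, by simp [hk]⟩
  have h4 : ∑' k : ℤ, (if 0 ≤ k then ‖fc G k‖ ^ 2 else 0) < ∑' k : ℤ, ‖fc G k‖ ^ 2 := by
    refine Summable.tsum_lt_tsum (i := j) (fun k => ?_) ?_ h2 h1.summable
    · split_ifs; exacts [le_rfl, by positivity]
    · rw [if_neg (by omega)]; positivity
  rw [h1.tsum_eq, h3] at h4
  linarith

/-! ### Spectral errors -/

lemma specError_eq (h : ℝ → ℂ) (f : ℝ → ℝ) :
    specError n μ a h f = ∫ t, ‖bFun n μ a t - h t‖ ^ 2 * weight n μ t * f t ∂circ := by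
  rw [specError, integral_circ, one_div, smul_eq_mul]

lemma classD0_iff {P₀ : ℝ} {f : ℝ → ℝ} : f ∈ classD0 P₀ ↔
    Integrable f circ ∧ (∀ᵐ t ∂circ, 0 ≤ f t) ∧ ∫ t, f t ∂circ ≤ P₀ := by
  rw [classD0, Set.mem_ofPred_eq, integral_circ, integrable_circ, ae_circ, one_div, smul_eq_mul]

lemma specError_nonneg (h : ℝ → ℂ) {f : ℝ → ℝ} (hf : ∀ᵐ t ∂circ, 0 ≤ f t) :
    0 ≤ specError n μ a h f := by
  rw [specError_eq]
  refine integral_nonneg_of_ae ?_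
  filter_upwards [hf] with t ht
  have := weight_nonneg n μ t
  simp only [Pi.zero_apply]
  positivity

lemma optimalError_le_specError {f : ℝ → ℝ} (hf : ∀ᵐ t ∂circ, 0 ≤ f t) (c : ℕ →₀ ℂ) :
    optimalError n μ a f ≤ specError n μ a (pastChar c) f :=
  ciInf_le ⟨0, by rintro _ ⟨c, rfl⟩; exact specError_nonneg _ hf⟩ c

/-- The polynomial with given coefficients. -/
def toPoly (c : ℕ →₀ ℂ) : Polynomial ℂ := c.sum fun j z => Polynomial.C z * Polynomial.X ^ j

/-- The extra factor $e^{-it}$ records that only strictly past increments are used. -/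
lemma pastChar_eq (c : ℕ →₀ ℂ) (t : ℝ) :
    pastChar c t = expo (-1) t * (toPoly c).eval (expo (-1) t) := by
  rw [pastChar, toPoly, Finsupp.sum, Finsupp.sum, Polynomial.eval_finsetSum, Finset.mul_sum]
  refine Finset.sum_congr rfl fun j _ => ?_
  simp only [Polynomial.eval_mul, Polynomial.eval_C, Polynomial.eval_pow, Polynomial.eval_X]
  rw [mul_left_comm, ← pow_succ', ← expo_mul_natCast, expo]
  congr 2; push_cast; ring

lemma exists_toPoly_eq (p : Polynomial ℂ) : ∃ c, toPoly c = p := by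
  refine ⟨Finsupp.onFinset p.support p.coeff fun j hj => by simpa using hj, ?_⟩
  rw [toPoly, Finsupp.onFinset_sum _ (fun j => by simp)]
  exact p.as_sum_support_C_mul_X_pow.symm

lemma norm_eval_expo_le (p : Polynomial ℂ) : ∃ C, ∀ t, ‖p.eval (expo (-1) t)‖ ≤ C := by
  refine ⟨p.sum fun _ c => ‖c‖, fun t => ?_⟩
  rw [Polynomial.eval_eq_sum, Polynomial.sum, Polynomial.sum]
  refine norm_sum_le_of_le _ fun j _ => ?_
  simp

lemma continuous_eval_expo (p : Polynomial ℂ) : Continuous fun t => p.eval (expo (-1) t) :=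
  p.continuous.comp (continuous_expo (-1))

lemma hardy_eval_expo (p : Polynomial ℂ) : Hardy fun t => p.eval (expo (-1) t) := by
  obtain ⟨C, hC⟩ := norm_eval_expo_le p
  refine ⟨memLp_of_bdd (continuous_eval_expo p).aestronglyMeasurable (Eventually.of_forall hC),
    fun j hj => ?_⟩
  have h : (fun t => p.eval (expo (-1) t)) =
      fun t => ∑ k ∈ p.support, p.coeff k * expo (-1 * k) t := by
    ext t
    rw [Polynomial.eval_eq_sum, Polynomial.sum]
    simp_rw [expo_mul_natCast]
  rw [h, fc_sum _ fun k _ => (memLp_expo _).const_mul _]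
  refine Finset.sum_eq_zero fun k _ => ?_
  rw [fc_const_mul, fc_expo, if_neg (by omega), mul_zero]

/-- The optimal error dominates the squared norm of the projection. -/
lemma sqNorm_le_optimalError (ha : Admissible n μ a) (hμ : 1 ≤ μ) {φ : ℕ → ℂ} {f : ℝ → ℝ}
    (hf : IsDensityOf φ f) : sqNorm (opDAW n μ a φ) ≤ optimalError n μ a f := by
  obtain ⟨F, hF, hfF⟩ := hf
  rw [← ae_circ] at hfF
  have hW := isFourierSum_opW n hμ hF
  have hWH := (isFourierSum_neg_one_iff.1 hW).1
  refine le_ciInf fun c => ?_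
  obtain ⟨C, hC⟩ := norm_eval_expo_le (toPoly c)
  have hP : Hardy fun t => (toPoly c).eval (expo (-1) t) * (wBdry n μ t * F t) :=
    (hardy_eval_expo _).mul_of_bdd hWH (Eventually.of_forall hC)
  have hG1 := memLp_bFun_mul ha hWH.1
  have hG2 := memLp_expo_mul (-1) hP.1
  -- The contribution of the estimate has frequencies at most $-1$, so no choice of `c` changes the
  -- coefficients at `k ≥ 0`.
  have hfc : ∀ k : ℕ, fc (fun t => bFun n μ a t * (wBdry n μ t * F t) -
      expo (-1) t * ((toPoly c).eval (expo (-1) t) * (wBdry n μ t * F t))) k =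
      opDAW n μ a φ k := fun k => by
    rw [fc_sub hG1 hG2, fc_bFun_mul ha hW, fc_expo_mul, hP.2 _ (by omega), sub_zero, opDAW]
  rw [sqNorm]
  simp_rw [← hfc]
  refine (tsum_fc_natCast_le (hG1.sub hG2)).trans (le_of_eq ?_)
  rw [specError_eq]
  refine integral_congr_ae ?_
  filter_upwards [norm_wBdry_sq n hμ, hfF] with t h1 h2
  rw [h2, ← h1, pastChar_eq, ← mul_pow, ← mul_pow, ← norm_mul, ← norm_mul, Pi.sub_apply]
  congr 2; ring

/-! ### Optimality certificates -/

/-- A function of constant modulus that differs from the symbol of the Hankel operator by a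
function with negative frequencies only. -/
structure IsCertificate (n μ : ℕ) (a : ℕ → ℂ) (ν : ℝ) (U : ℝ → ℂ) : Prop where
  aesm : AEStronglyMeasurable U circ
  norm_sq : ∀ᵐ t ∂circ, ‖U t‖ ^ 2 = ν
  hardy : Hardy fun t => expo 1 t * (bFun n μ a t * wBdry n μ t - U t)

lemma IsCertificate.norm_le {ν : ℝ} {U : ℝ → ℂ} (hU : IsCertificate n μ a ν U) :
    ∀ᵐ t ∂circ, ‖U t‖ ≤ Real.sqrt ν := by
  filter_upwards [hU.norm_sq] with t ht
  rw [← ht, Real.sqrt_sq (norm_nonneg _)]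

lemma IsCertificate.nonneg {ν : ℝ} {U : ℝ → ℂ} (hU : IsCertificate n μ a ν U) : 0 ≤ ν := by
  obtain ⟨t, ht⟩ := hU.norm_sq.exists
  rw [← ht]; positivity

lemma IsCertificate.bdd (ha : Admissible n μ a) (hμ : 1 ≤ μ) {ν : ℝ} {U : ℝ → ℂ}
    (hU : IsCertificate n μ a ν U) :
    ∃ C, ∀ᵐ t ∂circ, ‖expo 1 t * (bFun n μ a t * wBdry n μ t - U t)‖ ≤ C := by
  refine ⟨(∑' k, ‖bCoeff n μ a k‖) * Real.exp (n * Real.log μ) + Real.sqrt ν, ?_⟩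
  filter_upwards [hU.norm_le, norm_wBdry_le n hμ] with t h1 h2
  rw [norm_mul, norm_expo, one_mul]
  refine (norm_sub_le _ _).trans (add_le_add ?_ h1)
  rw [norm_mul]
  exact mul_le_mul (norm_bFun_le ha t) h2 (norm_nonneg _) (tsum_nonneg fun _ => norm_nonneg _)

/-- The difference of the symbols has negative frequencies only, and multiplication by the Hardy
function `F` keeps it so. Hence the certificate is another symbol of the same Hankel operator. -/
lemma IsCertificate.fc_eq (ha : Admissible n μ a) (hμ : 1 ≤ μ) {ν : ℝ} {U : ℝ → ℂ}
    (hU : IsCertificate n μ a ν U) {φ : ℕ → ℂ} {F : ℝ → ℂ} (hF : IsFourierSum (-1) φ F) (k : ℕ) :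
    fc (fun t => U t * F t) k = opDAW n μ a φ k := by
  obtain ⟨hH, -⟩ := isFourierSum_neg_one_iff.1 hF
  have hW := isFourierSum_opW n hμ hF
  have hWH := (isFourierSum_neg_one_iff.1 hW).1
  obtain ⟨C, hC⟩ := hU.bdd ha hμ
  have h1 := hU.hardy.mul_of_bdd hH hC
  have h2 : fc (fun t => bFun n μ a t * (wBdry n μ t * F t) - U t * F t) k = 0 := by
    rw [← h1.2 (k + 1) (by omega)]
    have := fc_expo_mul 1 (k + 1) (fun t => bFun n μ a t * (wBdry n μ t * F t) - U t * F t)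
    rw [add_sub_cancel_right] at this
    rw [← this]
    congr 1 with t
    ring
  rw [fc_sub (memLp_bFun_mul ha hWH.1) (memLp_bdd_mul hU.aesm hU.norm_le hH.1),
    fc_bFun_mul ha hW] at h2
  rw [opDAW]
  exact (sub_eq_zero.1 h2).symm

lemma IsCertificate.integral_eq {ν : ℝ} {U : ℝ → ℂ} (hU : IsCertificate n μ a ν U) {φ : ℕ → ℂ}
    {F : ℝ → ℂ} (hF : IsFourierSum (-1) φ F) :
    ∫ t, ‖U t * F t‖ ^ 2 ∂circ = ν * sqNorm φ := by
  rw [sqNorm, (hF.hasSum_sq (by norm_num)).tsum_eq, ← integral_const_mul]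
  refine integral_congr_ae ?_
  filter_upwards [hU.norm_sq] with t ht
  rw [norm_mul, mul_pow, ht]

lemma IsCertificate.memLp {ν : ℝ} {U : ℝ → ℂ} (hU : IsCertificate n μ a ν U) {φ : ℕ → ℂ}
    {F : ℝ → ℂ} (hF : IsFourierSum (-1) φ F) : MemLp (fun t => U t * F t) 2 circ :=
  memLp_bdd_mul hU.aesm hU.norm_le (isFourierSum_neg_one_iff.1 hF).1.1

/-- The easy half of Nehari's theorem: the Hankel operator keeps only some of the coefficients of
$UF$, whose squared norm is exactly $\nu\|\varphi\|^2$. -/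
lemma IsCertificate.sqNorm_le (ha : Admissible n μ a) (hμ : 1 ≤ μ) {ν : ℝ} {U : ℝ → ℂ}
    (hU : IsCertificate n μ a ν U) {φ : ℕ → ℂ} {F : ℝ → ℂ} (hF : IsFourierSum (-1) φ F) :
    sqNorm (opDAW n μ a φ) ≤ ν * sqNorm φ := by
  rw [← hU.integral_eq hF, sqNorm]
  simp_rw [← hU.fc_eq ha hμ hF]
  exact tsum_fc_natCast_le (hU.memLp hF)

/-- In the case of equality the product with the certificate has no negative frequencies. -/
lemma IsCertificate.isFourierSum (ha : Admissible n μ a) (hμ : 1 ≤ μ) {ν : ℝ} {U : ℝ → ℂ}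
    (hU : IsCertificate n μ a ν U) {φ : ℕ → ℂ} {F : ℝ → ℂ} (hF : IsFourierSum (-1) φ F)
    (h : ν * sqNorm φ ≤ sqNorm (opDAW n μ a φ)) :
    IsFourierSum 1 (opDA n μ a (opW n μ φ)) fun t => U t * F t := by
  refine isFourierSum_one_iff.2 ⟨hU.memLp hF, hU.fc_eq ha hμ hF, fun j hj => ?_⟩
  refine fc_eq_zero_of_integral_le (hU.memLp hF) ?_ hj
  rw [hU.integral_eq hF]
  simp_rw [hU.fc_eq ha hμ hF]
  exact h

/-- The weighted inequality keeps the coefficient of the main term close to 1, so that the sharp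
constant survives in the limit. -/
lemma norm_add_sq_le_mul {x y : ℂ} {η : ℝ} (hη : 0 < η) :
    ‖x + y‖ ^ 2 ≤ (1 + η) * ‖x‖ ^ 2 + (1 + η⁻¹) * ‖y‖ ^ 2 := by
  have h1 := pow_le_pow_left₀ (norm_nonneg _) (norm_add_le x y) 2
  have h2 : 0 ≤ η⁻¹ * (η * ‖x‖ - ‖y‖) ^ 2 := by positivity
  have h3 : η⁻¹ * (η * ‖x‖ - ‖y‖) ^ 2 = η * ‖x‖ ^ 2 - 2 * ‖x‖ * ‖y‖ + η⁻¹ * ‖y‖ ^ 2 := by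
    field_simp
    ring
  nlinarith

/-- With $h=e^{-it}p$ and $pw$ close to $e^{it}(bw-U)$ in $L_2(f)$, the function $bw-hw$ is close to
$U$. The error is then nearly $\nu\int f$, whatever `f` is. -/
lemma IsCertificate.optimalError_le (ha : Admissible n μ a) (hμ : 1 ≤ μ) {ν : ℝ} {U : ℝ → ℂ}
    (hU : IsCertificate n μ a ν U) {P₀ : ℝ} {f : ℝ → ℝ} (hf : f ∈ classD0 P₀) :
    optimalError n μ a f ≤ ν * P₀ := by
  obtain ⟨hfi, hf0, hfP⟩ := classD0_iff.1 hf
  obtain ⟨C, hC⟩ := hU.bdd ha hμ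
  have hν := hU.nonneg
  refine le_of_forall_pos_le_add fun ε hε => ?_
  have hP : 0 ≤ ∫ t, f t ∂circ := integral_nonneg_of_ae hf0
  have hP₀ : 0 ≤ P₀ := hP.trans hfP
  -- Chosen so that `η * (ν * P₀)` and `(1 + η⁻¹) * δ` are each at most `ε / 2`; the summand 1
  -- guards against a zero denominator.
  set η := ε / (2 * (ν * P₀ + 1)) with hη
  have hη0 : 0 < η := by positivity
  set δ := ε / (2 * (1 + η⁻¹)) with hδ
  have hδ0 : 0 < δ := by positivity
  obtain ⟨p, hp⟩ := (isCompletion_wLog n hμ).exists_polynomial (wExp_le n hμ)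
    hU.hardy hC hfi hf0 hδ0
  obtain ⟨c, rfl⟩ := exists_toPoly_eq p
  refine (optimalError_le_specError hf0 c).trans ?_
  obtain ⟨B, hB⟩ := norm_eval_expo_le (toPoly c)
  set V : ℝ → ℂ := fun t => expo 1 t * (bFun n μ a t * wBdry n μ t - U t) -
    (toPoly c).eval (expo (-1) t) * Complex.exp (wLog n μ t) with hV
  have hVm : AEStronglyMeasurable V circ := hU.hardy.1.1.sub
    ((continuous_eval_expo _).aestronglyMeasurable.mul (isCompletion_wLog n hμ).aesm_exp)
  have hVi : Integrable (fun t => ‖V t‖ ^ 2 * f t) circ := by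
    refine Integrable.mono' (hfi.const_mul ((C + B * Real.exp (n * Real.log μ)) ^ 2))
      ((hVm.norm.pow 2).mul hfi.1) ?_
    filter_upwards [hC, norm_wBdry_le n hμ, hf0] with t h1 h2 h3
    rw [Real.norm_of_nonneg (by positivity)]
    refine mul_le_mul_of_nonneg_right (pow_le_pow_left₀ (norm_nonneg _) ?_ 2) h3
    refine (norm_sub_le _ _).trans (add_le_add h1 ?_)
    rw [norm_mul]
    exact mul_le_mul (hB t) h2 (norm_nonneg _) ((norm_nonneg _).trans (hB t))
  rw [specError_eq]
  calc ∫ t, ‖bFun n μ a t - pastChar c t‖ ^ 2 * weight n μ t * f t ∂circ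
      ≤ ∫ t, ((1 + η) * ν * f t + (1 + η⁻¹) * (‖V t‖ ^ 2 * f t)) ∂circ := by
        refine integral_mono_of_nonneg ?_ ((hfi.const_mul _).add (hVi.const_mul _)) ?_
        · filter_upwards [hf0] with t ht
          have := weight_nonneg n μ t
          simp only [Pi.zero_apply]; positivity
        · filter_upwards [hf0, hU.norm_sq, norm_wBdry_sq n hμ] with t h1 h2 h3
          have e : expo 1 t * ((bFun n μ a t - pastChar c t) * wBdry n μ t) =
              expo 1 t * U t + V t := by
            have e1 : expo 1 t * expo (-1) t = 1 := by rw [← expo_add]; simp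
            rw [hV, pastChar_eq]
            change _ = expo 1 t * U t + (expo 1 t * (bFun n μ a t * wBdry n μ t - U t) -
              (toPoly c).eval (expo (-1) t) * wBdry n μ t)
            linear_combination (-(toPoly c).eval (expo (-1) t) * wBdry n μ t) * e1
          have h4 := norm_add_sq_le_mul (x := expo 1 t * U t) (y := V t) hη0
          rw [← e] at h4
          simp only [norm_mul, norm_expo, one_mul] at h4
          rw [h2, mul_pow, h3] at h4
          have := mul_le_mul_of_nonneg_right h4 h1
          linarith
    _ = (1 + η) * ν * ∫ t, f t ∂circ + (1 + η⁻¹) * ∫ t, ‖V t‖ ^ 2 * f t ∂circ := by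
        rw [integral_add (hfi.const_mul _) (hVi.const_mul _), integral_const_mul,
          integral_const_mul]
    _ ≤ (1 + η) * ν * P₀ + (1 + η⁻¹) * δ := by gcongr
    _ ≤ ν * P₀ + ε := by
        have h1 : (1 + η⁻¹) * δ = ε / 2 := by rw [hδ]; field_simp
        have h2 : η * (ν * P₀) ≤ ε / 2 := by
          rw [hη, div_mul_eq_mul_div, div_le_div_iff₀ (by positivity) (by norm_num)]
          nlinarith [mul_nonneg hν hP₀]
        rw [h1]; nlinarith

end Symbol

/-! ### Canonical factorizations -/

lemma IsCanonical.summable {φ : ℕ → ℂ} (hφ : IsCanonical φ) : Summable fun k => ‖φ k‖ := by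
  obtain ⟨⟨r, hr, hs⟩, -⟩ := hφ
  refine Summable.of_nonneg_of_le (fun _ => norm_nonneg _) (fun k => ?_) hs
  exact le_mul_of_one_le_right (norm_nonneg _) (one_le_pow₀ hr.le)

lemma isFourierSum_expo_pow {y : ℕ → ℂ} (hy : Summable fun k => ‖y k‖) :
    IsFourierSum (-1) y fun t => ∑' k, y k * expo (-1) t ^ k := by
  have := isFourierSum_dilate (x := y) (r := 1) zero_le_one (by simpa using hy)
  simpa using this

lemma IsFourierSum.ae_eq {σ : ℤ} (hσ : σ ≠ 0) {x : ℕ → ℂ} {F G : ℝ → ℂ} (hF : IsFourierSum σ x F)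
    (hG : IsFourierSum σ x G) : F =ᵐ[circ] G := by
  obtain ⟨h1, h2, h3⟩ := (isFourierSum_iff hσ).1 hF
  obtain ⟨h4, h5, h6⟩ := (isFourierSum_iff hσ).1 hG
  refine ae_eq_of_fc_eq h1 h4 fun j => ?_
  by_cases h : ∃ k : ℕ, j = σ * k
  · obtain ⟨k, rfl⟩ := h
    rw [h2, h5]
  · push Not at h
    rw [h3 j h, h6 j h]

/-- The reciprocal of the generating function of a canonical sequence. -/
lemma IsCanonical.exists_inv {φ : ℕ → ℂ} (hφ : IsCanonical φ) :
    ∃ y : ℕ → ℂ, (Summable fun k => ‖y k‖) ∧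
      ∀ z : ℂ, ‖z‖ ≤ 1 → ∑' k, y k * z ^ k = (∑' k, φ k * z ^ k)⁻¹ := by
  obtain ⟨⟨r, hr, hs⟩, hne⟩ := hφ
  set Φ : ℂ → ℂ := fun z => ∑' k, φ k * z ^ k with hΦ
  have hd : DifferentiableOn ℂ Φ (Metric.ball 0 r) :=
    Complex.differentiableOn_tsum_of_summable_norm hs (fun k => by fun_prop) Metric.isOpen_ball
      fun k w hw => by
        rw [mem_ball_zero_iff] at hw
        rw [norm_mul, norm_pow]
        gcongr
  have hopen : IsOpen (Metric.ball 0 r ∩ Φ ⁻¹' {0}ᶜ) :=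
    hd.continuousOn.isOpen_inter_preimage Metric.isOpen_ball isOpen_compl_singleton
  -- By compactness of the closed disc, `Φ` has no zeros in a slightly larger one, so its reciprocal
  -- has a Taylor series converging absolutely on the circle.
  obtain ⟨δ, hδ, hsub⟩ := (isCompact_closedBall (0 : ℂ) 1).exists_thickening_subset_open hopen
    (fun z hz => by
      rw [mem_closedBall_zero_iff] at hz
      exact ⟨by rw [mem_ball_zero_iff]; linarith, hne z hz⟩)
  rw [thickening_closedBall hδ zero_le_one] at hsub
  have hd2 : DifferentiableOn ℂ (fun z => (Φ z)⁻¹) (Metric.ball 0 (δ + 1)) :=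
    (hd.mono fun z hz => (hsub hz).1).inv fun z hz => (hsub hz).2
  have hsum : ∀ z : ℂ, ‖z‖ < δ + 1 → HasSum (fun k => iteratedDeriv k (fun z => (Φ z)⁻¹) 0 /
      (k.factorial : ℂ) * z ^ k) (Φ z)⁻¹ := fun z hz => by
    have := Complex.hasSum_taylorSeries_on_ball hd2 (z := z) (by simpa using hz)
    refine this.congr_fun fun k => ?_
    simp only [sub_zero, smul_eq_mul]; ring
  refine ⟨fun k => iteratedDeriv k (fun z => (Φ z)⁻¹) 0 / (k.factorial : ℂ), ?_, fun z hz =>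
    (hsum z (by linarith)).tsum_eq⟩
  have := summable_norm_mul_pow (fun z hz => (hsum z hz).summable) zero_le_one
    (show (1 : ℝ) < δ + 1 by linarith)
  simpa using this

lemma IsCanonical.exists_hardy_inv {φ : ℕ → ℂ} (hφ : IsCanonical φ) {F : ℝ → ℂ}
    (hF : IsFourierSum (-1) φ F) :
    ∃ Y : ℝ → ℂ, Hardy Y ∧ (∃ C, ∀ t, ‖Y t‖ ≤ C) ∧ ∀ᵐ t ∂circ, F t * Y t = 1 := by
  obtain ⟨y, hy, hinv⟩ := hφ.exists_inv
  refine ⟨fun t => ∑' k, y k * expo (-1) t ^ k,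
    (isFourierSum_neg_one_iff.1 (isFourierSum_expo_pow hy)).1, ⟨∑' k, ‖y k‖, fun t => ?_⟩, ?_⟩
  · exact (norm_tsum_le_tsum_norm (by simpa using hy)).trans (by simp)
  · filter_upwards [hF.ae_eq (by norm_num) (isFourierSum_expo_pow hφ.summable)] with t ht
    rw [ht, hinv _ (by simp), mul_inv_cancel₀ (hφ.2 _ (by simp))]

/-- The certificate is $U=R/F$, where $R$ is the nonnegative-frequency part of $bwF$. Condition (F)
gives it modulus $1/|c|$, and $bw-U=(bwF-R)/F$ keeps negative frequencies only because $1/F$ is a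
bounded Hardy function. -/
lemma IsCanonical.exists_certificate {n μ : ℕ} {a : ℕ → ℂ} (ha : Admissible n μ a) (hμ : 1 ≤ μ)
    {φ : ℕ → ℂ} (hφ : IsCanonical φ) {f : ℝ → ℝ} {c : ℂ} (hf : IsDensityOf φ f)
    (hc : IsExtremalForm n μ a φ c f) :
    ∃ ν U, 0 < ν ∧ IsCertificate n μ a ν U ∧ sqNorm (opDAW n μ a φ) = ν * sqNorm φ := by
  obtain ⟨F, hF, hfF⟩ := hf
  obtain ⟨R, hR, hfR⟩ := hc
  obtain ⟨Y, hY, ⟨C, hC⟩, hFY⟩ := hφ.exists_hardy_inv hF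
  obtain ⟨hRm, hRk, hRneg⟩ := isFourierSum_one_iff.1 hR
  have hW := isFourierSum_opW n hμ hF
  have hWH := (isFourierSum_neg_one_iff.1 hW).1
  have hFR : ∀ᵐ t ∂circ, ‖F t‖ ^ 2 = ‖c * R t‖ ^ 2 := by
    rw [ae_circ]
    filter_upwards [hfF, hfR] with t h1 h2
    rw [← h1, h2]
  -- `c = 0` would make `F` vanish, contradicting its invertibility.
  have hc0 : c ≠ 0 := by
    rintro rfl
    obtain ⟨t, h1, h2⟩ := (hFR.and hFY).exists
    have h3 : F t = 0 := by simpa using h1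
    rw [h3, zero_mul] at h2
    exact zero_ne_one h2
  have hcert : IsCertificate n μ a ((‖c‖ ^ 2)⁻¹) fun t => R t * Y t := by
    refine ⟨hRm.1.mul hY.1.1, ?_, ?_⟩
    · filter_upwards [hFR, hFY] with t h1 h2
      have h3 : ‖F t‖ ^ 2 * ‖Y t‖ ^ 2 = 1 := by
        rw [← mul_pow, ← norm_mul, h2]; simp
      rw [h1, norm_mul, mul_pow] at h3
      rw [norm_mul, mul_pow]
      refine eq_inv_of_mul_eq_one_left ?_
      linarith
    -- $R$ cancels every coefficient of $bwF$ at `k ≥ 0`. The shift by $e^{it}$ encodes that the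
    -- rest is strictly negative.
    · have hD : Hardy fun t => expo 1 t * (bFun n μ a t * (wBdry n μ t * F t) - R t) := by
        refine ⟨memLp_expo_mul 1 ((memLp_bFun_mul ha hWH.1).sub hRm), fun j hj => ?_⟩
        obtain ⟨k, rfl⟩ : ∃ k : ℕ, j = k + 1 := ⟨(j - 1).toNat, by omega⟩
        have := fc_expo_mul 1 (k + 1) fun t => bFun n μ a t * (wBdry n μ t * F t) - R t
        rw [this, add_sub_cancel_right, fc_sub (memLp_bFun_mul ha hWH.1) hRm, fc_bFun_mul ha hW,
          hRk, sub_self]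
      refine (hY.mul_of_bdd hD (Eventually.of_forall hC)).congr ?_
      filter_upwards [hFY] with t ht
      linear_combination (expo 1 t * bFun n μ a t * wBdry n μ t) * ht
  -- Here $UF=R$, so `φ` attains the bound given by its own certificate.
  refine ⟨(‖c‖ ^ 2)⁻¹, _, by positivity, hcert, le_antisymm (hcert.sqNorm_le ha hμ hF) ?_⟩
  rw [← hcert.integral_eq hF, sqNorm]
  have h1 : ∫ t, ‖R t * Y t * F t‖ ^ 2 ∂circ = ∫ t, ‖R t‖ ^ 2 ∂circ := by
    refine integral_congr_ae ?_
    filter_upwards [hFY] with t ht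
    rw [mul_assoc, mul_comm (Y t), ht, mul_one]
  rw [h1, ← (hR.hasSum_sq (by norm_num)).tsum_eq]
  rfl

/-! ### Least favorable densities -/

section LeastFavorable

variable {n μ : ℕ} {a : ℕ → ℂ} {P₀ : ℝ}

lemma IsDensityOf.ae_eq {φ : ℕ → ℂ} {f : ℝ → ℝ} (hf : IsDensityOf φ f) :
    ∃ F, IsFourierSum (-1) φ F ∧ f =ᵐ[circ] fun t => ‖F t‖ ^ 2 := by
  rw [ae_circ]; exact hf

lemma IsDensityOf.integral_eq {φ : ℕ → ℂ} {f : ℝ → ℝ} (hf : IsDensityOf φ f) :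
    ∫ t, f t ∂circ = sqNorm φ := by
  obtain ⟨F, hF, hfF⟩ := hf.ae_eq
  rw [sqNorm, (hF.hasSum_sq (by norm_num)).tsum_eq]
  exact integral_congr_ae hfF

lemma IsDensityOf.mem_classD0_iff {φ : ℕ → ℂ} {f : ℝ → ℝ} (hf : IsDensityOf φ f) :
    f ∈ classD0 P₀ ↔ sqNorm φ ≤ P₀ := by
  rw [classD0_iff, hf.integral_eq]
  obtain ⟨F, hF, hfF⟩ := hf.ae_eq
  have h1 : Integrable f circ :=
    (integrable_congr hfF).2 (integrable_norm_sq (isFourierSum_neg_one_iff.1 hF).1.1)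
  have h2 : ∀ᵐ t ∂circ, 0 ≤ f t := by
    filter_upwards [hfF] with t ht
    rw [ht]; positivity
  exact ⟨fun h => h.2.2, fun h => ⟨h1, h2, h⟩⟩

lemma exists_certificate_of_mem (ha : Admissible n μ a) (hμ : 1 ≤ μ) {x : ℝ}
    (hx : x ∈ extremalValues n μ a P₀) : ∃ ν U, 0 < ν ∧ IsCertificate n μ a ν U ∧ x = ν * P₀ := by
  obtain ⟨φ, hφ, hP, ⟨f, c, hf, hc⟩, rfl⟩ := hx
  obtain ⟨ν, U, hν, hU, h⟩ := hφ.exists_certificate ha hμ hf hc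
  exact ⟨ν, U, hν, hU, by rw [h, hP]⟩

/-- The uniform upper bound from the certificate meets the lower bound `sqNorm_le_optimalError` at
`f`. -/
lemma IsCertificate.isLeastFavorable (ha : Admissible n μ a) (hμ : 1 ≤ μ) {ν : ℝ} {U : ℝ → ℂ}
    (hU : IsCertificate n μ a ν U) {φ : ℕ → ℂ} {f : ℝ → ℝ} (hf : IsDensityOf φ f)
    (hφ : sqNorm φ ≤ P₀) (h : ν * P₀ ≤ sqNorm (opDAW n μ a φ)) :
    IsLeastFavorable n μ a (classD0 P₀) f :=
  ⟨hf.mem_classD0_iff.2 hφ, fun _ hg => (hU.optimalError_le ha hμ hg).trans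
    (h.trans (sqNorm_le_optimalError ha hμ hf))⟩

lemma IsCertificate.solvesExtremum (ha : Admissible n μ a) (hμ : 1 ≤ μ) {ν : ℝ} {U : ℝ → ℂ}
    (hU : IsCertificate n μ a ν U) {φ : ℕ → ℂ} {f : ℝ → ℝ} (hf : IsDensityOf φ f)
    (hφ : sqNorm φ ≤ P₀) (h : ν * P₀ ≤ sqNorm (opDAW n μ a φ)) :
    SolvesExtremum n μ a (classD0 P₀) φ := by
  refine ⟨⟨f, hf.mem_classD0_iff.2 hφ, hf⟩, ?_⟩
  rintro ψ ⟨g, hg, hψ⟩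
  have hψP := hψ.mem_classD0_iff.1 hg
  obtain ⟨G, hG, -⟩ := hψ
  exact (hU.sqNorm_le ha hμ hG).trans
    ((mul_le_mul_of_nonneg_left hψP hU.nonneg).trans h)

/-- Equality makes $UF$ the series $R$ itself, and $|U|^2=\nu$ then gives (F) with $c=\nu^{-1/2}$.
-/
lemma IsCertificate.isExtremalForm (ha : Admissible n μ a) (hμ : 1 ≤ μ) {ν : ℝ} (hν : 0 < ν)
    {U : ℝ → ℂ} (hU : IsCertificate n μ a ν U) {φ : ℕ → ℂ} {f : ℝ → ℝ} (hf : IsDensityOf φ f)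
    (h : ν * sqNorm φ ≤ sqNorm (opDAW n μ a φ)) : ∃ c, IsExtremalForm n μ a φ c f := by
  obtain ⟨F, hF, hfF⟩ := hf.ae_eq
  refine ⟨((Real.sqrt ν)⁻¹ : ℝ), _, hU.isFourierSum ha hμ hF h, ?_⟩
  rw [← ae_circ]
  filter_upwards [hfF, hU.norm_sq] with t h1 h2
  rw [h1, norm_mul, norm_mul, mul_pow, mul_pow, h2, Complex.norm_real, Real.norm_eq_abs, sq_abs,
    inv_pow, Real.sq_sqrt hν.le, inv_mul_cancel_left₀ hν.ne']

lemma two_pi_mul_eq_iff {φ : ℕ → ℂ} {f : ℝ → ℝ} (hf : IsDensityOf φ f) :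
    ∫ t in (-Real.pi)..Real.pi, f t = 2 * Real.pi * P₀ ↔ sqNorm φ = P₀ := by
  have h := hf.integral_eq
  have hpi := Real.pi_pos
  rw [integral_circ, smul_eq_mul, inv_mul_eq_iff_eq_mul₀ (by positivity)] at h
  rw [h]
  exact mul_right_inj' (by positivity)

/-- One element of `extremalValues` supplies a certificate that bounds all competitors. Any
canonical solution of (F) is extremal through its own certificate. Conversely, an extremal `φ` does
at least as well as that element and so reaches the bound. -/
theorem extremum_of_isGreatest (ha : Admissible n μ a) (hμ : 1 ≤ μ) {x : ℝ}
    (hx : x ∈ extremalValues n μ a P₀) :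
    (∃ (φ : ℕ → ℂ) (c : ℂ) (f₀ : ℝ → ℝ), IsCanonical φ ∧ IsDensityOf φ f₀ ∧
      SolvesExtremum n μ a (classD0 P₀) φ ∧
      ∫ t in (-Real.pi)..Real.pi, f₀ t = 2 * Real.pi * P₀ ∧ IsExtremalForm n μ a φ c f₀) ∧
    ∀ (φ : ℕ → ℂ) (f₀ : ℝ → ℝ), IsCanonical φ → IsDensityOf φ f₀ →
      ∫ t in (-Real.pi)..Real.pi, f₀ t = 2 * Real.pi * P₀ →
      (SolvesExtremum n μ a (classD0 P₀) φ ↔ ∃ c : ℂ, IsExtremalForm n μ a φ c f₀) ∧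
      (SolvesExtremum n μ a (classD0 P₀) φ → IsLeastFavorable n μ a (classD0 P₀) f₀) := by
  have key : ∀ (φ : ℕ → ℂ) (c : ℂ) (f₀ : ℝ → ℝ), IsCanonical φ → IsDensityOf φ f₀ →
      sqNorm φ = P₀ → IsExtremalForm n μ a φ c f₀ → SolvesExtremum n μ a (classD0 P₀) φ := by
    intro φ c f₀ hφ hf hP hc
    obtain ⟨ν, U, hν, hU, h⟩ := hφ.exists_certificate ha hμ hf hc
    exact hU.solvesExtremum ha hμ hf hP.le (by rw [h, hP])
  obtain ⟨ν, U, hν, hU, hxν⟩ := exists_certificate_of_mem ha hμ hx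
  obtain ⟨φs, hφs, hPs, ⟨fs, cs, hfs, hcs⟩, hxs⟩ := hx
  refine ⟨⟨φs, cs, fs, hφs, hfs, key φs cs fs hφs hfs hPs hcs, (two_pi_mul_eq_iff hfs).2 hPs, hcs⟩,
    fun φ f₀ hφ hf hint => ?_⟩
  have hP := (two_pi_mul_eq_iff hf).1 hint
  have hge : SolvesExtremum n μ a (classD0 P₀) φ → ν * P₀ ≤ sqNorm (opDAW n μ a φ) := fun h => by
    rw [← hxν, hxs]
    exact h.2 φs ⟨fs, hfs.mem_classD0_iff.2 hPs.le, hfs⟩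
  exact ⟨⟨fun h => hU.isExtremalForm ha hμ hν hf (by rw [hP]; exact hge h),
    fun ⟨c, hc⟩ => key φ c f₀ hφ hf hP hc⟩,
    fun h => hU.isLeastFavorable ha hμ hf hP.le (hge h)⟩

end LeastFavorable

end Extrapolation

end

noncomputable section

namespace Extrapolation

/-! ### Families with the same Gram matrix -/

section Gram

variable {E H : Type*} [NormedAddCommGroup E] [InnerProductSpace ℂ E]
  [NormedAddCommGroup H] [InnerProductSpace ℂ H]

/-- The closed linear span of a set. -/
def cspan (s : Set E) : Submodule ℂ E := (Submodule.span ℂ s).topologicalClosure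

lemma subset_cspan {s : Set E} {v : E} (h : v ∈ s) : v ∈ cspan s :=
  Submodule.le_topologicalClosure _ (Submodule.subset_span h)

lemma isClosed_cspan (s : Set E) : IsClosed (cspan s : Set E) :=
  Submodule.isClosed_topologicalClosure _

lemma cspan_le {s : Set E} {K : Submodule ℂ E} (hK : IsClosed (K : Set E)) (h : s ⊆ K) :
    cspan s ≤ K :=
  Submodule.topologicalClosure_minimal _ (Submodule.span_le.2 h) hK

lemma cspan_mono {s t : Set E} (h : s ⊆ t) : cspan s ≤ cspan t :=
  cspan_le (isClosed_cspan t) fun _ hv => subset_cspan (h hv)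

instance [CompleteSpace E] (s : Set E) : CompleteSpace (cspan s) :=
  (isClosed_cspan s).completeSpace_coe

lemma map_mem_of_mem_cspan {s : Set E} {K : Submodule ℂ H} (hK : IsClosed (K : Set H))
    (T : E →L[ℂ] H) (h : ∀ v ∈ s, T v ∈ K) {v : E} (hv : v ∈ cspan s) : T v ∈ K :=
  cspan_le (K := K.comap T.toLinearMap) (hK.preimage T.continuous) h hv

lemma inner_eq_zero_of_mem_cspan {s : Set E} {w : E} (h : ∀ v ∈ s, inner ℂ w v = 0) {v : E}
    (hv : v ∈ cspan s) : inner ℂ w v = 0 := by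
  have := map_mem_of_mem_cspan (K := (⊥ : Submodule ℂ ℂ)) (s := s) isClosed_singleton
    (innerSL ℂ w) (by simpa using h) hv
  simpa using this

lemma norm_linearCombination_eq {ι : Type*} {x : ι → H} {y : ι → E}
    (h : ∀ i j, inner ℂ (x i) (x j) = inner ℂ (y i) (y j)) (c : ι →₀ ℂ) :
    ‖Finsupp.linearCombination ℂ x c‖ = ‖Finsupp.linearCombination ℂ y c‖ := by
  have h1 : inner ℂ (Finsupp.linearCombination ℂ x c) (Finsupp.linearCombination ℂ x c) =
      inner ℂ (Finsupp.linearCombination ℂ y c) (Finsupp.linearCombination ℂ y c) := by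
    simp only [Finsupp.linearCombination_apply, Finsupp.sum, sum_inner, inner_sum,
      inner_smul_left, inner_smul_right, h]
  rw [inner_self_eq_norm_sq_to_K, inner_self_eq_norm_sq_to_K] at h1
  have h2 : ‖Finsupp.linearCombination ℂ x c‖ ^ 2 = ‖Finsupp.linearCombination ℂ y c‖ ^ 2 := by
    exact_mod_cast h1
  exact (pow_left_inj₀ (norm_nonneg _) (norm_nonneg _) two_ne_zero).1 h2

/-- Two families with the same Gram matrix are related by an isometry of their closed spans. -/
lemma exists_isometry_of_gram [CompleteSpace E] [CompleteSpace H] {ι : Type*} {x : ι → H}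
    {y : ι → E}
    (h : ∀ i j, inner ℂ (x i) (x j) = inner ℂ (y i) (y j)) :
    ∃ T : E →L[ℂ] H, (∀ i, T (y i) = x i) ∧
      ∀ v ∈ cspan (Set.range y), ∀ w ∈ cspan (Set.range y), inner ℂ (T v) (T w) = inner ℂ v w := by
  set K := cspan (Set.range y) with hK
  have hmem : ∀ c : ι →₀ ℂ, Finsupp.linearCombination ℂ y c ∈ K := fun c =>
    Submodule.le_topologicalClosure _ (by
      rw [Finsupp.mem_span_range_iff_exists_finsupp]
      exact ⟨c, rfl⟩)
  set e : (ι →₀ ℂ) →ₗ[ℂ] K := (Finsupp.linearCombination ℂ y).codRestrict K hmem with he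
  set f := Finsupp.linearCombination ℂ x with hf
  have hnorm : ∀ c, ‖f c‖ = ‖e c‖ := fun c => norm_linearCombination_eq h c
  have hdense : DenseRange e := by
    rw [DenseRange, dense_iff_closure_eq, Set.eq_univ_iff_forall]
    rintro ⟨v, hv⟩
    rw [closure_subtype]
    have h1 : (Subtype.val '' Set.range e : Set E) = Submodule.span ℂ (Set.range y) := by
      ext w
      rw [SetLike.mem_coe, Finsupp.mem_span_range_iff_exists_finsupp]
      constructor
      · rintro ⟨_, ⟨c, rfl⟩, rfl⟩; exact ⟨c, rfl⟩
      · rintro ⟨c, rfl⟩; exact ⟨_, ⟨c, rfl⟩, rfl⟩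
    rw [h1]
    exact hv
  -- Equality of norms makes `e c ↦ f c` well defined even when the `y i` are dependent; density of
  -- the range extends it to `K`.
  set T₀ := f.extendOfNorm e with hT₀
  have hT₀e : ∀ c, T₀ (e c) = f c := fun c =>
    LinearMap.extendOfNorm_eq hdense ⟨1, fun c => by rw [hnorm, one_mul]⟩ c
  have hT₀n : ∀ v, ‖T₀ v‖ = ‖v‖ := fun v =>
    hdense.induction (by rintro _ ⟨c, rfl⟩; rw [hT₀e, hnorm])
      (isClosed_eq (by fun_prop) continuous_norm) v
  have hT₀i : ∀ v w, inner ℂ (T₀ v) (T₀ w) = inner ℂ v w := fun v w =>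
    LinearIsometry.inner_map_map ⟨T₀.toLinearMap, hT₀n⟩ v w
  have hproj : ∀ v (hv : v ∈ K), K.orthogonalProjectionOnto v = ⟨v, hv⟩ := fun v hv =>
    Submodule.orthogonalProjectionOnto_mem_subspace_eq_self (K := K) ⟨v, hv⟩
  -- The projection onto `K` makes the map defined everywhere; it is isometric only on `K`.
  refine ⟨T₀ ∘L K.orthogonalProjectionOnto, fun i => ?_, fun v hv w hw => ?_⟩
  · have h1 : y i ∈ K := subset_cspan ⟨i, rfl⟩
    have h2 : (⟨y i, h1⟩ : K) = e (Finsupp.single i 1) := by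
      apply Subtype.ext; simp [he]
    rw [ContinuousLinearMap.comp_apply, hproj _ h1, h2, hT₀e, hf]
    simp
  · rw [ContinuousLinearMap.comp_apply, ContinuousLinearMap.comp_apply, hproj _ hv, hproj _ hw,
      hT₀i]
    rfl

end Gram

/-! ### The Wold decomposition -/

section Wold

variable {E : Type*} [NormedAddCommGroup E] [InnerProductSpace ℂ E]

/-- A group of isometries indexed by the integers. -/
structure IsShift (U : ℤ → E →ₗᵢ[ℂ] E) : Prop where
  zero : ∀ v, U 0 v = v
  add : ∀ j k v, U (j + k) v = U j (U k v)

/-- The closed span of `U j v`, `j ≤ t`. -/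
def past (U : ℤ → E →ₗᵢ[ℂ] E) (v : E) (t : ℤ) : Submodule ℂ E := cspan {w | ∃ j ≤ t, w = U j v}

instance [CompleteSpace E] (U : ℤ → E →ₗᵢ[ℂ] E) (v : E) (t : ℤ) : CompleteSpace (past U v t) := by
  unfold past; infer_instance

variable {U : ℤ → E →ₗᵢ[ℂ] E}

lemma mem_past {v : E} {j t : ℤ} (h : j ≤ t) : U j v ∈ past U v t := subset_cspan ⟨j, h, rfl⟩

lemma past_mono (v : E) {s t : ℤ} (h : s ≤ t) : past U v s ≤ past U v t :=
  cspan_mono fun _ ⟨j, hj, hw⟩ => ⟨j, hj.trans h, hw⟩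

lemma isClosed_past (v : E) (t : ℤ) : IsClosed (past U v t : Set E) := isClosed_cspan _

lemma IsShift.map_mem_past (hU : IsShift U) {v w : E} {s : ℤ} (t : ℤ) (hw : w ∈ past U v s) :
    U t w ∈ past U v (t + s) := by
  refine map_mem_of_mem_cspan (isClosed_past v (t + s)) (U t).toContinuousLinearMap ?_ hw
  rintro _ ⟨j, hj, rfl⟩
  change U t (U j v) ∈ _
  rw [← hU.add]
  exact mem_past (by omega)

lemma IsShift.past_le (hU : IsShift U) {v w : E} {s : ℤ} (hw : w ∈ past U v s) (t : ℤ) :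
    past U w t ≤ past U v (t + s) := by
  refine cspan_le (isClosed_past _ _) ?_
  rintro _ ⟨j, hj, rfl⟩
  exact past_mono v (by omega) (hU.map_mem_past j hw)

lemma IsShift.inner_eq (hU : IsShift U) (j k : ℤ) (v w : E) :
    inner ℂ (U j v) (U k w) = inner ℂ (U (j - k) v) w := by
  rw [← (U k).inner_map_map (U (j - k) v) w, ← hU.add]
  congr 3; ring

/-- `η` is an innovation of `θ`: its shifts are orthonormal and generate the past of `θ`. -/
structure IsInnovationVec (U : ℤ → E →ₗᵢ[ℂ] E) (θ η : E) : Prop where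
  orthonormal : Orthonormal ℂ fun j => U j η
  mem : η ∈ past U θ 0
  mem' : θ ∈ past U η 0

/-- The innovation is the normalised component of `θ` orthogonal to its strict past. The hypothesis
on the intersection of the pasts says that there is no deterministic part. -/
theorem IsShift.exists_innovation [CompleteSpace E] (hU : IsShift U) {θ : E} (hθ : θ ≠ 0)
    (hinter : ∀ g, (∀ t, g ∈ past U θ t) → g = 0) : ∃ η, IsInnovationVec U θ η := by
  set M := past U θ (-1) with hM
  set d := θ - M.starProjection θ with hd
  have hdM : d ∈ Mᗮ := Submodule.sub_starProjection_mem_orthogonal θ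
  have hθ0 : θ ∈ past U θ 0 := by
    have := mem_past (U := U) (v := θ) (le_refl 0)
    rwa [hU.zero] at this
  have hM0 : M ≤ past U θ 0 := past_mono θ (by norm_num)
  have hdmem : d ∈ past U θ 0 :=
    Submodule.sub_mem _ hθ0 (hM0 (Submodule.starProjection_apply_mem _ _))
  have hd0 : d ≠ 0 := by
    intro h0
    have hθM : θ ∈ M := by
      rw [sub_eq_zero.1 (hd.symm.trans h0)]; exact Submodule.starProjection_apply_mem _ _
    apply hθ
    -- If `θ` lay in its strict past, all its pasts would coincide and contain `θ`, which would then
    -- vanish.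
    have hstep : ∀ N : ℕ, θ ∈ past U θ (-N) := fun N => by
      induction N with
      | zero => simpa using hθ0
      | succ N ih =>
        have := hU.past_le hθM (-N) ih
        convert this using 2
        push_cast; ring
    refine hinter θ fun t => past_mono θ ?_ (hstep t.natAbs)
    omega
  set η := ((‖d‖⁻¹ : ℝ) : ℂ) • d with hη
  have hdn : ‖d‖ ≠ 0 := norm_ne_zero_iff.2 hd0
  have hηM : η ∈ Mᗮ := Submodule.smul_mem _ _ hdM
  have hηmem : η ∈ past U θ 0 := Submodule.smul_mem _ _ hdmem
  have hηn : ‖η‖ = 1 := by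
    rw [hη, norm_smul, Complex.norm_real, Real.norm_of_nonneg (by positivity), inv_mul_cancel₀ hdn]
  have hdη : d = ((‖d‖ : ℝ) : ℂ) • η := by
    rw [hη, smul_smul, ← Complex.ofReal_mul, mul_inv_cancel₀ hdn]; simp
  have hneg : ∀ k : ℤ, k < 0 → inner ℂ (U k η) η = 0 := fun k hk =>
    (Submodule.mem_orthogonal M η).1 hηM _
      (past_mono θ (by omega) (hU.map_mem_past k hηmem))
  have horth : Orthonormal ℂ fun j => U j η := by
    refine ⟨fun j => by rw [LinearIsometry.norm_map, hηn], fun j k hjk => ?_⟩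
    rcases lt_or_gt_of_ne hjk with h | h
    · change inner ℂ (U j η) (U k η) = 0
      rw [hU.inner_eq, hneg _ (by omega)]
    · change inner ℂ (U j η) (U k η) = 0
      rw [← inner_conj_symm, hU.inner_eq, hneg _ (by omega), map_zero]
  have hηθ : past U η 0 ≤ past U θ 0 := hU.past_le hηmem 0
  refine ⟨η, horth, hηmem, ?_⟩
  -- a vector of the past that is orthogonal to the innovation belongs to the strict past
  have step0 : ∀ h ∈ past U θ 0, inner ℂ η h = 0 → h ∈ M := by
    intro h hh hηh
    set x := h - M.starProjection h with hx
    have hxM : x ∈ Mᗮ := Submodule.sub_starProjection_mem_orthogonal h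
    have hx0 : x ∈ past U θ 0 :=
      Submodule.sub_mem _ hh (hM0 (Submodule.starProjection_apply_mem _ _))
    have hxη : inner ℂ x η = 0 := by
      rw [← inner_conj_symm, hx, inner_sub_right, hηh,
        (Submodule.mem_orthogonal' M η).1 hηM _ (Submodule.starProjection_apply_mem _ _)]
      simp
    have hxθ : inner ℂ x θ = 0 := by
      have e : θ = ((‖d‖ : ℝ) : ℂ) • η + M.starProjection θ := by
        rw [← hdη, hd]; abel
      rw [e, inner_add_right, inner_smul_right, hxη,
        (Submodule.mem_orthogonal' M x).1 hxM _ (Submodule.starProjection_apply_mem _ _)]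
      simp
    have hxx : inner ℂ x x = 0 := by
      refine inner_eq_zero_of_mem_cspan ?_ hx0
      rintro _ ⟨j, hj, rfl⟩
      rcases eq_or_lt_of_le hj with rfl | hj
      · rw [hU.zero, hxθ]
      · exact (Submodule.mem_orthogonal' M x).1 hxM _ (mem_past (by omega))
    rw [inner_self_eq_zero] at hxx
    rw [sub_eq_zero.1 (hx.symm.trans hxx)]
    exact Submodule.starProjection_apply_mem _ _
  have step : ∀ t : ℤ, ∀ g ∈ past U θ t, inner ℂ (U t η) g = 0 → g ∈ past U θ (t - 1) := by
    intro t g hg h0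
    have h1 : U (-t) g ∈ past U θ 0 := by
      have := hU.map_mem_past (-t) hg
      rwa [neg_add_cancel] at this
    have h2 : inner ℂ η (U (-t) g) = 0 := by
      rw [← (U t).inner_map_map, ← hU.add, add_neg_cancel, hU.zero, h0]
    have h3 := hU.map_mem_past t (step0 _ h1 h2)
    rwa [← hU.add, add_neg_cancel, hU.zero] at h3
  -- This residual is orthogonal to every past innovation, so it descends one step at a time into
  -- all pasts of `θ` and is zero.
  set g := θ - (past U η 0).starProjection θ with hg
  have hgO : g ∈ (past U η 0)ᗮ := Submodule.sub_starProjection_mem_orthogonal θ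
  have hg0 : g ∈ past U θ 0 :=
    Submodule.sub_mem _ hθ0 (hηθ (Submodule.starProjection_apply_mem _ _))
  have hgN : ∀ N : ℕ, g ∈ past U θ (-N) := fun N => by
    induction N with
    | zero => simpa using hg0
    | succ N ih =>
      have := step (-N) g ih ((Submodule.mem_orthogonal _ g).1 hgO _ (mem_past (by omega)))
      convert this using 2
      push_cast; ring
  have hgz : g = 0 := hinter g fun t => past_mono θ (by omega) (hgN t.natAbs)
  rw [sub_eq_zero.1 (hg.symm.trans hgz)]
  exact Submodule.starProjection_apply_mem _ _

lemma hasSum_of_mem_cspan [CompleteSpace E] {e : ℕ → E} (he : Orthonormal ℂ e) {v : E}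
    (hv : v ∈ cspan (Set.range e)) : HasSum (fun k => inner ℂ (e k) v • e k) v := by
  set K := cspan (Set.range e) with hK
  have hmem : ∀ k, e k ∈ K := fun k => subset_cspan ⟨k, rfl⟩
  have he' : Orthonormal ℂ fun k => (⟨e k, hmem k⟩ : K) := by
    rw [orthonormal_iff_ite] at he ⊢
    exact he
  have hbot : (Submodule.span ℂ (Set.range fun k => (⟨e k, hmem k⟩ : K)))ᗮ = ⊥ := by
    rw [Submodule.eq_bot_iff]
    rintro ⟨w, hw⟩ hwo
    have h0 : inner ℂ w w = 0 := by
      refine inner_eq_zero_of_mem_cspan ?_ hw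
      rintro _ ⟨k, rfl⟩
      exact (Submodule.mem_orthogonal' _ _).1 hwo _ (Submodule.subset_span ⟨k, rfl⟩)
    exact Subtype.ext (inner_self_eq_zero.1 h0)
  have h := (HilbertBasis.mkOfOrthogonalEqBot he' hbot).hasSum_repr ⟨v, hv⟩
  have h2 := h.mapL K.subtypeL
  simpa [HilbertBasis.repr_apply_apply] using h2

lemma IsInnovationVec.hasSum [CompleteSpace E] {θ η : E}
    (h : IsInnovationVec U θ η) {v : E} (hv : v ∈ past U η 0) :
    HasSum (fun k : ℕ => inner ℂ (U (-k) η) v • U (-k) η) v := by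
  have horth : Orthonormal ℂ fun k : ℕ => U (-k) η :=
    h.orthonormal.comp _ fun a b h => by simpa using h
  refine hasSum_of_mem_cspan horth (cspan_mono ?_ hv)
  rintro _ ⟨j, hj, rfl⟩
  exact ⟨(-j).toNat, by simp [hj]⟩

end Wold

end Extrapolation

end

noncomputable section

namespace Extrapolation

/-! ### The spectral model of the increments -/

lemma sum_smul_toLp {X : Type*} [MeasurableSpace X] {m : Measure X} {ι : Type*} (s : Finset ι)
    (c : ι → ℂ) {F : ι → X → ℂ} (hF : ∀ i, MemLp (F i) 2 m)
    (hs : MemLp (fun x => ∑ i ∈ s, c i * F i x) 2 m) :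
    ∑ i ∈ s, c i • (hF i).toLp (F i) = hs.toLp _ := by
  rw [← Lp.toLp_coeFn (∑ i ∈ s, _) (Lp.memLp _), MemLp.toLp_eq_toLp_iff]
  refine (Lp.coeFn_finsetSum _ _).trans ?_
  have : ∀ᵐ x ∂m, ∀ i ∈ s, (c i • (hF i).toLp (F i) : Lp ℂ 2 m) x = c i * F i x := by
    refine (Filter.eventually_all_finset s).2 fun i _ => ?_
    filter_upwards [Lp.coeFn_smul (c i) ((hF i).toLp (F i)), (hF i).coeFn_toLp] with x h1 h2
    rw [h1, Pi.smul_apply, h2, smul_eq_mul]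
  filter_upwards [this] with x hx
  rw [Finset.sum_apply]
  exact Finset.sum_congr rfl hx

lemma memLp_sum_mul {X : Type*} [MeasurableSpace X] {m : Measure X} {ι : Type*} (s : Finset ι)
    (c : ι → ℂ) {F : ι → X → ℂ} (hF : ∀ i, MemLp (F i) 2 m) :
    MemLp (fun x => ∑ i ∈ s, c i * F i x) 2 m :=
  memLp_finsetSum s fun i _ => (hF i).const_mul (c i)

/-- `g` is a factor of the spectral density of the increments of order `n`. -/
structure IsSpectralFactor (n : ℕ) (f : ℝ → ℝ) (g : ℝ → ℂ) : Prop where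
  aesm : AEStronglyMeasurable g circ
  norm_sq : ∀ᵐ t ∂circ, ‖g t‖ ^ 2 = f t / t ^ (2 * n)

/-- The spectral representation of the increment with step `k` at time zero. -/
def specIncr (n : ℕ) (g : ℝ → ℂ) (k : ℕ) (t : ℝ) : ℂ := (1 - expo (-(k : ℤ)) t) ^ n * g t

section Model

variable {n : ℕ} {f : ℝ → ℝ} {g : ℝ → ℂ}

lemma IsSpectralFactor.norm_specIncr_sq (hg : IsSpectralFactor n f g) (k : ℕ) :
    ∀ᵐ t ∂circ, ‖specIncr n g k t‖ ^ 2 = weight n k t * f t := by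
  filter_upwards [hg.norm_sq] with t ht
  rw [specIncr, norm_mul, mul_pow, ht, norm_pow, ← pow_mul, mul_comm n 2, weight_eq]
  ring

lemma IsSpectralFactor.memLp (hg : IsSpectralFactor n f g) (hf : Integrable f circ) (k : ℕ) :
    MemLp (specIncr n g k) 2 circ := by
  have hm : AEStronglyMeasurable (specIncr n g k) circ :=
    ((continuous_const.sub (continuous_expo _)).pow n).aestronglyMeasurable.mul hg.aesm
  rw [memLp_two_iff_integrable_sq_norm hm]
  refine Integrable.mono' (hf.norm.const_mul ((k : ℝ) ^ (2 * n))) (hm.norm.pow 2) ?_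
  filter_upwards [hg.norm_specIncr_sq k] with t ht
  rw [ht, norm_mul, Real.norm_of_nonneg (weight_nonneg n k t)]
  exact mul_le_mul_of_nonneg_right (weight_le n t) (norm_nonneg _)

lemma exists_isSpectralFactor (n : ℕ) (hf : Integrable f circ) (hf0 : ∀ᵐ t ∂circ, 0 ≤ f t) :
    ∃ g, IsSpectralFactor n f g := by
  refine ⟨fun t => ((Real.sqrt (f t) / t ^ n : ℝ) : ℂ), ?_, ?_⟩
  · refine Complex.continuous_ofReal.comp_aestronglyMeasurable ?_
    have h1 : AEMeasurable (fun t => Real.sqrt (f t) / t ^ n) circ :=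
      hf.1.aemeasurable.sqrt.div (by fun_prop)
    exact h1.aestronglyMeasurable
  · filter_upwards [hf0] with t ht
    rw [Complex.norm_real, Real.norm_eq_abs, sq_abs, div_pow, Real.sq_sqrt ht, ← pow_mul, mul_comm]

variable {Ω : Type u} [MeasurableSpace Ω] {P : Measure Ω} {ξ : ℤ → Ω → ℂ}

/-- The structural formula says that the increments and the functions $e^{imt}(1-e^{-ikt})^ng$ with
$|g|^2=f/t^{2n}$ have the same Gram matrix. The phase of $g$ is immaterial. -/
lemma HasSpectralDensity.inner_eq (hξ : HasSpectralDensity P n ξ f) (hg : IsSpectralFactor n f g)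
    (hf : Integrable f circ) (m₁ m₂ : ℤ) (k₁ k₂ : ℕ) :
    inner ℂ ((hξ.memLp m₁ k₁).toLp _) ((hξ.memLp m₂ k₂).toLp _) =
      inner ℂ ((memLp_expo_mul m₁ (hg.memLp hf k₁)).toLp _)
        ((memLp_expo_mul m₂ (hg.memLp hf k₂)).toLp _) := by
  rw [inner_toLp_eq_integral, inner_toLp_eq_integral]
  -- The inner product is conjugate linear in its first argument, so the two steps enter in reverse
  -- order.
  have h := hξ.structural m₁ (m₂ - m₁) k₂ k₁
  rw [add_sub_cancel] at h
  simp_rw [mul_comm (conj (increment n ξ m₁ k₁ _))]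
  rw [h]
  have hint : ∀ G : ℝ → ℂ, (1 / (2 * Real.pi) : ℂ) * ∫ t in (-Real.pi)..Real.pi, G t =
      ∫ t, G t ∂circ := fun G => by
    rw [integral_circ, Complex.real_smul]; push_cast; rw [one_div]
  rw [hint]
  refine integral_congr_ae ?_
  filter_upwards [hg.norm_sq] with t ht
  have e1 : Complex.exp (Complex.I * t * ((m₂ - m₁ : ℤ) : ℂ)) = conj (expo m₁ t) * expo m₂ t := by
    rw [conj_expo, ← expo_add, expo]; congr 1; push_cast; ring
  have e2 : Complex.exp (-(Complex.I * ((k₂ : ℤ) : ℂ) * t)) = expo (-(k₂ : ℤ)) t := by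
    rw [expo]; congr 1; push_cast; ring
  have e3 : Complex.exp (Complex.I * ((k₁ : ℤ) : ℂ) * t) = conj (expo (-(k₁ : ℤ)) t) := by
    rw [conj_expo, expo]; congr 1; push_cast; ring
  have e4 : (f t : ℂ) / (t : ℂ) ^ (2 * n) = conj (g t) * g t := by
    rw [Complex.conj_mul', ← Complex.ofReal_pow ‖g t‖, ht]; push_cast; rfl
  rw [e1, e2, e3, div_mul_eq_mul_div, mul_div_assoc, e4]
  simp only [specIncr, map_mul, map_pow, map_sub, map_one]
  ring

lemma norm_eq_of_inner_eq {E H : Type*} [NormedAddCommGroup E] [InnerProductSpace ℂ E]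
    [NormedAddCommGroup H] [InnerProductSpace ℂ H] {v : E} {w : H}
    (h : inner ℂ v v = inner ℂ w w) : ‖v‖ = ‖w‖ := by
  rw [inner_self_eq_norm_sq_to_K, inner_self_eq_norm_sq_to_K] at h
  exact (pow_left_inj₀ (norm_nonneg _) (norm_nonneg _) two_ne_zero).1 (by exact_mod_cast h)

/-! ### The mean square error of the optimal estimate -/

/-- Absolute summability of `b` bounds the partial sums uniformly, so dominated convergence needs
only $W\in L_2$. Transported to the increments, this gives convergence of $B\xi$. -/
lemma tendsto_bFun_mul {μ : ℕ} {a : ℕ → ℂ} (ha : Admissible n μ a) {W : ℝ → ℂ}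
    (hW : MemLp W 2 circ) :
    Tendsto (fun N : ℕ => ∑ k ∈ Finset.range N, bCoeff n μ a k • (memLp_expo_mul k hW).toLp _)
      atTop (𝓝 ((memLp_bFun_mul ha hW).toLp _)) := by
  have hS := fun N : ℕ => memLp_sum_mul (Finset.range N) (bCoeff n μ a)
    (fun k : ℕ => memLp_expo_mul (k : ℤ) hW)
  have e : ∀ N : ℕ, ∑ k ∈ Finset.range N, bCoeff n μ a k • (memLp_expo_mul (k : ℤ) hW).toLp _ =
      (hS N).toLp _ := fun N => sum_smul_toLp _ _ _ (hS N)
  simp_rw [e]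
  rw [Lp.tendsto_Lp_iff_tendsto_eLpNorm'']
  refine (tendsto_eLpNorm_two_iff fun N => (hS N).sub (memLp_bFun_mul ha hW)).2 ?_
  set C := ∑' k, ‖bCoeff n μ a k‖ with hC
  have h0 : (0 : ℝ) = ∫ t : ℝ, (0 : ℝ) ∂circ := by simp
  rw [h0]
  have hfac : ∀ (N : ℕ) t, ∑ k ∈ Finset.range N, bCoeff n μ a k * (expo k t * W t) =
      (∑ k ∈ Finset.range N, bCoeff n μ a k * expo k t) * W t := fun N t => by
    rw [Finset.sum_mul]; simp only [mul_assoc]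
  refine tendsto_integral_of_dominated_convergence (fun t => (2 * C) ^ 2 * ‖W t‖ ^ 2)
    (fun N => (((hS N).sub (memLp_bFun_mul ha hW)).1.norm.pow 2))
    ((integrable_norm_sq hW).const_mul _) (fun N => Eventually.of_forall fun t => ?_)
    (Eventually.of_forall fun t => ?_)
  · rw [Real.norm_of_nonneg (by positivity), Pi.sub_apply, hfac, ← sub_mul, norm_mul, mul_pow]
    gcongr
    refine (norm_sub_le _ _).trans ?_
    rw [two_mul]
    refine add_le_add (norm_sum_le_of_le _ (fun k _ => ?_) |>.trans
      (ha.summable.sum_le_tsum (Finset.range N) fun _ _ => norm_nonneg _)) (norm_bFun_le ha t)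
    rw [norm_mul, norm_expo, mul_one]
  · have h1 : HasSum (fun k : ℕ => bCoeff n μ a k * expo k t) (bFun n μ a t) := by
      have : Summable fun k : ℕ => bCoeff n μ a k * expo k t :=
        Summable.of_norm (by simpa using ha.summable)
      simpa [bFun, expo] using this.hasSum
    have h2 := ((h1.tendsto_sum_nat.mul_const (W t)).sub_const (bFun n μ a t * W t)).norm.pow 2
    simp only [sub_self, norm_zero, ne_eq, OfNat.ofNat_ne_zero, not_false_eq_true, zero_pow] at h2
    simpa only [Pi.sub_apply, hfac] using h2

/-- An isometry carries the spectral images of the increments of step `μ` to the increments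
themselves. It yields the limit $B\xi$ and identifies the two mean square errors for each `c`
separately, so the infima agree. -/
theorem exists_functionalA_and_leastMSE_eq {μ : ℕ} {a : ℕ → ℂ} (ha : Admissible n μ a)
    {P₀ : ℝ} (hf : f ∈ classD0 P₀) (hξ : HasSpectralDensity P n ξ f) :
    (∃ X, IsFunctionalA P n μ a ξ X) ∧
      ∀ X, IsFunctionalA P n μ a ξ X → leastMSE P n μ a ξ X = optimalError n μ a f := by
  obtain ⟨hfi, hf0, -⟩ := classD0_iff.1 hf
  obtain ⟨g, hg⟩ := exists_isSpectralFactor n hfi hf0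
  set W := specIncr n g μ with hWdef
  have hW : MemLp W 2 circ := hg.memLp hfi μ
  set y : ℤ → Lp ℂ 2 circ := fun m => (memLp_expo_mul m hW).toLp _ with hy
  set x : ℤ → Lp ℂ 2 P := fun m => (hξ.memLp m μ).toLp _ with hx
  obtain ⟨T, hT, hTi⟩ := exists_isometry_of_gram (x := x) (y := y)
    fun i j => hξ.inner_eq hg hfi i j μ μ
  have hTn : ∀ v ∈ cspan (Set.range y), ‖T v‖ = ‖v‖ := fun v hv =>
    norm_eq_of_inner_eq (hTi v hv v hv)
  set By : Lp ℂ 2 circ := (memLp_bFun_mul ha hW).toLp _ with hBy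
  have hlim : Tendsto (fun N : ℕ => ∑ k ∈ Finset.range N, bCoeff n μ a k • y k) atTop (𝓝 By) :=
    tendsto_bFun_mul ha hW
  have hBmem : By ∈ cspan (Set.range y) := by
    refine (isClosed_cspan _).mem_of_tendsto hlim (Eventually.of_forall fun N => ?_)
    exact Submodule.sum_mem _ fun k _ => Submodule.smul_mem _ _ (subset_cspan ⟨k, rfl⟩)
  have hlimT : Tendsto (fun N : ℕ => ∑ k ∈ Finset.range N, bCoeff n μ a k • x k) atTop
      (𝓝 (T By)) := by
    refine ((T.continuous.tendsto By).comp hlim).congr fun N => ?_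
    simp [map_sum, hT]
  have hS := fun N : ℕ => memLp_sum_mul (Finset.range N) (bCoeff n μ a)
    (fun k : ℕ => hξ.memLp k μ)
  have hSx : ∀ N : ℕ, ∑ k ∈ Finset.range N, bCoeff n μ a k • x k = (hS N).toLp _ := fun N =>
    sum_smul_toLp _ _ (fun k : ℕ => hξ.memLp k μ) (hS N)
  have hVm : AEStronglyMeasurable (functionalV n μ a ξ) P :=
    Finset.aestronglyMeasurable_fun_sum _ fun i _ => (hξ.meas _).const_mul _
  have hconv : ∀ Z : Ω → ℂ, ∀ hZ : MemLp Z 2 P,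
      Tendsto (fun N : ℕ => eLpNorm (fun ω => Z ω -
        ∑ k ∈ Finset.range N, bCoeff n μ a k * increment n ξ k μ ω) 2 P) atTop (𝓝 0) ↔
      T By = hZ.toLp Z := fun Z hZ => by
    have e : ∀ N : ℕ, eLpNorm (fun ω => Z ω -
        ∑ k ∈ Finset.range N, bCoeff n μ a k * increment n ξ k μ ω) 2 P =
        eLpNorm ((fun ω => ∑ k ∈ Finset.range N, bCoeff n μ a k * increment n ξ k μ ω) - Z) 2 P :=
      fun N => eLpNorm_sub_comm Z _ 2 P
    simp_rw [e]
    rw [← Lp.tendsto_Lp_iff_tendsto_eLpNorm'' (p := 2) _ hS Z hZ]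
    simp_rw [← hSx]
    exact ⟨fun h => tendsto_nhds_unique hlimT h, fun h => h ▸ hlimT⟩
  constructor
  · refine ⟨fun ω => T By ω - functionalV n μ a ξ ω, (Lp.aestronglyMeasurable _).sub hVm, ?_⟩
    have := (hconv (T By) (Lp.memLp _)).2 (Lp.toLp_coeFn _ _).symm
    simpa using this
  · rintro X ⟨hXm, hXlim⟩
    -- $X+V\xi$ is square integrable because it lies within distance 1 of some square integrable
    -- partial sum; $X$ and $V\xi$ separately need not be.
    have hZ : MemLp (fun ω => X ω + functionalV n μ a ξ ω) 2 P := by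
      obtain ⟨N, hN⟩ := (hXlim.eventually_lt_const (show (0 : ℝ≥0∞) < 1 by norm_num)).exists
      have h1 : MemLp (fun ω => X ω + functionalV n μ a ξ ω -
          ∑ k ∈ Finset.range N, bCoeff n μ a k * increment n ξ k μ ω) 2 P :=
        ⟨(hXm.add hVm).sub (hS N).1, hN.trans (by simp)⟩
      have h2 := h1.add (hS N)
      refine (memLp_congr_ae (Eventually.of_forall fun ω => ?_)).1 h2
      simp
    have hTB := (hconv _ hZ).1 hXlim
    rw [leastMSE, optimalError]
    congr 1 with c
    have hCx := memLp_sum_mul c.support c (fun j : ℕ => hξ.memLp (-1 - (j : ℤ)) μ)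
    have hCy := memLp_sum_mul c.support c (fun j : ℕ => memLp_expo_mul (-1 - (j : ℤ)) hW)
    have hCT : T (hCy.toLp _) = hCx.toLp _ := by
      rw [← sum_smul_toLp c.support c (fun j : ℕ => memLp_expo_mul (-1 - (j : ℤ)) hW) hCy,
        ← sum_smul_toLp c.support c (fun j : ℕ => hξ.memLp (-1 - (j : ℤ)) μ) hCx, map_sum]
      refine Finset.sum_congr rfl fun j _ => ?_
      rw [map_smul]
      congr 1
      exact hT (-1 - (j : ℤ))
    have hCmem : hCy.toLp _ ∈ cspan (Set.range y) := by
      rw [← sum_smul_toLp c.support c (fun j : ℕ => memLp_expo_mul (-1 - (j : ℤ)) hW) hCy]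
      exact Submodule.sum_mem _ fun j _ => Submodule.smul_mem _ _ (subset_cspan ⟨-1 - (j : ℤ), rfl⟩)
    have hL : ∫ ω, ‖X ω - linearEstimate n μ a ξ c ω‖ ^ 2 ∂P =
        ‖T By - T (hCy.toLp _)‖ ^ 2 := by
      rw [hTB, hCT, ← MemLp.toLp_sub hZ hCx, norm_toLp_sq]
      congr 1 with ω
      -- The term $-V\xi$ of the estimate completes $X$ to $X+V\xi=B\xi$, leaving only increments.
      rw [linearEstimate, Finsupp.sum, Pi.sub_apply]
      congr 2; ring
    have hR : specError n μ a (pastChar c) f = ‖By - hCy.toLp _‖ ^ 2 := by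
      rw [hBy, ← MemLp.toLp_sub (memLp_bFun_mul ha hW) hCy, norm_toLp_sq, specError_eq]
      refine integral_congr_ae ?_
      filter_upwards [hg.norm_specIncr_sq μ] with t ht
      rw [Pi.sub_apply, mul_assoc, ← ht, ← hWdef, ← mul_pow, ← norm_mul, sub_mul, pastChar,
        Finsupp.sum, Finset.sum_mul]
      congr 3
      refine Finset.sum_congr rfl fun j _ => ?_
      rw [mul_assoc, expo]
      congr 3; push_cast; ring
    rw [hL, hR, ← map_sub, hTn _ (Submodule.sub_mem _ hBmem hCmem)]

end Model

end Extrapolation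

end

noncomputable section

namespace Extrapolation

/-! ### Closed spans of random variables -/

section ClosedSpan

variable {Ω : Type*} [MeasurableSpace Ω] {P : Measure Ω} {S : Set (Ω → ℂ)}

/-- The classes of the elements of `S`. -/
def lpClasses (P : Measure Ω) (S : Set (Ω → ℂ)) : Set (Lp ℂ 2 P) := {v | ∃ Y ∈ S, v =ᵐ[P] Y}

lemma exists_toLp_mem_span (hS : ∀ Y ∈ S, MemLp Y 2 P) {Y : Ω → ℂ} (hY : Y ∈ Submodule.span ℂ S) :
    ∃ h : MemLp Y 2 P, h.toLp Y ∈ Submodule.span ℂ (lpClasses P S) := by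
  induction hY using Submodule.span_induction with
  | mem Y h => exact ⟨hS Y h, Submodule.subset_span ⟨Y, h, (hS Y h).coeFn_toLp⟩⟩
  | zero => exact ⟨MemLp.zero, by rw [MemLp.toLp_zero]; exact Submodule.zero_mem _⟩
  | add X Y _ _ hX hY =>
    obtain ⟨h1, h1'⟩ := hX
    obtain ⟨h2, h2'⟩ := hY
    exact ⟨h1.add h2, by rw [MemLp.toLp_add h1 h2]; exact Submodule.add_mem _ h1' h2'⟩
  | smul c X _ hX =>
    obtain ⟨h1, h1'⟩ := hX
    exact ⟨h1.const_smul c, by rw [MemLp.toLp_const_smul c h1]; exact Submodule.smul_mem _ _ h1'⟩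

lemma exists_mem_span_ae_eq {v : Lp ℂ 2 P} (hv : v ∈ Submodule.span ℂ (lpClasses P S)) :
    ∃ Y ∈ Submodule.span ℂ S, v =ᵐ[P] Y := by
  induction hv using Submodule.span_induction with
  | mem v h =>
    obtain ⟨Y, hY, h⟩ := h
    exact ⟨Y, Submodule.subset_span hY, h⟩
  | zero => exact ⟨0, Submodule.zero_mem _, Lp.coeFn_zero _ _ _⟩
  | add v w _ _ hv hw =>
    obtain ⟨X, hX, h1⟩ := hv
    obtain ⟨Y, hY, h2⟩ := hw
    exact ⟨X + Y, Submodule.add_mem _ hX hY, (Lp.coeFn_add v w).trans (h1.add h2)⟩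
  | smul c v _ hv =>
    obtain ⟨X, hX, h1⟩ := hv
    exact ⟨c • X, Submodule.smul_mem _ _ hX, (Lp.coeFn_smul c v).trans (h1.const_smul c)⟩

lemma mem_closedSpan_iff (hS : ∀ Y ∈ S, MemLp Y 2 P) {X : Ω → ℂ} :
    X ∈ closedSpan P S ↔ ∃ h : MemLp X 2 P, h.toLp X ∈ cspan (lpClasses P S) := by
  rw [closedSpan, Set.mem_ofPred_eq, ← exists_prop]
  refine exists_congr fun hX => ?_
  change _ ↔ hX.toLp X ∈ closure (Submodule.span ℂ (lpClasses P S) : Set (Lp ℂ 2 P))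
  rw [EMetric.mem_closure_iff]
  constructor
  · intro h δ hδ
    obtain ⟨δ', hδ', hlt⟩ := exists_between hδ
    obtain ⟨Y, hY, hle⟩ := h δ' hδ'
    obtain ⟨hYm, hYs⟩ := exists_toLp_mem_span hS hY
    exact ⟨_, hYs, by rw [Lp.edist_toLp_toLp]; exact hle.trans_lt hlt⟩
  · intro h δ hδ
    obtain ⟨v, hv, hlt⟩ := h δ hδ
    obtain ⟨Y, hY, hvY⟩ := exists_mem_span_ae_eq hv
    refine ⟨Y, hY, ?_⟩
    rw [Lp.edist_def] at hlt
    refine (eLpNorm_congr_ae ?_).trans_le hlt.le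
    exact hX.coeFn_toLp.symm.sub hvY.symm

end ClosedSpan

/-! ### The shift group on the circle -/

/-- Multiplication by `e^{ikt}`. -/
def shift (k : ℤ) : Lp ℂ 2 circ →ₗᵢ[ℂ] Lp ℂ 2 circ where
  toFun v := (memLp_expo_mul k (Lp.memLp v)).toLp _
  map_add' v w := by
    rw [← MemLp.toLp_add, MemLp.toLp_eq_toLp_iff]
    filter_upwards [Lp.coeFn_add v w] with t ht
    rw [ht, Pi.add_apply, Pi.add_apply, mul_add]
  map_smul' c v := by
    rw [RingHom.id_apply, ← MemLp.toLp_const_smul, MemLp.toLp_eq_toLp_iff]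
    filter_upwards [Lp.coeFn_smul c v] with t ht
    rw [ht, Pi.smul_apply, Pi.smul_apply, smul_eq_mul, smul_eq_mul, mul_left_comm]
  norm_map' v := by
    refine (pow_left_inj₀ (norm_nonneg _) (norm_nonneg _) two_ne_zero).1 ?_
    conv_rhs => rw [← Lp.toLp_coeFn v (Lp.memLp v)]
    change ‖(memLp_expo_mul k (Lp.memLp v)).toLp _‖ ^ 2 = _
    rw [norm_toLp_sq, norm_toLp_sq]
    simp

lemma shift_toLp (k : ℤ) {F : ℝ → ℂ} (hF : MemLp F 2 circ) :
    shift k (hF.toLp F) = (memLp_expo_mul k hF).toLp _ := by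
  change (memLp_expo_mul k (Lp.memLp (hF.toLp F))).toLp _ = _
  rw [MemLp.toLp_eq_toLp_iff]
  filter_upwards [hF.coeFn_toLp] with t ht
  rw [ht]

lemma isShift_shift : IsShift shift where
  zero v := by
    rw [← Lp.toLp_coeFn v (Lp.memLp v), shift_toLp, MemLp.toLp_eq_toLp_iff]
    exact Eventually.of_forall fun t => by simp
  add j k v := by
    rw [← Lp.toLp_coeFn v (Lp.memLp v), shift_toLp, shift_toLp, shift_toLp, MemLp.toLp_eq_toLp_iff]
    exact Eventually.of_forall fun t => by simp only [expo_add, mul_assoc]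

lemma shift_expoBasis (j k : ℤ) : shift j (expoBasis k) = expoBasis (j + k) := by
  rw [expoBasis_apply, shift_toLp, expoBasis_apply, MemLp.toLp_eq_toLp_iff]
  exact Eventually.of_forall fun t => by simp only [expo_add]

lemma toLp_eval_mul_mem_past (p : Polynomial ℂ) {G : ℝ → ℂ} (hG : MemLp G 2 circ)
    (h : MemLp (fun t => p.eval (expo (-1) t) * G t) 2 circ) :
    h.toLp _ ∈ past shift (hG.toLp G) 0 := by
  have hF : ∀ i : ℕ, MemLp (fun t => expo (-(i : ℤ)) t * G t) 2 circ := fun i =>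
    memLp_expo_mul _ hG
  have e : (fun t => p.eval (expo (-1) t) * G t) =
      fun t => ∑ i ∈ Finset.range (p.natDegree + 1), p.coeff i * (expo (-(i : ℤ)) t * G t) := by
    funext t
    rw [Polynomial.eval_eq_sum_range, Finset.sum_mul]
    refine Finset.sum_congr rfl fun i _ => ?_
    rw [← expo_mul_natCast, mul_assoc, neg_one_mul]
  have h' := memLp_sum_mul (Finset.range (p.natDegree + 1)) p.coeff hF
  have e2 : h.toLp _ = h'.toLp _ := by
    rw [MemLp.toLp_eq_toLp_iff, e]
  rw [e2, ← sum_smul_toLp _ _ hF h']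
  refine Submodule.sum_mem _ fun i _ => Submodule.smul_mem _ _ ?_
  rw [← shift_toLp _ hG]
  exact mem_past (by omega)

lemma Hardy.toLp_mem_past {F : ℝ → ℂ} (hF : Hardy F) :
    hF.1.toLp F ∈ past shift (expoBasis 0) 0 := by
  refine (isClosed_past _ _).mem_of_tendsto (hasSum_toLp_fourier hF.1)
    (Eventually.of_forall fun s => Submodule.sum_mem _ fun j _ => ?_)
  by_cases hj : 0 < j
  · rw [hF.2 j hj, zero_smul]; exact Submodule.zero_mem _
  · refine Submodule.smul_mem _ _ ?_
    have := mem_past (U := shift) (v := expoBasis 0) (not_lt.1 hj)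
    rwa [shift_expoBasis, add_zero] at this

/-- The past at time `t` of a Hardy function contains no frequency above `t`, so a vector in all
pasts has no frequency at all. -/
lemma Hardy.eq_zero_of_forall_mem_past {F : ℝ → ℂ} (hF : Hardy F) {v : Lp ℂ 2 circ}
    (hv : ∀ t, v ∈ past shift (hF.1.toLp F) t) : v = 0 := by
  have h0 : ∀ k, inner ℂ (expoBasis k) v = 0 := fun k => by
    refine inner_eq_zero_of_mem_cspan ?_ (hv (k - 1))
    rintro _ ⟨j, hj, rfl⟩
    rw [shift_toLp, expoBasis_inner, fc_expo_mul, hF.2 _ (by omega)]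
  have h := expoBasis.hasSum_repr v
  simp only [HilbertBasis.repr_apply_apply, h0, zero_smul] at h
  exact h.unique hasSum_zero

/-! ### Moving averages -/

section MovingAverage

variable {n : ℕ} {f : ℝ → ℝ} {g : ℝ → ℂ}

/-- $(1-z^k)^n=(1+z+\dots+z^{k-1})^n(1-z)^n$ with $z=e^{-it}$, so the increments of step 1 generate
the past of all positive steps. -/
lemma IsSpectralFactor.toLp_specIncr_mem_past (hg : IsSpectralFactor n f g)
    (hf : Integrable f circ) (k : ℕ) :
    (hg.memLp hf k).toLp _ ∈ past shift ((hg.memLp hf 1).toLp _) 0 := by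
  have e : ∀ t, specIncr n g k t =
      ((∑ i ∈ Finset.range k, (Polynomial.X : Polynomial ℂ) ^ i) ^ n).eval (expo (-1) t) *
        specIncr n g 1 t := fun t => by
    have h1 := mul_neg_geom_sum (expo (-1) t) k
    rw [← expo_mul_natCast, neg_one_mul] at h1
    simp only [specIncr, Polynomial.eval_pow, Polynomial.eval_finsetSum, Polynomial.eval_X,
      Nat.cast_one]
    rw [← h1, mul_pow]
    ring
  have h' := (memLp_congr_ae (Eventually.of_forall e)).1 (hg.memLp hf k)
  have e2 : (hg.memLp hf k).toLp _ = h'.toLp _ := by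
    rw [MemLp.toLp_eq_toLp_iff]; exact Eventually.of_forall e
  rw [e2]
  exact toLp_eval_mul_mem_past _ (hg.memLp hf 1) h'

variable {Ω : Type u} [MeasurableSpace Ω] {P : Measure Ω} [IsProbabilityMeasure P]
  {ξ : ℤ → Ω → ℂ}

/-- The orbit of `η` is transported to random variables by the isometry built from the increments of
all steps at once. Mutual membership in the pasts gives equality of the closed spans, and the
orthogonal expansion of the spectral increment becomes the moving average. -/
theorem IsInnovationVec.isMovingAverage (hξ : HasSpectralDensity P n ξ f)
    (hg : IsSpectralFactor n f g) (hf : Integrable f circ) {η : Lp ℂ 2 circ}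
    (hη : IsInnovationVec shift ((hg.memLp hf 1).toLp _) η) (μ : ℕ) :
    IsMovingAverage P n μ ξ fun k => inner ℂ (shift (-k) η) ((hg.memLp hf μ).toLp _) := by
  set θ : Lp ℂ 2 circ := (hg.memLp hf 1).toLp _ with hθ
  set y : ℤ × ℕ → Lp ℂ 2 circ := fun p => (memLp_expo_mul p.1 (hg.memLp hf p.2)).toLp _ with hy
  set x : ℤ × ℕ → Lp ℂ 2 P := fun p => (hξ.memLp p.1 p.2).toLp _ with hx
  obtain ⟨T, hT, hTi⟩ := exists_isometry_of_gram (x := x) (y := y)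
    fun i j => hξ.inner_eq hg hf i.1 j.1 i.2 j.2
  have hys : ∀ m k, y (m, k) = shift m ((hg.memLp hf k).toLp _) := fun m k =>
    (shift_toLp m (hg.memLp hf k)).symm
  have hU := isShift_shift
  have hηθ : ∀ t, past shift η t ≤ past shift θ t := fun t => by
    simpa using hU.past_le hη.mem t
  have hθη : ∀ t, past shift θ t ≤ past shift η t := fun t => by
    simpa using hU.past_le hη.mem' t
  have hself : ∀ (v : Lp ℂ 2 circ) t, shift t v ∈ past shift v t := fun v t => mem_past le_rfl
  have hyθ : ∀ m k, y (m, k) ∈ past shift θ m := fun m k => by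
    rw [hys]
    simpa using hU.map_mem_past m (hg.toLp_specIncr_mem_past hf k)
  have hθy : ∀ t, past shift θ t ≤ cspan (Set.range y) := fun t => by
    refine cspan_mono ?_
    rintro _ ⟨j, -, rfl⟩
    exact ⟨(j, 1), hys j 1⟩
  have hηy : ∀ m, shift m η ∈ cspan (Set.range y) := fun m => hθy m (hηθ m (hself η m))
  set e : ℤ → Lp ℂ 2 P := fun m => T (shift m η) with he
  set SI : ℤ → Set (Ω → ℂ) := fun t =>
    {X | ∃ m μ : ℤ, m ≤ t ∧ 0 < μ ∧ X = increment n ξ m μ} with hSI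
  set SE : ℤ → Set (Ω → ℂ) := fun t => {X | ∃ m : ℤ, m ≤ t ∧ X = e m} with hSE
  have hSIm : ∀ t, ∀ Y ∈ SI t, MemLp Y 2 P := by
    rintro t _ ⟨m, k, -, -, rfl⟩; exact hξ.memLp m k
  have hSEm : ∀ t, ∀ Y ∈ SE t, MemLp Y 2 P := by
    rintro t _ ⟨m, -, rfl⟩; exact Lp.memLp _
  have hEI : ∀ m t, m ≤ t → e m ∈ cspan (lpClasses P (SI t)) := fun m t hm => by
    refine map_mem_of_mem_cspan (isClosed_cspan _) T ?_ (hηθ m (hself η m))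
    rintro _ ⟨j, hj, rfl⟩
    have : T (shift j θ) = x (j, 1) := by rw [← hT, hys]
    rw [this]
    exact subset_cspan ⟨_, ⟨j, (1 : ℕ), hj.trans hm, by simp, rfl⟩, (hξ.memLp j (1 : ℕ)).coeFn_toLp⟩
  have hIE : ∀ m t (k : ℕ), m ≤ t → x (m, k) ∈ cspan (lpClasses P (SE t)) := fun m t k hm => by
    rw [← hT]
    refine map_mem_of_mem_cspan (isClosed_cspan _) T ?_ (hθη m (hyθ m k))
    rintro _ ⟨j, hj, rfl⟩
    exact subset_cspan ⟨_, ⟨j, hj.trans hm, rfl⟩, EventuallyEq.rfl⟩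
  have hspan : ∀ t, cspan (lpClasses P (SI t)) = cspan (lpClasses P (SE t)) := fun t => by
    refine le_antisymm (cspan_le (isClosed_cspan _) ?_) (cspan_le (isClosed_cspan _) ?_)
    · rintro v ⟨_, ⟨m, k, hm, hk, rfl⟩, hv⟩
      lift k to ℕ using hk.le
      have : v = x (m, k) := Lp.ext (hv.trans (hξ.memLp m k).coeFn_toLp.symm)
      rw [this]
      exact hIE m t k hm
    · rintro v ⟨_, ⟨m, hm, rfl⟩, hv⟩
      rw [Lp.ext hv]
      exact hEI m t hm
  refine ⟨?_, fun m => e m, ⟨fun m => Lp.memLp _, fun m => ?_, fun m k => ?_, fun t => ?_⟩,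
    fun m => ?_⟩
  · exact (hη.orthonormal.comp (fun k : ℕ => -(k : ℤ)) fun a b h => by simpa using h
      ).inner_products_summable _
  -- Having mean zero is orthogonality to the constant 1, so it passes from the increments to their
  -- closed span.
  · have h1 : ∀ v : Lp ℂ 2 P, inner ℂ ((memLp_const (1 : ℂ)).toLp _) v = ∫ ω, v ω ∂P := fun v => by
      conv_lhs => rw [← Lp.toLp_coeFn v (Lp.memLp v)]
      rw [inner_toLp_eq_integral]
      simp
    rw [← h1]
    refine inner_eq_zero_of_mem_cspan ?_ (hEI m m le_rfl)
    rintro v ⟨_, ⟨j, k, -, -, rfl⟩, hv⟩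
    rw [h1, integral_congr_ae hv, hξ.mean]
  · have h1 : ∫ ω, e m ω * conj (e k ω) ∂P = inner ℂ (e k) (e m) := by
      rw [L2.inner_def]
      simp [RCLike.inner_apply]
    rw [h1, hTi _ (hηy k) _ (hηy m), orthonormal_iff_ite.1 hη.orthonormal k m]
    simp only [eq_comm]
  · ext X
    rw [pastIncrements, mem_closedSpan_iff (hSIm t), mem_closedSpan_iff (hSEm t), hspan]
  · have hv : (hg.memLp hf μ).toLp _ ∈ past shift η 0 :=
      hθη 0 (hg.toLp_specIncr_mem_past hf μ)
    have h1 := ((hη.hasSum hv).mapL (shift m).toContinuousLinearMap).mapL T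
    have h2 : T ((shift m).toContinuousLinearMap ((hg.memLp hf μ).toLp _)) =
        (hξ.memLp m μ).toLp _ := by
      have h := hT (m, μ)
      rw [hys] at h
      exact h
    have h3 : ∀ k : ℕ, T ((shift m).toContinuousLinearMap
        (inner ℂ (shift (-k) η) ((hg.memLp hf μ).toLp _) • shift (-k) η)) =
        inner ℂ (shift (-k) η) ((hg.memLp hf μ).toLp (specIncr n g μ)) • e (m - k) := fun k => by
      have h : e (m - k) = T (shift m (shift (-k) η)) := by rw [← hU.add, ← sub_eq_add_neg]
      rw [map_smul, map_smul, h]; rfl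
    simp only [h2, h3] at h1
    have hS := fun N : ℕ => memLp_sum_mul (Finset.range N)
      (fun k : ℕ => inner ℂ (shift (-k) η) ((hg.memLp hf μ).toLp (specIncr n g μ)))
      (fun k : ℕ => Lp.memLp (e (m - k)))
    have h4 := h1.tendsto_sum_nat
    have h5 : ∀ N : ℕ, ∑ k ∈ Finset.range N,
        inner ℂ (shift (-k) η) ((hg.memLp hf μ).toLp (specIncr n g μ)) • e (m - k) =
        (hS N).toLp _ := fun N => by
      rw [← sum_smul_toLp _ _ (fun k : ℕ => Lp.memLp (e (m - k))) (hS N)]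
      simp only [Lp.toLp_coeFn]
    simp only [h5] at h4
    rw [Lp.tendsto_Lp_iff_tendsto_eLpNorm''] at h4
    refine h4.congr fun N => ?_
    exact eLpNorm_sub_comm _ _ 2 P

/-! ### The spectral factor of a density with a given factorization -/

section Factor

variable {φ : ℕ → ℂ} {F : ℝ → ℂ}

/-- Among all factors of the density, this choice of phase puts the spectral images of the
increments in the Hardy space. -/
lemma isSpectralFactor_kappa_mul (n : ℕ) (hF : IsFourierSum (-1) φ F)
    (hfF : f =ᵐ[circ] fun t => ‖F t‖ ^ 2) : IsSpectralFactor n f fun t => kappa n t * F t := by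
  refine ⟨(aesm_kappa n).mul (isFourierSum_neg_one_iff.1 hF).1.1.1, ?_⟩
  filter_upwards [hfF, norm_kappa n] with t h1 h2
  rw [norm_mul, h2, h1, mul_pow, inv_pow, ← pow_mul, mul_comm n 2, pow_mul |t|, sq_abs, ← pow_mul]
  ring

lemma specIncr_kappa_mul (n : ℕ) {μ : ℕ} (hμ : 1 ≤ μ) (F : ℝ → ℂ) :
    specIncr n (fun t => kappa n t * F t) μ =ᵐ[circ] fun t => wBdry n μ t * F t := by
  filter_upwards [wBdry_eq n hμ] with t ht
  rw [specIncr, ht, mul_assoc]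

lemma hardy_specIncr_kappa_mul (n : ℕ) {μ : ℕ} (hμ : 1 ≤ μ) (hF : IsFourierSum (-1) φ F) :
    Hardy (specIncr n (fun t => kappa n t * F t) μ) :=
  (isFourierSum_neg_one_iff.1 (isFourierSum_opW n hμ hF)).1.congr (specIncr_kappa_mul n hμ F).symm

/-- The spectral increment of step 1 is a nonzero Hardy function, so its pasts have trivial
intersection and an innovation exists, whether or not `φ` is canonical. -/
theorem exists_isMovingAverage (hξ : HasSpectralDensity P n ξ f) (hF : IsFourierSum (-1) φ F)
    (hfF : f =ᵐ[circ] fun t => ‖F t‖ ^ 2) (hφ : 0 < sqNorm φ) (μ : ℕ) :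
    ∃ ψ, IsMovingAverage P n μ ξ ψ := by
  have hg := isSpectralFactor_kappa_mul n hF hfF
  have hf : Integrable f circ :=
    (integrable_congr hfF).2 (integrable_norm_sq (isFourierSum_neg_one_iff.1 hF).1.1)
  have hH := hardy_specIncr_kappa_mul n le_rfl hF
  have hne : (hg.memLp hf 1).toLp _ ≠ 0 := by
    intro h0
    have h3 := (hg.memLp hf 1).coeFn_toLp
    rw [h0] at h3
    have hF0 : (fun t => ‖F t‖ ^ 2) =ᵐ[circ] 0 := by
      filter_upwards [h3, specIncr_kappa_mul n le_rfl F, Lp.coeFn_zero ℂ 2 circ] with t h1 h2 h4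
      rw [← h1, h4, Pi.zero_apply, eq_comm, mul_eq_zero, wBdry] at h2
      simp [h2.resolve_left (Complex.exp_ne_zero _)]
    rw [sqNorm, (hF.hasSum_sq (by norm_num)).tsum_eq, integral_congr_ae hF0] at hφ
    simp at hφ
  obtain ⟨η, hη⟩ := isShift_shift.exists_innovation hne fun v hv => hH.eq_zero_of_forall_mem_past hv
  exact ⟨_, hη.isMovingAverage hξ hg hf μ⟩

/-- The innovation is the constant function 1: $w_1F$ has only nonpositive frequencies, and 1 is a
limit of polynomial multiples of $w_1F$. The coefficients are then those of $w_\mu F$, namely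
$W^\mu\varphi$. -/
theorem IsCanonical.isMovingAverage (hφ : IsCanonical φ) (hξ : HasSpectralDensity P n ξ f)
    (hF : IsFourierSum (-1) φ F) (hfF : f =ᵐ[circ] fun t => ‖F t‖ ^ 2) {μ : ℕ} (hμ : 1 ≤ μ) :
    IsMovingAverage P n μ ξ (opW n μ φ) := by
  have hg := isSpectralFactor_kappa_mul n hF hfF
  have hf : Integrable f circ :=
    (integrable_congr hfF).2 (integrable_norm_sq (isFourierSum_neg_one_iff.1 hF).1.1)
  have hH := hardy_specIncr_kappa_mul n le_rfl hF
  have hshift : ∀ j, shift j (expoBasis 0) = expoBasis j := fun j => by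
    rw [shift_expoBasis, add_zero]
  have hη : IsInnovationVec shift ((hg.memLp hf 1).toLp _) (expoBasis 0) := by
    refine ⟨?_, ?_, hH.toLp_mem_past⟩
    · simp only [hshift]; exact expoBasis.orthonormal
    · obtain ⟨Y, hY, ⟨C, hC⟩, hFY⟩ := hφ.exists_hardy_inv hF
      rw [← SetLike.mem_coe, ← (isClosed_past _ _).closure_eq]
      refine Metric.mem_closure_iff.2 fun δ hδ => ?_
      -- With $Y=1/F$ and $f=|F|^2$, closeness of $pw_1$ to $Y$ in $L_2(f)$ is closeness of $pw_1F$
      -- to 1 in $L_2$.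
      obtain ⟨p, hp⟩ := (isCompletion_wLog n (le_refl 1)).exists_polynomial (wExp_le n le_rfl) hY
        (Eventually.of_forall hC) hf (by filter_upwards [hfF] with t ht; rw [ht]; positivity)
        (pow_pos hδ 2)
      obtain ⟨B, hB⟩ := norm_eval_expo_le p
      have hm : MemLp (fun t => p.eval (expo (-1) t) *
          specIncr n (fun t => kappa n t * F t) 1 t) 2 circ :=
        memLp_bdd_mul (continuous_eval_expo p).aestronglyMeasurable (Eventually.of_forall hB)
          (hg.memLp hf 1)
      refine ⟨hm.toLp _, toLp_eval_mul_mem_past p (hg.memLp hf 1) hm, ?_⟩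
      rw [expoBasis_apply, dist_eq_norm, ← MemLp.toLp_sub]
      refine lt_of_pow_lt_pow_left₀ 2 hδ.le ?_
      rw [norm_toLp_sq]
      refine lt_of_eq_of_lt (integral_congr_ae ?_) hp
      filter_upwards [hfF, hFY, specIncr_kappa_mul n (le_refl 1) F] with t h1 h2 h3
      rw [h1, Pi.sub_apply, h3, ← mul_pow, ← norm_mul, expo_zero, ← h2, wBdry]
      congr 2; ring
  convert hη.isMovingAverage hξ hg hf μ using 2 with k
  rw [hshift, expoBasis_inner, fc_congr (specIncr_kappa_mul n hμ F),
    (isFourierSum_neg_one_iff.1 (isFourierSum_opW n hμ hF)).2]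

end Factor

end MovingAverage

end Extrapolation

end

/-! ### Assembly of the theorem. -/

theorem theorem5p1 (n μ : ℕ) (hn : 1 ≤ n) (hμ : 1 ≤ μ) (a : ℕ → ℂ) (ha : Admissible n μ a)
    (P₀ : ℝ) (hP₀ : 0 < P₀) :
    -- `optimalError` is the mean square error of the optimal linear estimate of the functional
    (∀ f ∈ classD0 P₀, ∀ (Ω : Type u) [MeasurableSpace Ω] (P : Measure Ω) [IsProbabilityMeasure P]
      (ξ : ℤ → Ω → ℂ), HasSpectralDensity P n ξ f →
        (∃ X, IsFunctionalA P n μ a ξ X) ∧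
        ∀ X, IsFunctionalA P n μ a ξ X → leastMSE P n μ a ξ X = optimalError n μ a f) ∧
    -- the case `ν₀ = ν₀⁺`
    (∀ (φ₀ : ℕ → ℂ) (ν₀ νp : ℝ), SolvesEigen n μ a φ₀ → sqNorm φ₀ = P₀ →
      IsGreatest (eigenValues n μ a P₀) (ν₀ * P₀) →
      IsGreatest (extremalValues n μ a P₀) (νp * P₀) →
      ν₀ = νp → νp * P₀ = sqNorm (opDAW n μ a φ₀) →
      (∃ f₀, IsDensityOf φ₀ f₀) ∧
      ∀ f₀, IsDensityOf φ₀ f₀ →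
        IsLeastFavorable n μ a (classD0 P₀) f₀ ∧
        ∀ (Ω : Type u) [MeasurableSpace Ω] (P : Measure Ω) [IsProbabilityMeasure P]
          (ξ : ℤ → Ω → ℂ), HasSpectralDensity P n ξ f₀ →
            (∃ ψ, IsMovingAverage P n μ ξ ψ) ∧
            (IsCanonical φ₀ → IsMovingAverage P n μ ξ (opW n μ φ₀))) ∧
    -- the case `ν₀ < ν₀⁺`; the set defining `ν₀` may be empty here
    (∀ νp : ℝ, IsGreatest (extremalValues n μ a P₀) (νp * P₀) →
      (∀ x ∈ eigenValues n μ a P₀, x < νp * P₀) →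
      (∃ (φ : ℕ → ℂ) (c : ℂ) (f₀ : ℝ → ℝ), IsCanonical φ ∧ IsDensityOf φ f₀ ∧
        SolvesExtremum n μ a (classD0 P₀) φ ∧
        ∫ t in (-Real.pi)..Real.pi, f₀ t = 2 * Real.pi * P₀ ∧
        IsExtremalForm n μ a φ c f₀) ∧
      ∀ (φ : ℕ → ℂ) (f₀ : ℝ → ℝ), IsCanonical φ → IsDensityOf φ f₀ →
        ∫ t in (-Real.pi)..Real.pi, f₀ t = 2 * Real.pi * P₀ →
        (SolvesExtremum n μ a (classD0 P₀) φ ↔ ∃ c : ℂ, IsExtremalForm n μ a φ c f₀) ∧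
        (SolvesExtremum n μ a (classD0 P₀) φ → IsLeastFavorable n μ a (classD0 P₀) f₀)) := by
  refine ⟨fun f hf Ω _ P _ ξ hξ => exists_functionalA_and_leastMSE_eq ha hf hξ,
    fun φ₀ ν₀ νp hE hP₀φ _ hνp _ hν => ⟨?_, fun f₀ hf₀ => ⟨?_, fun Ω _ P _ ξ hξ => ?_⟩⟩,
    fun νp hνp _ => extremum_of_isGreatest ha hμ hνp.1⟩
  · obtain ⟨F, hF⟩ := exists_isFourierSum (σ := -1) (by norm_num) hE.1
    exact ⟨fun t => ‖F t‖ ^ 2, F, hF, EventuallyEq.rfl⟩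
  -- The certificate comes from a canonical maximiser in `extremalValues`, not from `φ₀`, which may
  -- fail to be canonical; `φ₀` only has to attain the same value.
  · obtain ⟨ν, U, -, hU, h⟩ := exists_certificate_of_mem ha hμ hνp.1
    exact hU.isLeastFavorable ha hμ hf₀ hP₀φ.le (h ▸ hν.le)
  · obtain ⟨F, hF, hfF⟩ := hf₀.ae_eq
    exact ⟨exists_isMovingAverage hξ hF hfF (hP₀φ ▸ hP₀) μ,
      fun hφ => hφ.isMovingAverage hξ hF hfF hμ⟩
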